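/- Let $K$ and $K_o$ be discrete valuation fields with perfect residue fields, valuation rings $\mathcal O_K$, $\mathcal O_{K_o}$ and uniformizers $\pi$, $\pi_o$. Let $L/K$ and $L_o/K_o$ be finite Galois extensions with the same Galois group $G$, and let $\mathcal O_L$, $\mathcal O_{L_o}$ be the integral closures of $\mathcal O_K$ in $L$ and of $\mathcal O_{K_o}$ in $L_o$. Put $v_K(\mathfrak D_{L/K}) = v_P(\mathfrak D_{L/K})/e_P$, where $\mathfrak D_{L/K}$ is the different of $\mathcal O_L/\mathcal O_K$, $P$ is a maximal ideal of $\mathcal O_L$ and $e_P$ its ramification index over $\mathcal O_K$ (this does not depend on $P$), and let $[\,\cdot\,]$ denote the integral part. Let $E$ be an elliptic curve over $K$ and $E_o$ an elliptic curve over $K_o$. A Weierstrass model of $E$ over $\mathcal O_K$ is a closed subscheme of $\mathbb P^2_{\mathcal O_K}$ defined by a Weierstrass equation with coefficients in $\mathcal O_K$, together with an isomorphism of its generic fiber with $E$ sending $[0:1:0]$ to the origin; it is pointed by the section $[0:1:0]$, and it is minimal if the ideal generated by its discriminant is the biggest among all Weierstrass models of $E$ over $\mathcal O_K$. The same definitions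 apply over $\mathcal O_L$, $\mathcal O_{K_o}$ and $\mathcal O_{L_o}$. Let $\mathcal W$, $\mathcal W'$, $\mathcal W_o$, $\mathcal W'_o$ be the minimal Weierstrass models of $E$ over $\mathcal O_K$, of $E_L$ over $\mathcal O_L$, of $E_o$ over $\mathcal O_{K_o}$ and of $(E_o)_{L_o}$ over $\mathcal O_{L_o}$, and let $\epsilon'$, $\epsilon'_o$ be the sections at infinity of $\mathcal W'$, $\mathcal W'_o$. The group $G$ acts on $\mathcal W'$, compatibly with its action on $\mathcal O_L$, by the unique extension of its action on $E_L=E\times_K L$, and similarly on $\mathcal W'_o$. A subscript $n\ge 0$ denotes reduction modulo $\pi^{n+1}$ (resp. $\pi_o^{n+1}$): $\mathcal O_{K,n}=\mathcal O_K/\pi^{n+1}\mathcal O_K$, $\mathcal O_{L,n}=\mathcal O_L/\pi^{n+1}\mathcal O_L$, $\mathcal Z_n=\mathcal Z\times_{\operatorname{Spec}\mathcal O_K}\operatorname{Spec}\mathcal O_{K,n}$. Let $N\ge 0$ and $$m\ \ge\ N+12\,[v_K(\mathfrak D_{L/K})]+19 .$$ Suppose that there are a ring isomorphism $\psi:\mathcal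 O_{K,m}\simeq\mathcal O_{K_o,m}$, a $G$-equivariant ring isomorphism $\theta:\mathcal O_{L,m}\simeq\mathcal O_{L_o,m}$ compatible with $\psi$, and a $G$-equivariant isomorphism of schemes $\mathcal W'_m\simeq\mathcal W'_{o,m}$ compatible with $\theta$ and mapping $\epsilon'_m$ to $\epsilon'_{o,m}$. Then there is an isomorphism of pointed schemes $\mathcal W_N\simeq\mathcal W_{o,N}$, compatible with the isomorphism $\mathcal O_{K,N}\simeq\mathcal O_{K_o,N}$ induced by $\psi$. -/

import Mathlib

open CategoryTheory AlgebraicGeometry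

universe u

namespace WeierstrassCurve

section Scheme

variable {R : Type u} [CommRing R] (W : WeierstrassCurve R)

/-- The homogeneous coordinate ring `R[X, Y, Z] / (F)` of the plane cubic `F = 0`, where
`F = Y²Z + a₁XYZ + a₃YZ² - (X³ + a₂X²Z + a₄XZ² + a₆Z³)`. -/
abbrev HomogRing : Type u :=
  MvPolynomial (Fin 3) R ⧸ Ideal.span {Projective.polynomial W}

/-- The classes of the coordinates `X, Y, Z` in `R[X, Y, Z] / (F)`. -/
noncomputable def coord (i : Fin 3) : W.HomogRing :=
  Ideal.Quotient.mk _ (MvPolynomial.X i)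

/-- The grading of `R[X, Y, Z] / (F)` by the degree. -/
noncomputable def homogPart (n : ℕ) : Submodule R W.HomogRing :=
  (MvPolynomial.homogeneousSubmodule (Fin 3) R n).map
    (Ideal.Quotient.mkₐ R (Ideal.span {Projective.polynomial W})).toLinearMap

theorem polynomial_isHomogeneous : (Projective.polynomial W).IsHomogeneous 3 := by
  have hX (i : Fin 3) := MvPolynomial.isHomogeneous_X R i
  have hC (a : R) := MvPolynomial.isHomogeneous_C (Fin 3) a
  unfold Projective.polynomial
  refine .sub (.add (.add ?_ ?_) ?_) (.add (.add (.add ?_ ?_) ?_) ?_)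
  · exact ((hX 1).pow 2).mul (hX 2)
  · exact (((hC _).mul (hX 0)).mul (hX 1)).mul (hX 2)
  · exact ((hC _).mul (hX 1)).mul ((hX 2).pow 2)
  · exact (hX 0).pow 3
  · exact ((hC _).mul ((hX 0).pow 2)).mul (hX 2)
  · exact ((hC _).mul (hX 0)).mul ((hX 2).pow 2)
  · exact (hC _).mul ((hX 2).pow 3)

theorem mk_mem_homogPart {p : MvPolynomial (Fin 3) R} {n : ℕ} (hp : p.IsHomogeneous n) :
    Ideal.Quotient.mk (Ideal.span {Projective.polynomial W}) p ∈ W.homogPart n :=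
  ⟨p, hp, rfl⟩

theorem coord_mem (i : Fin 3) : W.coord i ∈ W.homogPart 1 :=
  W.mk_mem_homogPart (MvPolynomial.isHomogeneous_X R i)

instance homogPart_gradedMonoid : SetLike.GradedMonoid W.homogPart where
  one_mem := ⟨1, MvPolynomial.isHomogeneous_one _ _, rfl⟩
  mul_mem := by
    rintro i j _ _ ⟨p, hp, rfl⟩ ⟨q, hq, rfl⟩
    exact ⟨p * q, MvPolynomial.IsHomogeneous.mul hp hq, map_mul (Ideal.Quotient.mk _) p q⟩

attribute [local instance] MvPolynomial.gradedAlgebra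

/-- The reduction map `R[X, Y, Z]ₙ → (R[X, Y, Z] / (F))ₙ`. -/
noncomputable def toHomogPart (n : ℕ) :
    MvPolynomial.homogeneousSubmodule (Fin 3) R n →ₗ[R] W.homogPart n :=
  ((Ideal.Quotient.mkₐ R (Ideal.span {Projective.polynomial W})).toLinearMap.domRestrict
    _).codRestrict _ fun p => ⟨p.1, p.2, rfl⟩

/-- The direct sum of the reduction maps `R[X, Y, Z]ₙ → (R[X, Y, Z] / (F))ₙ`. -/
noncomputable def sumToHomogPart :
    (DirectSum ℕ fun n => MvPolynomial.homogeneousSubmodule (Fin 3) R n) →ₐ[R]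
      DirectSum ℕ fun n => W.homogPart n :=
  DirectSum.toAlgebra R (fun n => MvPolynomial.homogeneousSubmodule (Fin 3) R n)
    (fun n => (DirectSum.lof R ℕ (fun n => W.homogPart n) n).comp (W.toHomogPart n))
    rfl (fun {i j} p q => by
      simp only [LinearMap.comp_apply, DirectSum.lof_eq_of]
      rw [DirectSum.of_mul_of]
      congr 1)

theorem sumToHomogPart_of (n : ℕ) (p : MvPolynomial.homogeneousSubmodule (Fin 3) R n) :
    W.sumToHomogPart (DirectSum.of _ n p) =
      DirectSum.of (fun n => W.homogPart n) n (W.toHomogPart n p) :=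
  DirectSum.toAddMonoid_of _ _ _

/-- The decomposition of (the class of) a polynomial into its homogeneous parts. -/
noncomputable def polyDecompose :
    MvPolynomial (Fin 3) R →ₐ[R] DirectSum ℕ fun n => W.homogPart n :=
  W.sumToHomogPart.comp
    (DirectSum.decomposeAlgEquiv (MvPolynomial.homogeneousSubmodule (Fin 3) R)).toAlgHom

theorem polyDecompose_of_isHomogeneous {p : MvPolynomial (Fin 3) R} {n : ℕ}
    (hp : p.IsHomogeneous n) :
    W.polyDecompose p = DirectSum.of (fun n => W.homogPart n) n ⟨_, W.mk_mem_homogPart hp⟩ := by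
  have h : DirectSum.decompose (MvPolynomial.homogeneousSubmodule (Fin 3) R) p =
      DirectSum.of _ n ⟨p, hp⟩ := DirectSum.decompose_of_mem _ hp
  have h2 : W.polyDecompose p =
      W.sumToHomogPart (DirectSum.decompose (MvPolynomial.homogeneousSubmodule (Fin 3) R) p) := rfl
  rw [h2, h, sumToHomogPart_of]
  rfl

noncomputable instance homogPart_gradedAlgebra : GradedAlgebra W.homogPart :=
  GradedAlgebra.ofAlgHom W.homogPart
    (Ideal.Quotient.liftₐ (Ideal.span {Projective.polynomial W}) W.polyDecompose (by
      intro a ha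
      have : Ideal.span {Projective.polynomial W} ≤ RingHom.ker W.polyDecompose := by
        rw [Ideal.span_singleton_le_iff_mem, RingHom.mem_ker,
          W.polyDecompose_of_isHomogeneous W.polynomial_isHomogeneous]
        convert map_zero (DirectSum.of (fun n => W.homogPart n) 3)
        exact Ideal.Quotient.eq_zero_iff_mem.mpr (Ideal.mem_span_singleton_self _)
      exact this ha))
    (by
      refine Ideal.Quotient.algHom_ext _ (MvPolynomial.algHom_ext fun i => ?_)
      change DirectSum.coeAlgHom W.homogPart (W.polyDecompose (MvPolynomial.X i)) = _
      rw [W.polyDecompose_of_isHomogeneous (MvPolynomial.isHomogeneous_X R i),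
        DirectSum.coeAlgHom_of]
      rfl)
    (by
      rintro i ⟨_, p, hp, rfl⟩
      exact W.polyDecompose_of_isHomogeneous hp)

/-- The closed subscheme of `ℙ²_R` defined by the homogeneous Weierstrass equation of `W`. -/
noncomputable abbrev scheme : Scheme.{u} :=
  Proj W.homogPart

/-- The structure morphism of `W.scheme` over `Spec R`. -/
noncomputable def toSpec : W.scheme ⟶ Spec (.of R) :=
  Proj.toSpecZero W.homogPart ≫ Spec.map (CommRingCat.ofHom (algebraMap R (W.homogPart 0)))

/-- Evaluation of homogeneous polynomials at `(X, Y, Z) = (0, 1, 0)`. -/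
noncomputable def evalInfinity : W.HomogRing →+* R :=
  Ideal.Quotient.lift _ (MvPolynomial.eval ![0, 1, 0]) (by
    intro a ha
    have : Ideal.span {Projective.polynomial W} ≤ RingHom.ker (MvPolynomial.eval ![0, 1, 0]) := by
      rw [Ideal.span_singleton_le_iff_mem, RingHom.mem_ker, Projective.eval_polynomial]
      simp
    exact this ha)

theorem evalInfinity_coord_one : W.evalInfinity (W.coord 1) = 1 := by
  change MvPolynomial.eval ![0, 1, 0] (MvPolynomial.X 1) = (1 : R)
  simp

/-- The section `Spec R ⟶ W.scheme` given by the point at infinity `[0 : 1 : 0]`. -/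
noncomputable def infinity : Spec (.of R) ⟶ W.scheme :=
  Proj.fromOfGlobalSections W.homogPart
    ((Scheme.ΓSpecIso (.of R)).inv.hom.comp W.evalInfinity) (by
      rw [Ideal.eq_top_iff_one]
      have h := Ideal.mem_map_of_mem
        ((Scheme.ΓSpecIso (.of R)).inv.hom.comp W.evalInfinity)
        (HomogeneousIdeal.mem_irrelevant_of_mem W.homogPart one_pos (W.coord_mem 1))
      rwa [RingHom.comp_apply, evalInfinity_coord_one, map_one] at h)

theorem infinity_toSpec : W.infinity ≫ W.toSpec = 𝟙 _ := by
  rw [infinity, toSpec, Proj.fromOfGlobalSections_toSpecZero_assoc, ← Spec.map_comp,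
    ← CommRingCat.ofHom_comp]
  have h : (((Scheme.ΓSpecIso (.of R)).inv.hom.comp W.evalInfinity).comp
      (algebraMap (W.homogPart 0) W.HomogRing)).comp (algebraMap R (W.homogPart 0)) =
      (Scheme.ΓSpecIso (.of R)).inv.hom := by
    ext r
    change (Scheme.ΓSpecIso (.of R)).inv.hom
      (MvPolynomial.eval ![0, 1, 0] (MvPolynomial.C r)) = _
    rw [MvPolynomial.eval_C]
  rw [h, CommRingCat.ofHom_hom]
  simp

end Scheme

section Functoriality

variable {R S : Type u} [CommRing R] [CommRing S]

/-- Let `W₁`, `W₂` be Weierstrass equations over `R` and `S` such that the change of variables `C`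
over `S` transforms the image of `W₁` under `φ : R → S` into `W₂`. This is the homomorphism
`R[X, Y, Z] → S[X, Y, Z] / (F₂)` which is `φ` on the coefficients and sends
`X ↦ u²X + rZ`, `Y ↦ u³Y + u²sX + tZ`, `Z ↦ Z`. -/
noncomputable def polyChange (W₂ : WeierstrassCurve S) (φ : R →+* S) (C : VariableChange S) :
    MvPolynomial (Fin 3) R →+* W₂.HomogRing :=
  MvPolynomial.eval₂Hom ((algebraMap S W₂.HomogRing).comp φ)
    ![algebraMap S _ (C.u ^ 2) * W₂.coord 0 + algebraMap S _ C.r * W₂.coord 2,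
      algebraMap S _ (C.u ^ 3) * W₂.coord 1 + algebraMap S _ (C.u ^ 2 * C.s) * W₂.coord 0
        + algebraMap S _ C.t * W₂.coord 2,
      W₂.coord 2]

theorem coord_relation (W : WeierstrassCurve S) :
    W.coord 1 ^ 2 * W.coord 2 + algebraMap S _ W.a₁ * W.coord 0 * W.coord 1 * W.coord 2
      + algebraMap S _ W.a₃ * W.coord 1 * W.coord 2 ^ 2
      - (W.coord 0 ^ 3 + algebraMap S _ W.a₂ * W.coord 0 ^ 2 * W.coord 2
        + algebraMap S _ W.a₄ * W.coord 0 * W.coord 2 ^ 2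
        + algebraMap S _ W.a₆ * W.coord 2 ^ 3) = 0 := by
  have h : Ideal.Quotient.mk (Ideal.span {Projective.polynomial W}) (Projective.polynomial W) = 0 :=
    Ideal.Quotient.eq_zero_iff_mem.mpr (Ideal.mem_span_singleton_self _)
  have key (q : MvPolynomial (Fin 3) S →+* W.HomogRing) : q (Projective.polynomial W) =
      q (.X 1) ^ 2 * q (.X 2) + q (.C W.a₁) * q (.X 0) * q (.X 1) * q (.X 2)
      + q (.C W.a₃) * q (.X 1) * q (.X 2) ^ 2
      - (q (.X 0) ^ 3 + q (.C W.a₂) * q (.X 0) ^ 2 * q (.X 2)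
        + q (.C W.a₄) * q (.X 0) * q (.X 2) ^ 2 + q (.C W.a₆) * q (.X 2) ^ 3) := by
    simp only [Projective.polynomial, map_sub, map_add, map_mul, map_pow]
  exact (key (Ideal.Quotient.mk _)).symm.trans h

theorem polyChange_polynomial {W₁ : WeierstrassCurve R} {W₂ : WeierstrassCurve S} {φ : R →+* S}
    {C : VariableChange S} (h : C • W₁.map φ = W₂) :
    polyChange W₂ φ C (Projective.polynomial W₁) = 0 := by
  have hu : (C.u : S) * ((C.u⁻¹ : Sˣ) : S) = 1 := C.u.mul_inv
  have e₁ : (C.u : S) * W₂.a₁ = φ W₁.a₁ + 2 * C.s := by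
    rw [← h, variableChange_a₁, map_a₁]
    linear_combination (φ W₁.a₁ + 2 * C.s) * hu
  have e₂ : (C.u : S) ^ 2 * W₂.a₂ = φ W₁.a₂ - C.s * φ W₁.a₁ + 3 * C.r - C.s ^ 2 := by
    rw [← h, variableChange_a₂, map_a₁, map_a₂]
    linear_combination (φ W₁.a₂ - C.s * φ W₁.a₁ + 3 * C.r - C.s ^ 2) * pow_mul_pow_eq_one 2 hu
  have e₃ : (C.u : S) ^ 3 * W₂.a₃ = φ W₁.a₃ + C.r * φ W₁.a₁ + 2 * C.t := by
    rw [← h, variableChange_a₃, map_a₁, map_a₃]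
    linear_combination (φ W₁.a₃ + C.r * φ W₁.a₁ + 2 * C.t) * pow_mul_pow_eq_one 3 hu
  have e₄ : (C.u : S) ^ 4 * W₂.a₄ = φ W₁.a₄ - C.s * φ W₁.a₃ + 2 * C.r * φ W₁.a₂
      - (C.t + C.r * C.s) * φ W₁.a₁ + 3 * C.r ^ 2 - 2 * C.s * C.t := by
    rw [← h, variableChange_a₄, map_a₁, map_a₂, map_a₃, map_a₄]
    linear_combination (φ W₁.a₄ - C.s * φ W₁.a₃ + 2 * C.r * φ W₁.a₂
      - (C.t + C.r * C.s) * φ W₁.a₁ + 3 * C.r ^ 2 - 2 * C.s * C.t) * pow_mul_pow_eq_one 4 hu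
  have e₆ : (C.u : S) ^ 6 * W₂.a₆ = φ W₁.a₆ + C.r * φ W₁.a₄ + C.r ^ 2 * φ W₁.a₂ + C.r ^ 3
      - C.t * φ W₁.a₃ - C.t ^ 2 - C.r * C.t * φ W₁.a₁ := by
    rw [← h, variableChange_a₆, map_a₁, map_a₂, map_a₃, map_a₄, map_a₆]
    linear_combination (φ W₁.a₆ + C.r * φ W₁.a₄ + C.r ^ 2 * φ W₁.a₂ + C.r ^ 3
      - C.t * φ W₁.a₃ - C.t ^ 2 - C.r * C.t * φ W₁.a₁) * pow_mul_pow_eq_one 6 hu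
  apply_fun algebraMap S W₂.HomogRing at e₁ e₂ e₃ e₄ e₆
  simp only [map_mul, map_add, map_sub, map_pow, map_ofNat] at e₁ e₂ e₃ e₄ e₆
  have hF := W₂.coord_relation
  simp only [polyChange, Projective.polynomial, MvPolynomial.coe_eval₂Hom, map_sub, map_add,
    map_mul, map_pow, MvPolynomial.eval₂_X, MvPolynomial.eval₂_C, RingHom.comp_apply,
    Matrix.cons_val_zero, Matrix.cons_val_one, Matrix.cons_val]
  generalize algebraMap S W₂.HomogRing (C.u : S) = u at *
  generalize algebraMap S W₂.HomogRing C.r = r at *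
  generalize algebraMap S W₂.HomogRing C.s = s at *
  generalize algebraMap S W₂.HomogRing C.t = t at *
  generalize W₂.coord 0 = x at *
  generalize W₂.coord 1 = y at *
  generalize W₂.coord 2 = z at *
  linear_combination u ^ 6 * hF - u ^ 5 * x * y * z * e₁ + u ^ 4 * x ^ 2 * z * e₂
    - u ^ 3 * y * z ^ 2 * e₃ + u ^ 2 * x * z ^ 2 * e₄ + z ^ 3 * e₆

/-- The homomorphism of homogeneous coordinate rings induced by `polyChange`. -/
noncomputable def ringChange {W₁ : WeierstrassCurve R} {W₂ : WeierstrassCurve S} (φ : R →+* S)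
    (C : VariableChange S) (h : C • W₁.map φ = W₂) : W₁.HomogRing →+* W₂.HomogRing :=
  Ideal.Quotient.lift _ (polyChange W₂ φ C) (by
    intro a ha
    have : Ideal.span {Projective.polynomial W₁} ≤ RingHom.ker (polyChange W₂ φ C) := by
      rw [Ideal.span_singleton_le_iff_mem, RingHom.mem_ker, polyChange_polynomial h]
    exact this ha)

theorem polyChange_X_zero (W₂ : WeierstrassCurve S) (φ : R →+* S) (C : VariableChange S) :
    polyChange W₂ φ C (.X 0) =
      algebraMap S _ (C.u ^ 2) * W₂.coord 0 + algebraMap S _ C.r * W₂.coord 2 :=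
  MvPolynomial.eval₂Hom_X' _ _ 0

theorem polyChange_X_one (W₂ : WeierstrassCurve S) (φ : R →+* S) (C : VariableChange S) :
    polyChange W₂ φ C (.X 1) = algebraMap S _ (C.u ^ 3) * W₂.coord 1
      + algebraMap S _ (C.u ^ 2 * C.s) * W₂.coord 0 + algebraMap S _ C.t * W₂.coord 2 :=
  MvPolynomial.eval₂Hom_X' _ _ 1

theorem polyChange_X_two (W₂ : WeierstrassCurve S) (φ : R →+* S) (C : VariableChange S) :
    polyChange W₂ φ C (.X 2) = W₂.coord 2 :=
  MvPolynomial.eval₂Hom_X' _ _ 2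

theorem polyChange_C (W₂ : WeierstrassCurve S) (φ : R →+* S) (C : VariableChange S) (a : R) :
    polyChange W₂ φ C (.C a) = algebraMap S _ (φ a) :=
  MvPolynomial.eval₂Hom_C _ _ a

theorem polyChange_X_mem (W₂ : WeierstrassCurve S) (φ : R →+* S) (C : VariableChange S)
    (i : Fin 3) : polyChange W₂ φ C (.X i) ∈ W₂.homogPart 1 := by
  have h (a : S) (j : Fin 3) : algebraMap S _ a * W₂.coord j ∈ W₂.homogPart 1 := by
    rw [← Algebra.smul_def]
    exact Submodule.smul_mem _ _ (W₂.coord_mem j)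
  match i with
  | 0 => exact polyChange_X_zero W₂ φ C ▸ add_mem (h _ 0) (h _ 2)
  | 1 => exact polyChange_X_one W₂ φ C ▸ add_mem (add_mem (h _ 1) (h _ 0)) (h _ 2)
  | 2 => exact polyChange_X_two W₂ φ C ▸ W₂.coord_mem 2

theorem polyChange_mem (W₂ : WeierstrassCurve S) (φ : R →+* S) (C : VariableChange S)
    {p : MvPolynomial (Fin 3) R} {n : ℕ} (hp : p.IsHomogeneous n) :
    polyChange W₂ φ C p ∈ W₂.homogPart n := by
  rw [p.as_sum, map_sum]
  refine Submodule.sum_mem _ fun d hd => ?_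
  rw [MvPolynomial.monomial_eq, map_mul, Finsupp.prod_fintype _ _ (fun _ => pow_zero _), map_prod]
  rw [polyChange_C, ← Algebra.smul_def]
  refine Submodule.smul_mem _ _ ?_
  have hn : n = ∑ i, d i * 1 := by
    rw [← hp (MvPolynomial.mem_support_iff.mp hd)]
    simp [Finsupp.weight_apply, Finsupp.sum_fintype]
  rw [hn]
  refine SetLike.prod_mem_graded _ _ _ fun i _ => ?_
  rw [map_pow]
  exact SetLike.pow_mem_graded _ (polyChange_X_mem W₂ φ C i)

/-- The graded homomorphism of homogeneous coordinate rings induced by `polyChange`. -/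
noncomputable def gradedChange {W₁ : WeierstrassCurve R} {W₂ : WeierstrassCurve S} (φ : R →+* S)
    (C : VariableChange S) (h : C • W₁.map φ = W₂) :
    GradedRingHom W₁.homogPart W₂.homogPart where
  __ := ringChange φ C h
  map_mem := by
    rintro i _ ⟨p, hp, rfl⟩
    exact polyChange_mem W₂ φ C hp

theorem irrelevant_le_of_coord_mem (W : WeierstrassCurve R) {I : Ideal W.HomogRing}
    (hI : ∀ i, W.coord i ∈ I) : (HomogeneousIdeal.irrelevant W.homogPart).toIdeal ≤ I := by
  rw [HomogeneousIdeal.toIdeal_irrelevant_le]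
  rintro n hn _ ⟨p, hp, rfl⟩
  change Ideal.Quotient.mk _ p ∈ I
  rw [p.as_sum, map_sum]
  refine Ideal.sum_mem _ fun d hd => ?_
  have hn' : n = ∑ i, d i := by
    rw [← hp (MvPolynomial.mem_support_iff.mp hd)]
    simp [Finsupp.weight_apply, Finsupp.sum_fintype]
  obtain ⟨i, hi⟩ : ∃ i, d i ≠ 0 := by
    by_contra! h
    simp [h] at hn'
    omega
  rw [MvPolynomial.monomial_eq, map_mul, Finsupp.prod_fintype _ _ (fun _ => pow_zero _), map_prod]
  refine Ideal.mul_mem_left _ _ (Ideal.mem_of_dvd _ (Finset.dvd_prod_of_mem _ (Finset.mem_univ i)) ?_)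
  rw [map_pow]
  exact Ideal.pow_mem_of_mem _ (hI i) _ (Nat.pos_of_ne_zero hi)

theorem irrelevant_le_map_gradedChange {W₁ : WeierstrassCurve R} {W₂ : WeierstrassCurve S}
    (φ : R →+* S) (C : VariableChange S) (h : C • W₁.map φ = W₂) :
    HomogeneousIdeal.irrelevant W₂.homogPart ≤
      (HomogeneousIdeal.irrelevant W₁.homogPart).map (gradedChange φ C h) := by
  let I := ((HomogeneousIdeal.irrelevant W₁.homogPart).map (gradedChange φ C h)).toIdeal
  have hm (i : Fin 3) : polyChange W₂ φ C (.X i) ∈ I :=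
    Ideal.mem_map_of_mem (gradedChange φ C h)
      (HomogeneousIdeal.mem_irrelevant_of_mem W₁.homogPart one_pos (W₁.coord_mem i))
  have hinv (n : ℕ) : algebraMap S W₂.HomogRing (((C.u⁻¹ : Sˣ) : S) ^ n) *
      algebraMap S W₂.HomogRing ((C.u : S) ^ n) = 1 := by
    rw [← map_mul, ← mul_pow, Units.inv_mul, one_pow, map_one]
  have h2 : W₂.coord 2 ∈ I := polyChange_X_two W₂ φ C ▸ hm 2
  have h0 : W₂.coord 0 ∈ I := by
    have e : W₂.coord 0 = algebraMap S W₂.HomogRing (((C.u⁻¹ : Sˣ) : S) ^ 2) *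
        (polyChange W₂ φ C (.X 0) - algebraMap S _ C.r * W₂.coord 2) := by
      rw [polyChange_X_zero]
      linear_combination -W₂.coord 0 * hinv 2
    rw [e]
    exact Ideal.mul_mem_left _ _ (sub_mem (hm 0) (Ideal.mul_mem_left _ _ h2))
  have h1 : W₂.coord 1 ∈ I := by
    have e : W₂.coord 1 = algebraMap S W₂.HomogRing (((C.u⁻¹ : Sˣ) : S) ^ 3) *
        (polyChange W₂ φ C (.X 1) - algebraMap S _ (C.u ^ 2 * C.s) * W₂.coord 0
          - algebraMap S _ C.t * W₂.coord 2) := by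
      rw [polyChange_X_one]
      linear_combination -W₂.coord 1 * hinv 3
    rw [e]
    exact Ideal.mul_mem_left _ _ (sub_mem (sub_mem (hm 1) (Ideal.mul_mem_left _ _ h0))
      (Ideal.mul_mem_left _ _ h2))
  refine irrelevant_le_of_coord_mem W₂ fun i => ?_
  fin_cases i
  exacts [h0, h1, h2]

/-- The morphism of plane cubics `W₂.scheme ⟶ W₁.scheme` over `Spec φ : Spec S ⟶ Spec R` given in
coordinates by `[X : Y : Z] ↦ [u²X + rZ : u³Y + u²sX + tZ : Z]`, where `C = (u, r, s, t)`
transforms the image of `W₁` under `φ : R → S` into `W₂`. -/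
noncomputable def schemeChange {W₁ : WeierstrassCurve R} {W₂ : WeierstrassCurve S} (φ : R →+* S)
    (C : VariableChange S) (h : C • W₁.map φ = W₂) : W₂.scheme ⟶ W₁.scheme :=
  Proj.map (gradedChange φ C h) (irrelevant_le_map_gradedChange φ C h)

theorem schemeChange_toSpec {W₁ : WeierstrassCurve R} {W₂ : WeierstrassCurve S} (φ : R →+* S)
    (C : VariableChange S) (h : C • W₁.map φ = W₂) :
    schemeChange φ C h ≫ W₁.toSpec = W₂.toSpec ≫ Spec.map (CommRingCat.ofHom φ) := by
  have key (i : ℕ) (hi : 0 < i) (a : W₁.HomogRing) (ha : a ∈ W₁.homogPart i) :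
      Proj.awayι W₂.homogPart (gradedChange φ C h a) ((gradedChange φ C h).map_mem ha) hi ≫
        schemeChange φ C h ≫ W₁.toSpec =
      Proj.awayι W₂.homogPart (gradedChange φ C h a) ((gradedChange φ C h).map_mem ha) hi ≫
        W₂.toSpec ≫ Spec.map (CommRingCat.ofHom φ) := by
    rw [schemeChange, toSpec, toSpec, Category.assoc, Proj.awayι_comp_map_assoc _ _ hi _ ha,
      Proj.awayι_toSpecZero_assoc, Proj.awayι_toSpecZero_assoc]
    simp only [← Spec.map_comp, ← CommRingCat.ofHom_comp]
    congr 2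
    ext r
    have e : gradedChange φ C h (algebraMap R W₁.HomogRing r) = algebraMap S _ (φ r) :=
      polyChange_C W₂ φ C r
    change Localization.mk (gradedChange φ C h (algebraMap R W₁.HomogRing r))
      ⟨gradedChange φ C h 1, _⟩ = Localization.mk (algebraMap S W₂.HomogRing (φ r)) 1
    rw [e, Localization.mk_eq_mk_iff, Localization.r_iff_exists]
    exact ⟨1, by simp⟩
  exact (Proj.mapAffineOpenCover (gradedChange φ C h)
    (irrelevant_le_map_gradedChange φ C h)).openCover.hom_ext _ _ fun s => key _ s.1.2 _ s.2.2

end Functoriality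

section Functoriality

variable {R S T : Type u} [CommRing R] [CommRing S] [CommRing T]

theorem ringChange_mk {W₁ : WeierstrassCurve R} {W₂ : WeierstrassCurve S} (φ : R →+* S)
    (C : VariableChange S) (h : C • W₁.map φ = W₂) (p : MvPolynomial (Fin 3) R) :
    ringChange φ C h (Ideal.Quotient.mk _ p) = polyChange W₂ φ C p :=
  rfl

theorem ringChange_algebraMap {W₁ : WeierstrassCurve R} {W₂ : WeierstrassCurve S} (φ : R →+* S)
    (C : VariableChange S) (h : C • W₁.map φ = W₂) (a : R) :
    ringChange φ C h (algebraMap R _ a) = algebraMap S _ (φ a) :=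
  polyChange_C W₂ φ C a

theorem schemeChange_comp {W₁ : WeierstrassCurve R} {W₂ : WeierstrassCurve S}
    {W₃ : WeierstrassCurve T} {φ : R →+* S} {C : VariableChange S} (h : C • W₁.map φ = W₂)
    {ψ : S →+* T} {D : VariableChange T} (h' : D • W₂.map ψ = W₃)
    {χ : R →+* T} {C' : VariableChange T} (h'' : C' • W₁.map χ = W₃)
    (hχ : χ = ψ.comp φ) (hC : C' = D * C.map ψ) :
    schemeChange ψ D h' ≫ schemeChange φ C h = schemeChange χ C' h'' := by
  subst hχ hC
  have e : (gradedChange ψ D h').comp (gradedChange φ C h) =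
      gradedChange (ψ.comp φ) (D * C.map ψ) h'' := by
    have : (ringChange ψ D h').comp (ringChange φ C h) =
        ringChange (ψ.comp φ) (D * C.map ψ) h'' := by
      refine Ideal.Quotient.ringHom_ext (MvPolynomial.ringHom_ext (fun a => ?_) fun i => ?_)
      · rw [RingHom.comp_apply, RingHom.comp_apply, RingHom.comp_apply, ringChange_mk,
          ringChange_mk, polyChange_C, polyChange_C, ringChange_algebraMap, RingHom.comp_apply]
      · rw [RingHom.comp_apply, RingHom.comp_apply, RingHom.comp_apply, ringChange_mk,
          ringChange_mk]
        have e₀ : ringChange ψ D h' (W₂.coord 0) = _ := polyChange_X_zero W₃ ψ D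
        have e₁ : ringChange ψ D h' (W₂.coord 1) = _ := polyChange_X_one W₃ ψ D
        have e₂ : ringChange ψ D h' (W₂.coord 2) = _ := polyChange_X_two W₃ ψ D
        match i with
        | 0 =>
          rw [polyChange_X_zero, polyChange_X_zero]
          simp only [map_add, map_mul, map_pow, ringChange_algebraMap, e₀, e₂,
            VariableChange.mul_def, VariableChange.map, Units.val_mul, Units.coe_map,
            MonoidHom.coe_coe]
          ring
        | 1 =>
          rw [polyChange_X_one, polyChange_X_one]
          simp only [map_add, map_mul, map_pow, ringChange_algebraMap, e₀, e₁, e₂,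
            VariableChange.mul_def, VariableChange.map, Units.val_mul, Units.coe_map,
            MonoidHom.coe_coe]
          ring
        | 2 => rw [polyChange_X_two, polyChange_X_two, e₂]
    exact DFunLike.ext _ _ fun x => RingHom.congr_fun this x
  unfold schemeChange
  rw [← Proj.map_comp]
  congr 1

end Functoriality

section Fiber

variable {R S : Type u} [CommRing R] [CommRing S]

/-- The base change of `W.scheme` to `Spec (R / I)`. -/
noncomputable abbrev fiber (W : WeierstrassCurve R) (I : Ideal R) : Scheme.{u} :=
  Limits.pullback W.toSpec (Spec.map (CommRingCat.ofHom (Ideal.Quotient.mk I)))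

/-- The structure morphism of `W.fiber I` over `Spec (R / I)`. -/
noncomputable abbrev fiberToSpec (W : WeierstrassCurve R) (I : Ideal R) :
    W.fiber I ⟶ Spec (.of (R ⧸ I)) :=
  Limits.pullback.snd _ _

/-- The base change to `Spec (R / I)` of the section at infinity. -/
noncomputable def fiberInfinity (W : WeierstrassCurve R) (I : Ideal R) :
    Spec (.of (R ⧸ I)) ⟶ W.fiber I :=
  Limits.pullback.lift (Spec.map (CommRingCat.ofHom (Ideal.Quotient.mk I)) ≫ W.infinity) (𝟙 _) (by
    rw [Category.assoc, infinity_toSpec, Category.comp_id, Category.id_comp])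

/-- The morphism induced by `schemeChange φ C h` on the base changes modulo `I` and `J`. -/
noncomputable def fiberChange {W₁ : WeierstrassCurve R} {W₂ : WeierstrassCurve S} (φ : R →+* S)
    (C : VariableChange S) (h : C • W₁.map φ = W₂) {I : Ideal R} {J : Ideal S}
    (hIJ : I ≤ J.comap φ) : W₂.fiber J ⟶ W₁.fiber I :=
  Limits.pullback.map _ _ _ _ (schemeChange φ C h)
    (Spec.map (CommRingCat.ofHom (Ideal.quotientMap J φ hIJ))) (Spec.map (CommRingCat.ofHom φ))
    (schemeChange_toSpec φ C h).symm (by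
      rw [← Spec.map_comp, ← Spec.map_comp, ← CommRingCat.ofHom_comp, ← CommRingCat.ofHom_comp,
        Ideal.quotientMap_comp_mk])

/-- An isomorphism of pointed schemes between the base changes of two Weierstrass cubics modulo `I`
and `I₀`, over a given isomorphism `θ : R / I ≃ R₀ / I₀` of the base rings. -/
structure PointedFiberIso {R₀ : Type u} [CommRing R₀] (W : WeierstrassCurve R) (I : Ideal R)
    (W₀ : WeierstrassCurve R₀) (I₀ : Ideal R₀) (θ : R ⧸ I ≃+* R₀ ⧸ I₀) where
  iso : W.fiber I ≅ W₀.fiber I₀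
  comp_toSpec : iso.hom ≫ W₀.fiberToSpec I₀ ≫ Spec.map (CommRingCat.ofHom θ.toRingHom) = W.fiberToSpec I
  pointed : Spec.map (CommRingCat.ofHom θ.toRingHom) ≫ W.fiberInfinity I ≫ iso.hom =
    W₀.fiberInfinity I₀

end Fiber

section Model

/-- A Weierstrass model over `R` of the elliptic curve `E` over the fraction field `F` of `R`: a
Weierstrass equation over `R` together with an isomorphism of its generic fiber with `E` (respecting
the origins), i.e. a change of variables over `F` transforming `E` into that equation. -/
structure Model (R : Type u) {F : Type u} [CommRing R] [Field F] [Algebra R F]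
    (E : WeierstrassCurve F) where
  eqn : WeierstrassCurve R
  change : VariableChange F
  change_smul : change • E = eqn.map (algebraMap R F)

/-- A Weierstrass model is minimal if the ideal generated by its discriminant is the biggest among
all Weierstrass models. -/
def Model.IsMinimal {R F : Type u} [CommRing R] [Field F] [Algebra R F] {E : WeierstrassCurve F}
    (M : Model R E) : Prop :=
  ∀ M' : Model R E, Ideal.span {M'.eqn.Δ} ≤ Ideal.span {M.eqn.Δ}

/-- A change of variables over the fraction field between integral Weierstrass equations with
associated discriminants has integral coefficients. -/
theorem exists_integral_change {R F : Type u} [CommRing R] [IsDomain R] [IsIntegrallyClosed R]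
    [Field F] [Algebra R F] [IsFractionRing R F] {W₁ W₂ : WeierstrassCurve R}
    {C : VariableChange F} (h : C • W₁.map (algebraMap R F) = W₂.map (algebraMap R F))
    (h₀ : W₁.Δ ≠ 0) (hΔ : Associated W₁.Δ W₂.Δ) :
    ∃ D : VariableChange R, D.map (algebraMap R F) = C ∧ D • W₁ = W₂ := by
  have hinj := IsFractionRing.injective R F
  have lift {x : F} (hx : _root_.IsIntegral R x) : ∃ y, algebraMap R F y = x :=
    IsIntegrallyClosed.isIntegral_iff.mp hx
  have alg (a : R) : _root_.IsIntegral R (algebraMap R F a) := isIntegral_algebraMap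
  -- the unit `u`
  obtain ⟨v, hv⟩ := hΔ
  have hΔ' : (C.u : F)⁻¹ ^ 12 = algebraMap R F v := by
    have := congrArg Δ h
    rw [variableChange_Δ, map_Δ, map_Δ, ← hv, map_mul, mul_comm] at this
    have h0 : algebraMap R F W₁.Δ ≠ 0 := by simpa using h₀
    simpa using mul_left_cancel₀ h0 this
  have hu0 : (C.u : F) ≠ 0 := C.u.ne_zero
  obtain ⟨w, hw⟩ := lift (x := (C.u : F)⁻¹) (.of_pow (n := 12) (by norm_num) (hΔ' ▸ alg _))
  obtain ⟨u, hu⟩ := lift (x := (C.u : F)) (.of_pow (n := 12) (by norm_num) (by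
    have : (C.u : F) ^ 12 = algebraMap R F ((v⁻¹ : Rˣ) : R) := by
      have h1 : algebraMap R F v * algebraMap R F ((v⁻¹ : Rˣ) : R) = 1 := by
        rw [← map_mul, Units.mul_inv, map_one]
      rw [← hΔ'] at h1
      field_simp at h1
      exact h1.symm
    exact this ▸ alg _))
  have huw : u * w = 1 := hinj (by rw [map_mul, hu, hw, map_one, mul_inv_cancel₀ hu0])
  have e₂ := congrArg a₂ h
  have e₆ := congrArg a₆ h
  have eb₆ := congrArg b₆ h
  have eb₈ := congrArg b₈ h
  rw [variableChange_b₆, map_b₂, map_b₄, map_b₆, map_b₆] at eb₆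
  rw [variableChange_b₈, map_b₂, map_b₄, map_b₆, map_b₈, map_b₈] at eb₈
  rw [variableChange_a₂, map_a₁, map_a₂, map_a₂] at e₂
  rw [variableChange_a₆, map_a₁, map_a₂, map_a₃, map_a₄, map_a₆, map_a₆] at e₆
  have hinv : ((C.u⁻¹ : Fˣ) : F) = (C.u : F)⁻¹ := by simp
  rw [hinv] at eb₆ eb₈ e₂ e₆
  field_simp at eb₆ eb₈ e₂ e₆
  rw [← hu] at eb₆ eb₈ e₂ e₆
  -- `r` satisfies a monic equation of degree four
  obtain ⟨r, hr⟩ := lift (x := C.r) (by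
    refine ⟨.X ^ 4 - .C W₁.b₄ * .X ^ 2 - .C (2 * W₁.b₆ + u ^ 6 * W₂.b₆) * .X
      - .C (W₁.b₈ - u ^ 8 * W₂.b₈), by monicity!, ?_⟩
    simp only [Polynomial.eval₂_sub, Polynomial.eval₂_mul, Polynomial.eval₂_pow,
      Polynomial.eval₂_X, Polynomial.eval₂_C]
    simp only [map_add, map_sub, map_mul, map_pow, map_ofNat]
    linear_combination C.r * eb₆ - eb₈)
  rw [← hr] at e₂ e₆
  obtain ⟨s, hs⟩ := lift (x := C.s) (by
    refine ⟨.X ^ 2 + .C W₁.a₁ * .X + .C (u ^ 2 * W₂.a₂ - W₁.a₂ - 3 * r), by monicity!, ?_⟩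
    simp only [Polynomial.eval₂_add, Polynomial.eval₂_mul, Polynomial.eval₂_pow,
      Polynomial.eval₂_X, Polynomial.eval₂_C]
    simp only [map_sub, map_mul, map_pow, map_ofNat]
    linear_combination -e₂)
  obtain ⟨t, ht⟩ := lift (x := C.t) (by
    refine ⟨.X ^ 2 + .C (W₁.a₃ + r * W₁.a₁) * .X
      + .C (u ^ 6 * W₂.a₆ - W₁.a₆ - r * W₁.a₄ - r ^ 2 * W₁.a₂ - r ^ 3), by monicity!, ?_⟩
    simp only [Polynomial.eval₂_add, Polynomial.eval₂_mul, Polynomial.eval₂_pow,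
      Polynomial.eval₂_X, Polynomial.eval₂_C]
    simp only [map_add, map_sub, map_mul, map_pow]
    linear_combination -e₆)
  have hD : (⟨⟨u, w, huw, by rw [mul_comm, huw]⟩, r, s, t⟩ : VariableChange R).map
      (algebraMap R F) = C := by
    ext
    exacts [hu, hr, hs, ht]
  refine ⟨_, hD, map_injective hinj ?_⟩
  exact (map_variableChange _ _ _).symm.trans (hD ▸ h)

/-- The inclusion of the generic fiber of a Weierstrass model of `E`, identified with `E`. -/
noncomputable def Model.generic {R F : Type u} [CommRing R] [Field F] [Algebra R F]
    {E : WeierstrassCurve F} (M : Model R E) : E.scheme ⟶ M.eqn.scheme :=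
  schemeChange (algebraMap R F) M.change⁻¹ (by rw [← M.change_smul, inv_smul_smul])

end Model

section Galois

variable {K B L : Type u} [Field K] [Field L] [Algebra K L] [CommRing B] [Algebra B L]
  {G : Type*} [Group G] [MulSemiringAction G B] [MulSemiringAction G L] [SMulDistribClass G B L]
  [SMulCommClass G K L] {E : WeierstrassCurve K}

theorem map_smul_eq (E : WeierstrassCurve K) (g : G) :
    (E.map (algebraMap K L)).map (MulSemiringAction.toRingHom G L g) = E.map (algebraMap K L) := by
  rw [map_map]
  congr 1
  ext a
  exact smul_algebraMap g a

/-- The action of `g ∈ G` on `E_L = E ×_K L`, as a morphism over the action of `g` on `Spec L`. -/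
noncomputable def galoisMap (E : WeierstrassCurve K) (L : Type u) [Field L] [Algebra K L]
    [MulSemiringAction G L] [SMulCommClass G K L] (g : G) :
    (E.map (algebraMap K L)).scheme ⟶ (E.map (algebraMap K L)).scheme :=
  schemeChange (MulSemiringAction.toRingHom G L g) 1 (by rw [one_smul, map_smul_eq])

theorem algebraMap_comp_toRingHom (g : G) :
    (algebraMap B L).comp (MulSemiringAction.toRingHom G B g) =
      (MulSemiringAction.toRingHom G L g).comp (algebraMap B L) := by
  ext b
  exact algebraMap.smul' g b L

/-- The conjugate by `g ∈ G` of a Weierstrass model of `E_L`, again a Weierstrass model of `E_L`. -/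
def Model.conj (M : Model B (E.map (algebraMap K L))) (g : G) :
    Model B (E.map (algebraMap K L)) where
  eqn := M.eqn.map (MulSemiringAction.toRingHom G B g)
  change := M.change.map (MulSemiringAction.toRingHom G L g)
  change_smul := by
    rw [map_map, algebraMap_comp_toRingHom (L := L), ← map_map, ← M.change_smul,
      ← map_variableChange, map_smul_eq]

theorem Model.exists_galoisChange [IsDomain B] [IsIntegrallyClosed B] [IsFractionRing B L]
    [E.IsElliptic] (M : Model B (E.map (algebraMap K L))) (hM : M.IsMinimal) (g : G) :
    ∃ D : VariableChange B,
      D.map (algebraMap B L) =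
        M.change * (M.change.map (MulSemiringAction.toRingHom G L g))⁻¹ ∧
      D • M.eqn.map (MulSemiringAction.toRingHom G B g) = M.eqn := by
  have hd (g : G) : M.eqn.Δ ∣ g • M.eqn.Δ := by
    have := hM (M.conj g)
    rw [Ideal.span_singleton_le_span_singleton] at this
    simpa [Model.conj] using this
  have hne : M.eqn.Δ ≠ 0 := by
    intro h0
    have := congrArg Δ M.change_smul
    rw [map_Δ, h0, map_zero, variableChange_Δ, map_Δ] at this
    have hE : E.Δ ≠ 0 := E.isUnit_Δ.ne_zero
    simp [hE] at this
  refine exists_integral_change ?_ ?_ ?_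
  · have := (M.conj g).change_smul
    simp only [Model.conj] at this
    rw [← this, mul_smul, inv_smul_smul, M.change_smul]
  · rw [map_Δ]
    simpa using (smul_ne_zero_iff_ne g).mpr hne
  · rw [map_Δ]
    refine associated_of_dvd_dvd ?_ (hd g)
    have := map_dvd (MulSemiringAction.toRingHom G B g) (hd g⁻¹)
    simpa using this

/-- The change of variables over `B` by which `g ∈ G` acts on a minimal Weierstrass model. -/
noncomputable def Model.galoisChange [IsDomain B] [IsIntegrallyClosed B] [IsFractionRing B L]
    [E.IsElliptic] (M : Model B (E.map (algebraMap K L))) (hM : M.IsMinimal) (g : G) :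
    VariableChange B :=
  (M.exists_galoisChange hM g).choose

theorem Model.galoisChange_map [IsDomain B] [IsIntegrallyClosed B] [IsFractionRing B L]
    [E.IsElliptic] (M : Model B (E.map (algebraMap K L))) (hM : M.IsMinimal) (g : G) :
    (M.galoisChange hM g).map (algebraMap B L) =
      M.change * (M.change.map (MulSemiringAction.toRingHom G L g))⁻¹ :=
  (M.exists_galoisChange hM g).choose_spec.1

theorem Model.galoisChange_smul [IsDomain B] [IsIntegrallyClosed B] [IsFractionRing B L]
    [E.IsElliptic] (M : Model B (E.map (algebraMap K L))) (hM : M.IsMinimal) (g : G) :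
    M.galoisChange hM g • M.eqn.map (MulSemiringAction.toRingHom G B g) = M.eqn :=
  (M.exists_galoisChange hM g).choose_spec.2

/-- The action of `g ∈ G` on the minimal Weierstrass model of `E_L`, as a morphism over the action
of `g` on `Spec B`. It extends the action of `g` on `E_L`, see `generic_comp_galoisMap`. -/
noncomputable def Model.galoisMap [IsDomain B] [IsIntegrallyClosed B] [IsFractionRing B L]
    [E.IsElliptic] (M : Model B (E.map (algebraMap K L))) (hM : M.IsMinimal) (g : G) :
    M.eqn.scheme ⟶ M.eqn.scheme :=
  schemeChange (MulSemiringAction.toRingHom G B g) (M.galoisChange hM g)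
    (M.galoisChange_smul hM g)

theorem Model.generic_comp_galoisMap [IsDomain B] [IsIntegrallyClosed B] [IsFractionRing B L]
    [E.IsElliptic] (M : Model B (E.map (algebraMap K L))) (hM : M.IsMinimal) (g : G) :
    M.generic ≫ M.galoisMap hM g = E.galoisMap L g ≫ M.generic := by
  have h : (M.change⁻¹ * (M.galoisChange hM g).map (algebraMap B L)) •
      M.eqn.map ((algebraMap B L).comp (MulSemiringAction.toRingHom G B g)) =
        E.map (algebraMap K L) := by
    rw [mul_smul, ← map_map, map_variableChange, M.galoisChange_smul hM g, ← M.change_smul, inv_smul_smul]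
  rw [Model.generic, Model.galoisMap, WeierstrassCurve.galoisMap,
    schemeChange_comp (h'' := h) (hχ := rfl) (hC := rfl),
    schemeChange_comp (h'' := h) (hχ := algebraMap_comp_toRingHom g)]
  rw [one_mul, M.galoisChange_map hM g, inv_mul_cancel_left]
  exact (map_inv (VariableChange.mapHom (MulSemiringAction.toRingHom G L g)) M.change).symm

end Galois

section Level

/-- The ideal `π ^ (n + 1) O_L` of `O_L = B`, where `π` is a uniformizer of `O_K = A`. -/
def level (A B : Type u) [CommRing A] [IsLocalRing A] [CommRing B] [Algebra A B] (n : ℕ) :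
    Ideal B :=
  (IsLocalRing.maximalIdeal A ^ (n + 1)).map (algebraMap A B)

theorem level_le_comap (A K B L : Type u) [CommRing A] [IsLocalRing A] [Field K] [Algebra A K]
    [CommRing B] [Algebra A B] [Field L] [Algebra K L] [Algebra A L] [Algebra B L]
    [IsScalarTower A B L] [IsScalarTower A K L] [IsFractionRing B L] {G : Type*} [Group G]
    [MulSemiringAction G B] [MulSemiringAction G L] [SMulDistribClass G B L] [SMulCommClass G K L]
    (n : ℕ) (g : G) :
    level A B n ≤ (level A B n).comap (MulSemiringAction.toRingHom G B g) := by
  refine Ideal.map_le_iff_le_comap.mpr fun a ha => ?_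
  have h : g • algebraMap A B a = algebraMap A B a := by
    apply IsFractionRing.injective B L
    rw [algebraMap.smul', ← IsScalarTower.algebraMap_apply A B L,
      IsScalarTower.algebraMap_apply A K L, smul_algebraMap]
  change g • algebraMap A B a ∈ level A B n
  rw [h]
  exact Ideal.mem_map_of_mem _ ha

/-- The action of `g ∈ G` on the fiber `W'_n = W' ×_{O_K} Spec (O_K / π ^ (n + 1))` of the minimal
Weierstrass model `W'` of `E_L`, induced by its action `Model.galoisMap` on `W'`. -/
noncomputable def Model.galoisLevelMap (A : Type u) {K B L : Type u} [CommRing A] [IsLocalRing A]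
    [Field K] [Algebra A K] [CommRing B] [IsDomain B] [IsIntegrallyClosed B] [Algebra A B] [Field L]
    [Algebra K L] [Algebra A L] [Algebra B L] [IsScalarTower A B L] [IsScalarTower A K L]
    [IsFractionRing B L] {G : Type*} [Group G] [MulSemiringAction G B] [MulSemiringAction G L]
    [SMulDistribClass G B L] [SMulCommClass G K L] {E : WeierstrassCurve K} [E.IsElliptic]
    (M : Model B (E.map (algebraMap K L))) (hM : M.IsMinimal) (n : ℕ) (g : G) :
    M.eqn.fiber (level A B n) ⟶ M.eqn.fiber (level A B n) :=
  fiberChange (MulSemiringAction.toRingHom G B g) (M.galoisChange hM g)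
    (M.galoisChange_smul hM g) (level_le_comap A K B L n g)

end Level

end WeierstrassCurve

/-- The rational number `v_K(𝔇_{L/K}) = v_L(𝔇_{L/K}) / e_{L/K}`, where `v_L(𝔇_{L/K})` is the exponent
of the different of `O_L = B` over `O_K = A` at the maximal ideal `P` of `B` and `e_{L/K}` is the
ramification index of `P` over `A`. -/
noncomputable def valDifferent (A : Type u) {B : Type u} [CommRing A] [IsDomain A] [CommRing B]
    [IsDedekindDomain B] [Algebra A B] [Module.IsTorsionFree A B] (P : Ideal B) : ℚ :=
  (multiplicity P (differentIdeal A B) : ℚ) / (P.ramificationIdx A : ℚ)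

/-! The proof turns schemes into Weierstrass equations and then performs a Galois descent with
controlled loss of precision. Write `ϖ` for a uniformizer of `A` and `M = m + 1`.

Equations. Over `B`, the equation `W` is the transform of `W'` by a substitution `c = (u, r, s, t)`
with entries in `B`, where `u` need not be a unit (`Model.exists_substitution`). The group acts on
`W'` through changes of variables `D g`, and `c` satisfies the descent relation `D g * g(c) = c`. A
pointed isomorphism between the reductions of `W'` and `W₀'` is a change of variables `H` on the
complement of infinity (`exists_variableChange`). Over an arbitrary base ring this is read off from
Laurent expansions at infinity: the affine coordinates of the target pull back to functions with
poles of order exactly 2 and 3. Equivariance then says that `H` carries `D g` to `D₀ g`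
(`galoisChange_relation`).

Transfer. A lift `d` to `B₀` of `H * c` satisfies the descent relation of `W₀'` modulo `ϖ₀ ^ M`,
while `c₀` satisfies it exactly. Hence `c₀⁻¹ * d` is almost invariant, and averaging it against an
element of trace `ϖ₀ ^ j` produces a substitution over `K₀` close to it (`exists_close_change`). So
`W₀` has an integral transform `V` over `A₀` that is congruent to a lift `X` of the reduction of `W`
(`exists_close_model`). The loss is controlled by two facts. First, `j` is at most the integral part
of the valuation of the different (`exists_sum_smul_eq_pow`). Second, the scaling factor of `c`
divides `ϖ ^ (j + 1)` (`u_dvd_pow`): if it were a multiple of `ϖ ^ (j + 1)`, averaging `r`, `s`, `t`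
would allow `W` to be scaled down by `ϖ`, against minimality.

Conclusion. Minimality of `W₀` shows that `c₀.u` divides `d.u`. The same argument with the two
fields exchanged gives the opposite divisibility. Thus `V` and `W₀` have associated discriminants,
so they differ by an integral change of variables (`exists_integral_change`), and `W`, `W₀` agree
modulo the uniformizer to the power `M - (j + 1) - 3 * j = m - 4 * j`, which is at least `N + 1`. -/

namespace AlgebraicGeometry.Proj

open HomogeneousLocalization

/-! ### Points of `Proj` with values in a ring. -/

section Points

variable {A B Q Q' : Type u} {σ τ : Type u} [CommRing A] [SetLike σ A] [AddSubgroupClass σ A]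
  [CommRing B] [SetLike τ B] [AddSubgroupClass τ B] [CommRing Q] [CommRing Q']
  (𝒜 : ℕ → σ) [GradedRing 𝒜] (ℬ : ℕ → τ) [GradedRing ℬ]

/-- The homomorphism `(A_f)₀ → Q` induced by a homomorphism `A → Q` under which `f` becomes
a unit. -/
noncomputable def awayLift (e : A →+* Q) {f : A} (hf : IsUnit (e f)) : Away 𝒜 f →+* Q :=
  (IsLocalization.Away.lift f hf : Localization.Away f →+* Q).comp
    (algebraMap (Away 𝒜 f) (Localization.Away f))

theorem awayLift_mk (e : A →+* Q) {f : A} (hf : IsUnit (e f)) {d : ℕ} (hd : f ∈ 𝒜 d) (n : ℕ)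
    (x : A) (hx : x ∈ 𝒜 (n • d)) :
    awayLift 𝒜 e hf (Away.mk 𝒜 hd n x hx) * e f ^ n = e x := by
  let s : Submonoid.powers f := ⟨f ^ n, n, rfl⟩
  have h1 : awayLift 𝒜 e hf (Away.mk 𝒜 hd n x hx) =
      IsLocalization.Away.lift (S := Localization.Away f) f hf (Localization.mk x s) := rfl
  have h2 : e f ^ n = IsLocalization.Away.lift (S := Localization.Away f) f hf
      (algebraMap A _ (s : A)) := by
    rw [IsLocalization.Away.lift_eq, map_pow]
  rw [h1, h2, ← map_mul, Localization.mk_eq_mk', IsLocalization.mk'_spec,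
    IsLocalization.Away.lift_eq]

theorem algebraMap_away_mk {f : A} {d : ℕ} (hd : f ∈ 𝒜 d) (n : ℕ) (x : A)
    (hx : x ∈ 𝒜 (n • d)) :
    algebraMap (Away 𝒜 f) (Localization.Away f) (Away.mk 𝒜 hd n x hx) * algebraMap A _ f ^ n =
      algebraMap A _ x := by
  let s : Submonoid.powers f := ⟨f ^ n, n, rfl⟩
  rw [← map_pow, show algebraMap (Away 𝒜 f) (Localization.Away f) (Away.mk 𝒜 hd n x hx) =
    Localization.mk x s from rfl, Localization.mk_eq_mk']
  exact IsLocalization.mk'_spec _ x s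

/-- Every element of `(A_f)₀` is a fraction `x / f ^ n`, and `e f` is cancellable. The
compatibilities of `awayLift` below all reduce to this uniqueness. -/
theorem awayLift_unique (e : A →+* Q) {f : A} (hf : IsUnit (e f)) {d : ℕ} (hd : f ∈ 𝒜 d)
    (ρ : Away 𝒜 f →+* Q)
    (h : ∀ (n : ℕ) (x : A) (hx : x ∈ 𝒜 (n • d)), ρ (Away.mk 𝒜 hd n x hx) * e f ^ n = e x) :
    ρ = awayLift 𝒜 e hf := by
  ext y
  obtain ⟨n, x, hx, rfl⟩ := Away.mk_surjective 𝒜 hd y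
  refine (hf.pow n).mul_right_cancel ?_
  rw [h, awayLift_mk]

theorem comp_awayLift (e : A →+* Q) {f : A} (hf : IsUnit (e f)) {d : ℕ} (hd : f ∈ 𝒜 d)
    (ρ : Q →+* Q') :
    ρ.comp (awayLift 𝒜 e hf) =
      awayLift 𝒜 (ρ.comp e) (f := f) (hf.map ρ) := by
  refine awayLift_unique 𝒜 _ _ hd _ fun n x hx => ?_
  rw [RingHom.comp_apply, RingHom.comp_apply, RingHom.comp_apply, ← map_pow, ← map_mul,
    awayLift_mk]

theorem awayLift_comp_map (e : B →+* Q) (γ : 𝒜 →+*ᵍ ℬ) (e' : A →+* Q)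
    (he : ∀ x, e' x = e (γ x)) {f : A} {d : ℕ} (hd : f ∈ 𝒜 d)
    (hf : IsUnit (e (γ f))) (hf' : IsUnit (e' f)) :
    (awayLift ℬ e hf).comp (Away.map γ f) = awayLift 𝒜 e' hf' := by
  refine awayLift_unique 𝒜 _ _ hd _ fun n x hx => ?_
  rw [RingHom.comp_apply, Away.map_mk, he, he]
  exact awayLift_mk ℬ e hf _ n _ _

theorem awayLift_comp_awayMap (e : A →+* Q) {f g x : A} {d d' : ℕ} (hd : f ∈ 𝒜 d) (hd' : g ∈ 𝒜 d')
    (hx : x = f * g) (hf : IsUnit (e f)) (hx' : IsUnit (e x)) :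
    (awayLift 𝒜 e hx').comp (awayMap 𝒜 hd' hx) = awayLift 𝒜 e hf := by
  refine awayLift_unique 𝒜 _ _ hd _ fun n y hy => ?_
  rw [RingHom.comp_apply, awayMap_mk]
  have h := awayLift_mk 𝒜 e hx' (hx ▸ SetLike.mul_mem_graded hd hd') n (y * g ^ n)
    (by rw [smul_add]; exact SetLike.mul_mem_graded hy (SetLike.pow_mem_graded n hd'))
  have hg : IsUnit (e g) := by
    rw [hx, map_mul] at hx'
    exact isUnit_of_mul_isUnit_right hx'
  refine (hg.pow n).mul_right_cancel ?_
  subst hx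
  rwa [map_mul, map_mul, map_pow, mul_pow, ← mul_assoc] at h

/-- The morphism `Spec Q ⟶ Proj 𝒜` induced by a homomorphism `A → Q` under which some homogeneous
element `f` of positive degree becomes a unit. -/
noncomputable def point (e : A →+* Q) {f : A} {d : ℕ} (hd : f ∈ 𝒜 d) (h0 : 0 < d)
    (hf : IsUnit (e f)) : Spec (.of Q) ⟶ Proj 𝒜 :=
  Spec.map (CommRingCat.ofHom (awayLift 𝒜 e hf)) ≫ awayι 𝒜 f hd h0

/-- Passing to the smaller chart `D₊(f * g)` makes the choice of `f` irrelevant: two charts are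
compared through their intersection. -/
theorem point_eq_mul (e : A →+* Q) {f g : A} {d d' : ℕ} (hd : f ∈ 𝒜 d) (h0 : 0 < d)
    (hf : IsUnit (e f)) (hd' : g ∈ 𝒜 d') (hg : IsUnit (e g)) :
    point 𝒜 e hd h0 hf = point 𝒜 e (f := f * g) (SetLike.mul_mem_graded hd hd')
      (Nat.add_pos_left h0 _) (by rw [map_mul]; exact hf.mul hg) := by
  rw [point, point, ← SpecMap_awayMap_awayι 𝒜 hd h0 hd' rfl, ← Category.assoc, ← Spec.map_comp,
    ← CommRingCat.ofHom_comp, awayLift_comp_awayMap 𝒜 e hd hd' rfl hf]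

theorem point_eq_point (e : A →+* Q) {f g : A} {d d' : ℕ} (hd : f ∈ 𝒜 d) (h0 : 0 < d)
    (hf : IsUnit (e f)) (hd' : g ∈ 𝒜 d') (h0' : 0 < d') (hg : IsUnit (e g)) :
    point 𝒜 e hd h0 hf = point 𝒜 e hd' h0' hg := by
  have key {x y : A} (hxy : x = y) {i j : ℕ} (hij : i = j) (hx : x ∈ 𝒜 i) (hi : 0 < i)
      (hu : IsUnit (e x)) (hy : y ∈ 𝒜 j) (hj : 0 < j) (hv : IsUnit (e y)) :
      point 𝒜 e hx hi hu = point 𝒜 e hy hj hv := by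
    subst hxy hij
    rfl
  rw [point_eq_mul 𝒜 e hd h0 hf hd' hg, point_eq_mul 𝒜 e hd' h0' hg hd hf]
  exact key (mul_comm _ _) (add_comm _ _) _ _ _ _ _ _

theorem specMap_point (e : A →+* Q) {f : A} {d : ℕ} (hd : f ∈ 𝒜 d) (h0 : 0 < d)
    (hf : IsUnit (e f)) (ρ : Q →+* Q') :
    Spec.map (CommRingCat.ofHom ρ) ≫ point 𝒜 e hd h0 hf =
      point 𝒜 (ρ.comp e) hd h0 (hf.map ρ) := by
  rw [point, point, ← Category.assoc, ← Spec.map_comp, ← CommRingCat.ofHom_comp,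
    comp_awayLift 𝒜 e hf hd]

theorem point_map (e : B →+* Q) (γ : 𝒜 →+*ᵍ ℬ) (e' : A →+* Q) (he : ∀ x, e' x = e (γ x))
    (hγ : HomogeneousIdeal.irrelevant ℬ ≤ (HomogeneousIdeal.irrelevant 𝒜).map γ)
    {f : A} {d : ℕ} (hd : f ∈ 𝒜 d) (hd' : γ f ∈ ℬ d) (h0 : 0 < d) (hf : IsUnit (e (γ f)))
    (hf' : IsUnit (e' f)) :
    point ℬ e hd' h0 hf ≫ map γ hγ = point 𝒜 e' hd h0 hf' := by
  unfold point
  rw [Category.assoc, awayι_comp_map _ _ h0 _ hd, ← Category.assoc,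
    ← Spec.map_comp, ← CommRingCat.ofHom_comp, awayLift_comp_map 𝒜 ℬ e γ e' he hd hf hf']

/-- Only the ratios of homogeneous elements of equal degree matter. This gives the invariance of
homogeneous coordinates under scaling. -/
theorem point_congr {e e' : A →+* Q} {f : A} {d : ℕ} (hd : f ∈ 𝒜 d) (h0 : 0 < d)
    (hf : IsUnit (e f)) (hf' : IsUnit (e' f))
    (h : ∀ (n : ℕ), ∀ x ∈ 𝒜 (n • d), e x * e' f ^ n = e' x * e f ^ n) :
    point 𝒜 e hd h0 hf = point 𝒜 e' hd h0 hf' := by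
  rw [point, point, awayLift_unique 𝒜 e' hf' hd (awayLift 𝒜 e hf)]
  intro n x hx
  refine (hf.pow n).mul_right_cancel ?_
  rw [mul_right_comm, awayLift_mk, h n x hx]

/-- The section at infinity is defined through `fromOfGlobalSections`, whereas all computations are
made with `point`; this is the bridge between the two. -/
theorem fromOfGlobalSections_eq_toSpecΓ_point {X : Scheme.{u}} (E : A →+* Γ(X, ⊤))
    (he : (HomogeneousIdeal.irrelevant 𝒜).toIdeal.map E = ⊤)
    {f : A} {d : ℕ} (hd : f ∈ 𝒜 d) (h0 : 0 < d) (hf : IsUnit (E f)) :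
    fromOfGlobalSections 𝒜 E he = X.toSpecΓ ≫ point 𝒜 E hd h0 hf := by
  -- Since `E f` is a unit its basic open is the whole of `X`, so one local piece of the glued
  -- morphism already determines it.
  have htop : X.basicOpen (E f) = ⊤ := X.basicOpen_of_isUnit hf
  have : IsIso (X.basicOpen (E f)).ι := by rw [htop]; exact (Scheme.topIso X).isIso_hom
  rw [← cancel_epi (X.basicOpen (E f)).ι]
  have h1 : (X.basicOpen (E f)).ι ≫ fromOfGlobalSections 𝒜 E he =
      toBasicOpenOfGlobalSections 𝒜 E rfl h0 hd ≫ (basicOpen 𝒜 f).ι := by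
    rw [← fromOfGlobalSections_resLE 𝒜 E he h0 hd, Scheme.Hom.resLE_comp_ι]
  rw [h1]
  let l : Localization.Away (E f) →+* Γ(X, ⊤) := IsLocalization.Away.lift (E f)
    (g := RingHom.id _) hf
  have hl : l.comp (algebraMap _ _) = RingHom.id _ := IsLocalization.Away.lift_comp _ _
  have h2 : (X.isoOfEq (X.toSpecΓ_preimage_basicOpen (E f))).inv ≫ X.toSpecΓ ∣_ _ ≫
      (basicOpenIsoSpecAway (E f)).hom =
      (X.basicOpen (E f)).ι ≫ X.toSpecΓ ≫ Spec.map (CommRingCat.ofHom l) := by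
    rw [← cancel_mono (Spec.map (CommRingCat.ofHom
      (algebraMap Γ(X, ⊤) (Localization.Away (E f)))))]
    simp only [Category.assoc, ← Spec.map_comp, ← CommRingCat.ofHom_comp, hl]
    rw [basicOpenIsoSpecAway_hom_SpecMap]
    refine (congrArg (_ ≫ ·) (morphismRestrict_ι X.toSpecΓ _)).trans ?_
    refine (Scheme.isoOfEq_inv_ι_assoc _ _ _).trans ?_
    rw [CommRingCat.ofHom_id, Spec.map_id]
    exact congrArg (_ ≫ ·) (Category.comp_id _).symm
  trans ((X.isoOfEq (X.toSpecΓ_preimage_basicOpen (E f))).inv ≫ X.toSpecΓ ∣_ _ ≫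
      (basicOpenIsoSpecAway (E f)).hom) ≫ Spec.map (CommRingCat.ofHom (RingHom.comp
        (IsLocalization.map (M := .powers f) (T := .powers (E f)) (Localization.Away (E f)) E
          (by rw [← Submonoid.map_le_iff_le_comap, Submonoid.map_powers]))
        (algebraMap (Away 𝒜 f) (Localization.Away f)))) ≫ awayι 𝒜 f hd h0
  · simp only [toBasicOpenOfGlobalSections, Category.assoc]
    rfl
  rw [h2, point]
  simp only [Category.assoc, ← Spec.map_comp_assoc, ← CommRingCat.ofHom_comp]
  congr 5
  rw [awayLift, ← RingHom.comp_assoc]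
  congr 1
  refine IsLocalization.ringHom_ext (.powers f) ?_
  rw [RingHom.comp_assoc, IsLocalization.map_comp, ← RingHom.comp_assoc, hl, RingHom.id_comp,
    IsLocalization.Away.lift_comp]

theorem fromOfGlobalSections_eq_point (e : A →+* Q)
    (he : (HomogeneousIdeal.irrelevant 𝒜).toIdeal.map
      ((Scheme.ΓSpecIso (.of Q)).inv.hom.comp e) = ⊤)
    {f : A} {d : ℕ} (hd : f ∈ 𝒜 d) (h0 : 0 < d) (hf : IsUnit (e f)) :
    fromOfGlobalSections 𝒜 ((Scheme.ΓSpecIso (.of Q)).inv.hom.comp e) he =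
      point 𝒜 e hd h0 hf := by
  rw [fromOfGlobalSections_eq_toSpecΓ_point 𝒜 _ he hd h0
    (hf.map (Scheme.ΓSpecIso (.of Q)).inv.hom)]
  rw [← specMap_point 𝒜 e hd h0 hf (Scheme.ΓSpecIso (.of Q)).inv.hom]
  simp

end Points

end AlgebraicGeometry.Proj

theorem MvPolynomial.IsHomogeneous.eval₂_mul_left {σ R S : Type*} [CommSemiring R]
    [CommSemiring S] {q : MvPolynomial σ R} {n : ℕ} (hq : q.IsHomogeneous n) (φ : R →+* S) (c : S)
    (p : σ → S) : q.eval₂ φ (fun i => c * p i) = c ^ n * q.eval₂ φ p := by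
  rw [MvPolynomial.eval₂_eq, MvPolynomial.eval₂_eq, Finset.mul_sum]
  refine Finset.sum_congr rfl fun d hd => ?_
  simp only [mul_pow, Finset.prod_mul_distrib, Finset.prod_pow_eq_pow_sum]
  have hn : ∑ i ∈ d.support, d i = n := by
    rw [← hq (MvPolynomial.mem_support_iff.mp hd)]
    simp [Finsupp.weight_apply, Finsupp.sum]
  rw [hn]
  ring

/-! ### Homogeneous coordinates and affine charts on plane cubics. -/

namespace WeierstrassCurve

open HomogeneousLocalization

variable {R S Q Q' : Type u} [CommRing R] [CommRing S] [CommRing Q] [CommRing Q']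

section Points

variable (W : WeierstrassCurve R)

/-- The triple `p` of elements of the `R`-algebra `Q` satisfies the homogeneous equation of `W`. -/
def IsPoint (φ : R →+* Q) (p : Fin 3 → Q) : Prop :=
  p 1 ^ 2 * p 2 + φ W.a₁ * p 0 * p 1 * p 2 + φ W.a₃ * p 1 * p 2 ^ 2
    - (p 0 ^ 3 + φ W.a₂ * p 0 ^ 2 * p 2 + φ W.a₄ * p 0 * p 2 ^ 2 + φ W.a₆ * p 2 ^ 3) = 0

variable {W}

theorem eval₂_polynomial (φ : R →+* Q) (p : Fin 3 → Q) :
    MvPolynomial.eval₂Hom φ p (Projective.polynomial W) =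
      p 1 ^ 2 * p 2 + φ W.a₁ * p 0 * p 1 * p 2 + φ W.a₃ * p 1 * p 2 ^ 2
    - (p 0 ^ 3 + φ W.a₂ * p 0 ^ 2 * p 2 + φ W.a₄ * p 0 * p 2 ^ 2 + φ W.a₆ * p 2 ^ 3) := by
  simp only [Projective.polynomial, MvPolynomial.coe_eval₂Hom, map_sub, map_add,
    map_mul, map_pow, MvPolynomial.eval₂_X, MvPolynomial.eval₂_C]

theorem IsPoint.comp {φ : R →+* Q} {p : Fin 3 → Q} (h : W.IsPoint φ p) (ρ : Q →+* Q') :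
    W.IsPoint (ρ.comp φ) (ρ ∘ p) := by
  have := congrArg ρ h
  simpa only [IsPoint, map_sub, map_add, map_mul, map_pow, map_zero, Function.comp_apply,
    RingHom.comp_apply] using this

/-- Evaluation of homogeneous polynomials at a point. -/
noncomputable def evalPoint {φ : R →+* Q} {p : Fin 3 → Q} (h : W.IsPoint φ p) :
    W.HomogRing →+* Q :=
  Ideal.Quotient.lift _ (MvPolynomial.eval₂Hom φ p) (by
    intro a ha
    have : Ideal.span {Projective.polynomial W} ≤ RingHom.ker (MvPolynomial.eval₂Hom φ p) := by
      rw [Ideal.span_singleton_le_iff_mem, RingHom.mem_ker, eval₂_polynomial]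
      exact h
    exact this ha)

theorem evalPoint_mk {φ : R →+* Q} {p : Fin 3 → Q} (h : W.IsPoint φ p)
    (q : MvPolynomial (Fin 3) R) :
    evalPoint h (Ideal.Quotient.mk _ q) = q.eval₂ φ p :=
  rfl

@[simp]
theorem evalPoint_coord {φ : R →+* Q} {p : Fin 3 → Q} (h : W.IsPoint φ p) (i : Fin 3) :
    evalPoint h (W.coord i) = p i :=
  MvPolynomial.eval₂_X _ _ _

@[simp]
theorem evalPoint_algebraMap {φ : R →+* Q} {p : Fin 3 → Q} (h : W.IsPoint φ p) (r : R) :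
    evalPoint h (algebraMap R _ r) = φ r :=
  MvPolynomial.eval₂_C _ _ _

theorem homogRing_hom_ext {f g : W.HomogRing →+* Q}
    (h : ∀ r, f (algebraMap R _ r) = g (algebraMap R _ r))
    (h' : ∀ i, f (W.coord i) = g (W.coord i)) :
    f = g :=
  Ideal.Quotient.ringHom_ext (MvPolynomial.ringHom_ext h h')

theorem comp_evalPoint {φ : R →+* Q} {p : Fin 3 → Q} (h : W.IsPoint φ p) (ρ : Q →+* Q') :
    ρ.comp (evalPoint h) = evalPoint (h.comp ρ) :=
  homogRing_hom_ext (fun r => by simp) (fun i => by simp)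

/-- The morphism `Spec Q ⟶ W.scheme` with homogeneous coordinates `p`, where `p i` is a unit. -/
noncomputable def point {φ : R →+* Q} {p : Fin 3 → Q} (h : W.IsPoint φ p) (i : Fin 3)
    (hi : IsUnit (p i)) : Spec (.of Q) ⟶ W.scheme :=
  Proj.point W.homogPart (evalPoint h) (W.coord_mem i) one_pos (by rwa [evalPoint_coord])

theorem point_congr {φ φ' : R →+* Q} {p p' : Fin 3 → Q} (h : W.IsPoint φ p) (h' : W.IsPoint φ' p')
    {i j : Fin 3} (hi : IsUnit (p i)) (hj : IsUnit (p' j)) (hφ : φ = φ') (hp : p = p') :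
    point h i hi = point h' j hj := by
  subst hφ hp
  exact Proj.point_eq_point _ _ _ _ _ _ _ _

theorem point_congr_mul {φ φ' : R →+* Q} {p p' : Fin 3 → Q} (h : W.IsPoint φ p)
    (h' : W.IsPoint φ' p') {i j : Fin 3} (hi : IsUnit (p i)) (hj : IsUnit (p' j)) (hφ : φ = φ')
    (c : Q) (hc : IsUnit c) (hp : ∀ k, p' k = c * p k) :
    point h i hi = point h' j hj := by
  subst hφ
  obtain rfl : p' = fun k => c * p k := funext hp
  have hi' : IsUnit (c * p i) := hc.mul hi
  rw [point_congr h' h' hj hi' rfl rfl]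
  refine Proj.point_congr _ _ _ _ _ ?_
  rintro n _ ⟨q, hq, rfl⟩
  have hq' : q.IsHomogeneous n := by simpa using hq
  rw [evalPoint_coord, evalPoint_coord]
  refine (congrArg (· * _) (evalPoint_mk h q)).trans
    (.trans ?_ (congrArg (· * _) (evalPoint_mk h' q)).symm)
  rw [hq'.eval₂_mul_left]
  ring

theorem specMap_point {φ : R →+* Q} {p : Fin 3 → Q} (h : W.IsPoint φ p) {i : Fin 3}
    (hi : IsUnit (p i)) (ρ : Q →+* Q') :
    Spec.map (CommRingCat.ofHom ρ) ≫ point h i hi = point (h.comp ρ) i (hi.map ρ) := by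
  unfold point
  rw [Proj.specMap_point]
  simp only [comp_evalPoint]

theorem isPoint_infinity : W.IsPoint (RingHom.id R) ![0, 1, 0] := by
  simp [IsPoint]

theorem isUnit_infinity : IsUnit ((![0, 1, 0] : Fin 3 → Q) 1) :=
  isUnit_one

theorem infinity_eq_point :
    W.infinity = point W.isPoint_infinity 1 isUnit_infinity := by
  have h : W.evalInfinity = evalPoint W.isPoint_infinity := by
    refine homogRing_hom_ext (fun r => ?_) (fun i => ?_)
    · rw [evalPoint_algebraMap]
      exact MvPolynomial.eval_C _
    · rw [evalPoint_coord]
      exact MvPolynomial.eval_X _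
  unfold infinity point
  rw [Proj.fromOfGlobalSections_eq_point _ _ _ (W.coord_mem 1) one_pos
    (by rw [evalInfinity_coord_one]; exact isUnit_one)]
  simp only [h]

variable (W) in
/-- The standard affine chart `D₊(Xᵢ)`. -/
noncomputable abbrev chartRing (i : Fin 3) : Type u :=
  Away W.homogPart (W.coord i)

variable (W) in
/-- The inclusion of the standard affine chart `D₊(Xᵢ)`. -/
noncomputable abbrev chart (i : Fin 3) : Spec (.of (W.chartRing i)) ⟶ W.scheme :=
  Proj.awayι W.homogPart (W.coord i) (W.coord_mem i) one_pos

variable (W) in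
/-- The structure homomorphism of the standard affine chart `D₊(Xᵢ)`. -/
noncomputable def chartC (i : Fin 3) : R →+* W.chartRing i :=
  (fromZeroRingHom W.homogPart _).comp (algebraMap R (W.homogPart 0))

variable (W) in
/-- The function `Xⱼ / Xᵢ` on `D₊(Xᵢ)`. -/
noncomputable def chartCoord (i j : Fin 3) : W.chartRing i :=
  Away.mk W.homogPart (W.coord_mem i) 1 (W.coord j) (W.coord_mem j)

theorem chart_toSpec (i : Fin 3) :
    W.chart i ≫ W.toSpec = Spec.map (CommRingCat.ofHom (W.chartC i)) := by
  rw [toSpec, Proj.awayι_toSpecZero_assoc, ← Spec.map_comp]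
  rfl

theorem awayLift_chartC {φ : R →+* Q} {p : Fin 3 → Q} (h : W.IsPoint φ p) (i : Fin 3)
    (hi : IsUnit (evalPoint h (W.coord i))) (r : R) :
    Proj.awayLift W.homogPart (evalPoint h) hi (W.chartC i r) = φ r := by
  have := Proj.awayLift_mk W.homogPart (evalPoint h) hi (W.coord_mem i) 0 (algebraMap R _ r)
    (by simpa using (algebraMap R (W.homogPart 0) r).2)
  rw [pow_zero, mul_one, evalPoint_algebraMap] at this
  rw [← this]
  congr 1

theorem awayLift_chartCoord {φ : R →+* Q} {p : Fin 3 → Q} (h : W.IsPoint φ p) (i j : Fin 3)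
    (hi : IsUnit (evalPoint h (W.coord i))) :
    Proj.awayLift W.homogPart (evalPoint h) hi (W.chartCoord i j) * p i = p j := by
  simpa [chartCoord] using Proj.awayLift_mk W.homogPart (evalPoint h) hi (W.coord_mem i) 1
    (W.coord j) (W.coord_mem j)

theorem point_toSpec {φ : R →+* Q} {p : Fin 3 → Q} (h : W.IsPoint φ p) {i : Fin 3}
    (hi : IsUnit (p i)) : point h i hi ≫ W.toSpec = Spec.map (CommRingCat.ofHom φ) := by
  unfold point Proj.point
  rw [Category.assoc, chart_toSpec, ← Spec.map_comp, ← CommRingCat.ofHom_comp]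
  congr 2
  ext r
  exact awayLift_chartC h i (by rwa [evalPoint_coord]) r

theorem algebraMap_chartCoord (i j : Fin 3) :
    algebraMap W.HomogRing (Localization.Away (W.coord i)) (W.coord i) *
      algebraMap (W.chartRing i) (Localization.Away (W.coord i)) (W.chartCoord i j) =
      algebraMap W.HomogRing _ (W.coord j) := by
  have := Proj.algebraMap_away_mk W.homogPart (W.coord_mem i) 1 (W.coord j) (W.coord_mem j)
  rwa [pow_one, mul_comm] at this

theorem algebraMap_chartC (i : Fin 3) (r : R) :
    algebraMap (W.chartRing i) (Localization.Away (W.coord i)) (W.chartC i r) =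
      algebraMap W.HomogRing _ (algebraMap R _ r) :=
  rfl

theorem algebraMap_chartRing_injective (i : Fin 3) : Function.Injective
    (algebraMap (W.chartRing i) (Localization.Away (W.coord i))) :=
  HomogeneousLocalization.val_injective _

theorem isUnit_algebraMap_coord (i : Fin 3) :
    IsUnit (algebraMap W.HomogRing (Localization.Away (W.coord i)) (W.coord i)) :=
  IsLocalization.Away.algebraMap_isUnit _

theorem chartCoord_self (i : Fin 3) : W.chartCoord i i = 1 := by
  apply algebraMap_chartRing_injective
  apply (isUnit_algebraMap_coord i).mul_left_cancel
  rw [algebraMap_chartCoord, map_one, mul_one]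

/-- Dehomogenization: dividing a form of degree `n` by `Xᵢ ^ n` amounts to evaluating it at the
ratios `Xⱼ / Xᵢ`. Hence these ratios generate the chart ring over `R`. -/
theorem mk_eq_eval₂ (i : Fin 3) {n : ℕ} (q : MvPolynomial (Fin 3) R) (hq : q.IsHomogeneous n)
    (hx) : Away.mk W.homogPart (W.coord_mem i) n (Ideal.Quotient.mk _ q) hx =
      q.eval₂ (W.chartC i) (W.chartCoord i) := by
  apply algebraMap_chartRing_injective
  apply ((isUnit_algebraMap_coord i).pow n).mul_left_cancel
  rw [mul_comm, Proj.algebraMap_away_mk, MvPolynomial.hom_eval₂, ← hq.eval₂_mul_left]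
  simp only [algebraMap_chartCoord]
  have : (algebraMap W.HomogRing (Localization.Away (W.coord i))).comp (Ideal.Quotient.mk _) =
      MvPolynomial.eval₂Hom ((algebraMap (W.chartRing i) _).comp (W.chartC i)) (fun j =>
        algebraMap W.HomogRing (Localization.Away (W.coord i)) (W.coord j)) := by
    refine MvPolynomial.ringHom_ext (fun r => ?_) fun j => ?_
    · rw [MvPolynomial.coe_eval₂Hom, MvPolynomial.eval₂_C]
      rfl
    · rw [MvPolynomial.coe_eval₂Hom, MvPolynomial.eval₂_X]
      rfl
  exact RingHom.congr_fun this q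

theorem exists_eq_eval₂ (i : Fin 3) (y : W.chartRing i) :
    ∃ q : MvPolynomial (Fin 3) R, y = q.eval₂ (W.chartC i) (W.chartCoord i) := by
  obtain ⟨n, _, ⟨q, hq, rfl⟩, rfl⟩ := Away.mk_surjective W.homogPart (W.coord_mem i) y
  exact ⟨q, mk_eq_eval₂ i q (by simpa using hq) _⟩

theorem chartRing_hom_ext {i : Fin 3} {f g : W.chartRing i →+* Q}
    (h : ∀ r, f (W.chartC i r) = g (W.chartC i r))
    (h' : ∀ j, f (W.chartCoord i j) = g (W.chartCoord i j)) : f = g := by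
  ext y
  obtain ⟨q, rfl⟩ := exists_eq_eval₂ i y
  rw [MvPolynomial.hom_eval₂, MvPolynomial.hom_eval₂]
  congr 1
  · exact RingHom.ext h
  · exact funext h'

theorem isPoint_chartCoord (i : Fin 3) : W.IsPoint (W.chartC i) (W.chartCoord i) := by
  have h := W.coord_relation
  apply_fun algebraMap W.HomogRing (Localization.Away (W.coord i)) at h
  simp only [map_sub, map_add, map_mul, map_pow, map_zero] at h
  apply algebraMap_chartRing_injective
  apply ((isUnit_algebraMap_coord i).pow 3).mul_left_cancel
  simp only [map_sub, map_add, map_mul, map_pow, map_zero, algebraMap_chartC]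
  simp only [← algebraMap_chartCoord i 0, ← algebraMap_chartCoord i 1,
    ← algebraMap_chartCoord i 2] at h
  rw [mul_zero, ← h]
  ring

theorem specMap_chart {i : Fin 3} (f : W.chartRing i →+* Q) :
    Spec.map (CommRingCat.ofHom f) ≫ W.chart i =
      point ((isPoint_chartCoord i).comp f) i (by simp [chartCoord_self]) := by
  unfold point Proj.point
  congr 3
  refine chartRing_hom_ext (fun r => ?_) (fun j => ?_)
  · rw [awayLift_chartC]
    rfl
  · have := awayLift_chartCoord ((isPoint_chartCoord i).comp f) i j (by simp [chartCoord_self])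
    simp only [Function.comp_apply, chartCoord_self, map_one, mul_one] at this
    exact this.symm

theorem chart_eq_point (i : Fin 3) :
    W.chart i = point (isPoint_chartCoord i) i (by simp [chartCoord_self]) := by
  have := specMap_chart (W := W) (RingHom.id (W.chartRing i))
  rw [CommRingCat.ofHom_id, Spec.map_id, Category.id_comp] at this
  exact this

theorem point_injective {φ φ' : R →+* Q} {p p' : Fin 3 → Q} {h : W.IsPoint φ p}
    {h' : W.IsPoint φ' p'} {i : Fin 3} {hi : IsUnit (p i)} {hi' : IsUnit (p' i)}
    (H : point h i hi = point h' i hi') (j : Fin 3) : p j * p' i = p' j * p i := by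
  unfold point Proj.point at H
  rw [cancel_mono] at H
  have H' := congrArg CommRingCat.Hom.hom (Spec.map_injective H)
  have h1 := awayLift_chartCoord h i j (by rwa [evalPoint_coord])
  have h2 := awayLift_chartCoord h' i j (by rwa [evalPoint_coord])
  rw [CommRingCat.hom_ofHom, CommRingCat.hom_ofHom] at H'
  rw [← H'] at h2
  rw [← h1, ← h2]
  ring

theorem range_chart (i : Fin 3) :
    Set.range (W.chart i) = Proj.basicOpen W.homogPart (W.coord i) :=
  congrArg SetLike.coe (Proj.opensRange_awayι W.homogPart (W.coord i) (W.coord_mem i) one_pos)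

theorem exists_eq_point (i : Fin 3) (f : Spec (.of Q) ⟶ W.scheme)
    (hf : Set.range f ⊆ Proj.basicOpen W.homogPart (W.coord i)) :
    ∃ (φ : R →+* Q) (p : Fin 3 → Q) (h : W.IsPoint φ p) (hi : p i = 1),
      f = point h i (hi ▸ isUnit_one) := by
  have hr : Set.range f ⊆ Set.range (W.chart i) := by
    rwa [range_chart]
  obtain ⟨ρ, hρ⟩ := Spec.map_surjective (IsOpenImmersion.lift (W.chart i) f hr)
  refine ⟨_, _, (isPoint_chartCoord i).comp ρ.hom, by simp [chartCoord_self], ?_⟩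
  rw [← IsOpenImmersion.lift_fac (W.chart i) f hr, ← hρ]
  exact specMap_chart ρ.hom

theorem range_point_subset {φ : R →+* Q} {p : Fin 3 → Q} (h : W.IsPoint φ p) {i : Fin 3}
    (hi : IsUnit (p i)) :
    Set.range (point h i hi) ⊆ Proj.basicOpen W.homogPart (W.coord i) := by
  rw [← range_chart]
  rintro _ ⟨x, rfl⟩
  unfold point Proj.point
  rw [Scheme.Hom.comp_apply]
  exact ⟨_, rfl⟩

/-- The homogeneous coordinates of the image of a point under `schemeChange`. -/
def changePoint (φ : S →+* Q) (C : VariableChange S) (p : Fin 3 → Q) : Fin 3 → Q :=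
  ![φ (C.u ^ 2) * p 0 + φ C.r * p 2,
    φ (C.u ^ 3) * p 1 + φ (C.u ^ 2 * C.s) * p 0 + φ C.t * p 2, p 2]

theorem isPoint_of_hom (e : W.HomogRing →+* Q) :
    W.IsPoint (e.comp (algebraMap R _)) (fun i => e (W.coord i)) := by
  have h := congrArg e W.coord_relation
  simpa only [IsPoint, RingHom.comp_apply, map_sub, map_add, map_mul, map_pow, map_zero] using h

theorem evalPoint_ringChange_coord {W₁ : WeierstrassCurve R} {W₂ : WeierstrassCurve S} {ψ : R →+* S}
    {C : VariableChange S} (hC : C • W₁.map ψ = W₂) {φ : S →+* Q} {p : Fin 3 → Q}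
    (h : W₂.IsPoint φ p) (i : Fin 3) :
    evalPoint h (ringChange ψ C hC (W₁.coord i)) = changePoint φ C p i := by
  have e₀ : ringChange ψ C hC (W₁.coord 0) = _ := polyChange_X_zero W₂ ψ C
  have e₁ : ringChange ψ C hC (W₁.coord 1) = _ := polyChange_X_one W₂ ψ C
  have e₂ : ringChange ψ C hC (W₁.coord 2) = _ := polyChange_X_two W₂ ψ C
  match i with
  | 0 => simp only [e₀, map_add, map_mul, evalPoint_algebraMap, evalPoint_coord, changePoint,
      Matrix.cons_val_zero]
  | 1 =>
    rw [e₁]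
    simp only [map_add, map_mul φ, map_mul (evalPoint h), evalPoint_algebraMap, evalPoint_coord,
      changePoint, Matrix.cons_val_one, Matrix.cons_val_zero]
  | 2 =>
    rw [e₂, evalPoint_coord]
    rfl

theorem isPoint_changePoint {W₁ : WeierstrassCurve R} {W₂ : WeierstrassCurve S} {ψ : R →+* S}
    {C : VariableChange S} (hC : C • W₁.map ψ = W₂) {φ : S →+* Q} {p : Fin 3 → Q}
    (h : W₂.IsPoint φ p) : W₁.IsPoint (φ.comp ψ) (changePoint φ C p) := by
  have := isPoint_of_hom ((evalPoint h).comp (ringChange ψ C hC))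
  convert this using 1
  · ext r
    rw [RingHom.comp_apply, RingHom.comp_apply, RingHom.comp_apply, ringChange_algebraMap,
      evalPoint_algebraMap]
  · ext i
    exact (evalPoint_ringChange_coord hC h i).symm

theorem point_schemeChange {W₁ : WeierstrassCurve R} {W₂ : WeierstrassCurve S} {ψ : R →+* S}
    {C : VariableChange S} (hC : C • W₁.map ψ = W₂) {φ : S →+* Q} {p : Fin 3 → Q}
    (h : W₂.IsPoint φ p) {k : Fin 3} (hk : IsUnit (p k)) {i : Fin 3}
    (hi : IsUnit (changePoint φ C p i)) :
    point h k hk ≫ schemeChange ψ C hC = point (isPoint_changePoint hC h) i hi := by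
  have hi' : IsUnit (evalPoint h (gradedChange ψ C hC (W₁.coord i))) := by
    change IsUnit (evalPoint h (ringChange ψ C hC (W₁.coord i)))
    rwa [evalPoint_ringChange_coord]
  unfold point schemeChange
  rw [Proj.point_eq_point _ _ _ _ _ ((gradedChange ψ C hC).map_mem (W₁.coord_mem i)) one_pos hi']
  refine Proj.point_map _ _ _ _ _ (fun x => ?_) _ _ _ _ _ _
  change _ = evalPoint h (ringChange ψ C hC x)
  have : evalPoint (isPoint_changePoint hC h) = (evalPoint h).comp (ringChange ψ C hC) := by
    refine homogRing_hom_ext (fun r => ?_) fun i => ?_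
    · rw [RingHom.comp_apply, ringChange_algebraMap, evalPoint_algebraMap, evalPoint_algebraMap]
      rfl
    · rw [RingHom.comp_apply, evalPoint_ringChange_coord, evalPoint_coord]
  rw [this]
  rfl

theorem infinity_schemeChange {W₁ : WeierstrassCurve R} {W₂ : WeierstrassCurve S} {ψ : R →+* S}
    {C : VariableChange S} (hC : C • W₁.map ψ = W₂) :
    W₂.infinity ≫ schemeChange ψ C hC = Spec.map (CommRingCat.ofHom ψ) ≫ W₁.infinity := by
  have h1 : changePoint (RingHom.id S) C ![0, 1, 0] = ![0, (C.u : S) ^ 3, 0] := by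
    simp [changePoint]
  rw [infinity_eq_point, infinity_eq_point,
    point_schemeChange hC _ _ (i := 1) (by rw [h1]; exact C.u.isUnit.pow 3), specMap_point]
  refine (point_congr_mul _ _ _ _ (RingHom.ext fun x => rfl) ((C.u : S) ^ 3) (C.u.isUnit.pow 3)
    fun k => ?_).symm
  rw [h1]
  fin_cases k <;> simp

/-- A change of variables fixes `Z`, hence preserves the complement of infinity. This allows changes
of variables to be composed and compared on that chart alone. -/
theorem chart_two_schemeChange {W₁ : WeierstrassCurve R} {W₂ : WeierstrassCurve S} {ψ : R →+* S}
    {C : VariableChange S} (hC : C • W₁.map ψ = W₂) :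
    ∃ a, W₂.chart 2 ≫ schemeChange ψ C hC = a ≫ W₁.chart 2 := by
  rw [chart_eq_point, point_schemeChange hC _ _ (i := 2) (by
    change IsUnit (W₂.chartCoord 2 2)
    rw [chartCoord_self]
    exact isUnit_one)]
  exact ⟨_, rfl⟩

theorem coord_mem_of_coord_two_mem (x : W.scheme) (h : W.coord 2 ∈ x.asHomogeneousIdeal) :
    W.coord 1 ∉ x.asHomogeneousIdeal := by
  intro h1
  have h0 : W.coord 0 ∈ x.asHomogeneousIdeal := by
    refine x.isPrime.mem_of_pow_mem 3 ?_
    have e : W.coord 0 ^ 3 = W.coord 2 * (W.coord 1 ^ 2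
        + algebraMap R _ W.a₁ * W.coord 0 * W.coord 1
      + algebraMap R _ W.a₃ * W.coord 1 * W.coord 2
      - (algebraMap R _ W.a₂ * W.coord 0 ^ 2
        + algebraMap R _ W.a₄ * W.coord 0 * W.coord 2
        + algebraMap R _ W.a₆ * W.coord 2 ^ 2)) := by
      linear_combination -W.coord_relation
    rw [e]
    exact Ideal.mul_mem_right _ _ h
  refine x.not_irrelevant_le ?_
  refine irrelevant_le_of_coord_mem W fun i => ?_
  fin_cases i
  exacts [h0, h1, h]

/-- On the locus `Z = 0` the equation forces `X ^ 3 = 0`, so topologically only the point `[0 : 1 :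
0]` of each fiber is left. -/
theorem mem_range_infinity_iff (x : W.scheme) :
    x ∈ Set.range W.infinity ↔ x ∉ Proj.basicOpen W.homogPart (W.coord 2) := by
  constructor
  · rintro ⟨y, rfl⟩ hy
    have h : y ∈ W.infinity ⁻¹ᵁ Proj.basicOpen W.homogPart (W.coord 2) := hy
    have h2 : W.evalInfinity (W.coord 2) = 0 :=
      (MvPolynomial.eval_X (f := ![0, 1, 0]) 2).trans rfl
    rw [infinity, Proj.fromOfGlobalSections_preimage_basicOpen _ _ _ one_pos (W.coord_mem 2),
      RingHom.comp_apply, h2, map_zero, Scheme.basicOpen_zero] at h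
    exact h
  · intro hx
    have hx1 : x ∈ Proj.basicOpen W.homogPart (W.coord 1) := by
      rw [Proj.mem_basicOpen] at hx ⊢
      exact coord_mem_of_coord_two_mem x (not_not.mp hx)
    obtain ⟨y, rfl⟩ : x ∈ Set.range (W.chart 1) := by rwa [range_chart]
    have hy : W.chartCoord 1 2 ∈ y.asIdeal := by
      by_contra hy
      apply hx
      have h1 := Proj.awayι_preimage_basicOpen W.homogPart (W.coord_mem 1) one_pos (W.coord_mem 2)
        one_pos
      have h2 : Away.isLocalizationElem (W.coord_mem 1) (W.coord_mem 2) = W.chartCoord 1 2 := by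
        simp only [Away.isLocalizationElem, chartCoord, pow_one]
      rw [h2] at h1
      have h3 : y ∈ W.chart 1 ⁻¹ᵁ Proj.basicOpen W.homogPart (W.coord 2) := by
        rw [h1]
        exact hy
      exact h3
    have hy0 : W.chartCoord 1 0 ∈ y.asIdeal := by
      refine y.isPrime.mem_of_pow_mem 3 ?_
      have h1 := isPoint_chartCoord (W := W) 1
      unfold IsPoint at h1
      have e : W.chartCoord 1 0 ^ 3 = W.chartCoord 1 2 * (W.chartCoord 1 1 ^ 2
        + W.chartC 1 W.a₁ * W.chartCoord 1 0 * W.chartCoord 1 1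
        + W.chartC 1 W.a₃ * W.chartCoord 1 1 * W.chartCoord 1 2
        - (W.chartC 1 W.a₂ * W.chartCoord 1 0 ^ 2
          + W.chartC 1 W.a₄ * W.chartCoord 1 0 * W.chartCoord 1 2
          + W.chartC 1 W.a₆ * W.chartCoord 1 2 ^ 2)) := by
        linear_combination -h1
      rw [e]
      exact Ideal.mul_mem_right _ _ hy
    -- Restricted to the residue domain at `y`, the chart has coordinates `(0, 1, 0)`, so it factors
    -- through the section at infinity.
    let I : Ideal (W.chartRing 1) := y.asIdeal
    let f := Ideal.Quotient.mk I
    have : I.IsPrime := y.isPrime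
    let z : Spec (.of (W.chartRing 1 ⧸ I)) := (⟨⊥, Ideal.isPrime_bot⟩ : PrimeSpectrum _)
    have hz : Spec.map (CommRingCat.ofHom f) z = y := by
      refine PrimeSpectrum.ext ?_
      change Ideal.comap f ⊥ = _
      rw [← RingHom.ker_eq_comap_bot, Ideal.mk_ker]
    have hp : f ∘ W.chartCoord 1 = f.comp (W.chartC 1) ∘ ![0, 1, 0] := by
      ext i
      fin_cases i
      · simpa using! Ideal.Quotient.eq_zero_iff_mem.mpr hy0
      · simp [chartCoord_self]
      · simpa using! Ideal.Quotient.eq_zero_iff_mem.mpr hy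
    have key : Spec.map (CommRingCat.ofHom f) ≫ W.chart 1 =
        Spec.map (CommRingCat.ofHom (f.comp (W.chartC 1))) ≫ W.infinity := by
      rw [specMap_chart, infinity_eq_point, specMap_point]
      exact point_congr _ _ _ _ rfl hp
    refine ⟨Spec.map (CommRingCat.ofHom (f.comp (W.chartC 1))) z, ?_⟩
    refine (Scheme.Hom.comp_apply _ _ _).symm.trans ?_
    rw [← key, Scheme.Hom.comp_apply, hz]

end Points
end WeierstrassCurve

/-! ### Base change of plane cubics and reduction modulo an ideal. -/

namespace WeierstrassCurve

open HomogeneousLocalization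

section BaseChange

variable {R S T Q : Type u} [CommRing R] [CommRing S] [CommRing T] [CommRing Q]
  (W : WeierstrassCurve R) (f : R →+* S)

theorem IsPoint.of_map {W : WeierstrassCurve R} {f : R →+* S} {φ : S →+* Q} {p : Fin 3 → Q}
    (h : (W.map f).IsPoint φ p) : W.IsPoint (φ.comp f) p := by
  simpa only [IsPoint, map_a₁, map_a₂, map_a₃, map_a₄, map_a₆, RingHom.comp_apply] using h

/-- The restriction of the base change morphism `(W.map f).scheme ⟶ W.scheme` to a chart. -/
noncomputable def chartMap (i : Fin 3) : W.chartRing i →+* (W.map f).chartRing i :=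
  Proj.awayLift W.homogPart (evalPoint (isPoint_chartCoord (W := W.map f) i).of_map)
    (f := W.coord i)
    (by rw [evalPoint_coord, chartCoord_self]; exact isUnit_one)

theorem chartMap_chartC (i : Fin 3) (r : R) :
    W.chartMap f i (W.chartC i r) = (W.map f).chartC i (f r) :=
  awayLift_chartC _ _ _ _

theorem chartMap_chartCoord (i j : Fin 3) :
    W.chartMap f i (W.chartCoord i j) = (W.map f).chartCoord i j := by
  have := awayLift_chartCoord (isPoint_chartCoord (W := W.map f) i).of_map i j
    (by rw [evalPoint_coord, chartCoord_self]; exact isUnit_one)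
  exact (this.symm.trans ((congrArg (_ * ·) (chartCoord_self i)).trans (mul_one _))).symm

theorem changePoint_one (φ : S →+* Q) (p : Fin 3 → Q) : changePoint φ 1 p = p := by
  ext i
  fin_cases i <;> simp [changePoint, VariableChange.one_def]

theorem chart_schemeChange_one (i : Fin 3) :
    (W.map f).chart i ≫ schemeChange f 1 (one_smul _ _) =
      Spec.map (CommRingCat.ofHom (W.chartMap f i)) ≫ W.chart i := by
  rw [chart_eq_point, point_schemeChange _ _ _ (i := i) (by
    rw [changePoint_one, chartCoord_self]; exact isUnit_one), specMap_chart]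
  refine point_congr _ _ _ _ ?_ ?_
  · exact RingHom.ext fun r => (W.chartMap_chartC f i r).symm
  · rw [changePoint_one]
    exact funext fun j => (W.chartMap_chartCoord f i j).symm

/-- A homomorphism out of a chart ring is a structure map together with a solution of the equation
whose `i`-th coordinate is 1. For the base-changed equation these are exactly the compatible pairs
of the universal property. -/
theorem isPushout_chartRing (i : Fin 3) :
    IsPushout (CommRingCat.ofHom (W.chartC i)) (CommRingCat.ofHom f)
      (CommRingCat.ofHom (W.chartMap f i)) (CommRingCat.ofHom ((W.map f).chartC i)) := by
  have w : CommRingCat.ofHom (W.chartC i) ≫ CommRingCat.ofHom (W.chartMap f i) =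
      CommRingCat.ofHom f ≫ CommRingCat.ofHom ((W.map f).chartC i) :=
    CommRingCat.hom_ext (RingHom.ext (W.chartMap_chartC f i))
  have hpt (s : Limits.PushoutCocone (CommRingCat.ofHom (W.chartC i)) (CommRingCat.ofHom f)) :
      (W.map f).IsPoint s.inr.hom (s.inl.hom ∘ W.chartCoord i) := by
    have h := (isPoint_chartCoord (W := W) i).comp s.inl.hom
    have e (r : R) : s.inl.hom (W.chartC i r) = s.inr.hom (f r) :=
      RingHom.congr_fun (congrArg CommRingCat.Hom.hom s.condition) r
    simpa only [IsPoint, map_a₁, map_a₂, map_a₃, map_a₄, map_a₆, RingHom.comp_apply, e] using h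
  have hu (s : Limits.PushoutCocone (CommRingCat.ofHom (W.chartC i)) (CommRingCat.ofHom f)) :
      IsUnit (evalPoint (hpt s) ((W.map f).coord i)) := by
    rw [evalPoint_coord, Function.comp_apply, chartCoord_self, map_one]
    exact isUnit_one
  have hc (s : Limits.PushoutCocone (CommRingCat.ofHom (W.chartC i)) (CommRingCat.ofHom f))
      (j : Fin 3) : Proj.awayLift _ (evalPoint (hpt s)) (hu s) ((W.map f).chartCoord i j) =
        s.inl.hom (W.chartCoord i j) := by
    have := awayLift_chartCoord (hpt s) i j (hu s)
    rwa [Function.comp_apply, chartCoord_self, map_one, mul_one] at this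
  refine .of_isColimit' ⟨w⟩ (Limits.PushoutCocone.IsColimit.mk w
    (fun s => CommRingCat.ofHom (Proj.awayLift _ (evalPoint (hpt s)) (hu s)))
    (fun s => ?_) (fun s => ?_) (fun s m h1 h2 => ?_))
  · ext x
    refine RingHom.congr_fun (f := RingHom.comp _ (W.chartMap f i)) (g := s.inl.hom)
      (chartRing_hom_ext (fun r => ?_) fun j => ?_) x
    · rw [RingHom.comp_apply, chartMap_chartC]
      exact (awayLift_chartC (hpt s) i (hu s) _).trans
        (RingHom.congr_fun (congrArg CommRingCat.Hom.hom s.condition) r).symm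
    · rw [RingHom.comp_apply, chartMap_chartCoord]
      exact hc s j
  · ext x
    exact awayLift_chartC (hpt s) i (hu s) x
  · ext x
    refine RingHom.congr_fun (f := m.hom)
      (chartRing_hom_ext (fun r => ?_) fun j => ?_) x
    · refine .trans ?_ (awayLift_chartC (hpt s) i (hu s) r).symm
      exact RingHom.congr_fun (congrArg CommRingCat.Hom.hom h2) r
    · refine .trans ?_ (hc s j).symm
      rw [← chartMap_chartCoord]
      exact RingHom.congr_fun (congrArg CommRingCat.Hom.hom h1) _

/-- The covering of `W.scheme` by the standard affine charts. -/
noncomputable def chartCover : W.scheme.OpenCover :=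
  (Proj.affineOpenCoverOfIrrelevantLESpan W.homogPart W.coord W.coord_mem (fun _ => one_pos)
    (irrelevant_le_of_coord_mem W fun i => Ideal.subset_span ⟨i, rfl⟩)).openCover

theorem preimage_opensRange_chart (i : Fin 3) :
    schemeChange f 1 (one_smul _ (W.map f)) ⁻¹ᵁ (W.chart i).opensRange =
      ((W.map f).chart i).opensRange := by
  rw [Proj.opensRange_awayι, Proj.opensRange_awayι, schemeChange, Proj.map_preimage_basicOpen]
  congr 1
  have : polyChange (W.map f) f 1 (.X i) = (W.map f).coord i := by
    match i with
    | 0 => simp [polyChange_X_zero, VariableChange.one_def]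
    | 1 => simp [polyChange_X_one, VariableChange.one_def]
    | 2 => simp [polyChange_X_two]
  exact this

/-- The comparison map to the fiber product is an isomorphism because it is one over each standard
chart, where it is the pushout of chart rings. -/
theorem isPullback_schemeChange_one :
    IsPullback (schemeChange f 1 (one_smul _ (W.map f))) (W.map f).toSpec W.toSpec
      (Spec.map (CommRingCat.ofHom f)) := by
  let g := schemeChange f 1 (one_smul _ (W.map f))
  have w : g ≫ W.toSpec = (W.map f).toSpec ≫ Spec.map (CommRingCat.ofHom f) :=
    schemeChange_toSpec f 1 _
  let c := Limits.pullback.lift _ _ w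
  let fst := Limits.pullback.fst W.toSpec (Spec.map (CommRingCat.ofHom f))
  let snd := Limits.pullback.snd W.toSpec (Spec.map (CommRingCat.ofHom f))
  suffices IsIso c from
    .of_iso_pullback ⟨w⟩ (asIso c) (Limits.pullback.lift_fst _ _ w) (Limits.pullback.lift_snd _ _ w)
  suffices H : ∀ i : Fin 3, IsIso (Limits.pullback.snd c (Limits.pullback.fst fst (W.chart i))) from
    IsZariskiLocalAtTarget.of_openCover (P := MorphismProperty.isomorphisms Scheme)
      (Precoverage.ZeroHypercover.pullback₁ fst W.chartCover) H
  intro i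
  have hi : IsPullback (Spec.map (CommRingCat.ofHom (W.chartMap f i))) ((W.map f).chart i)
      (W.chart i) g := IsOpenImmersion.isPullback _ _ _ _ (W.chart_schemeChange_one f i)
    (W.preimage_opensRange_chart f i)
  have hp : IsPullback (Limits.pullback.snd fst (W.chart i)) (Limits.pullback.fst fst (W.chart i))
      (W.chart i) fst := (IsPullback.of_hasPullback fst (W.chart i)).flip
  let e := hp.lift (Spec.map (CommRingCat.ofHom (W.chartMap f i))) ((W.map f).chart i ≫ c)
    (by rw [hi.w, Category.assoc, Limits.pullback.lift_fst])
  have he : IsPullback e ((W.map f).chart i) (Limits.pullback.fst fst (W.chart i)) c := by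
    refine IsPullback.of_right (h₁₂ := Limits.pullback.snd fst (W.chart i)) (v₁₃ := W.chart i)
      (h₂₂ := fst) ?_ (hp.lift_snd _ _ _) hp
    rwa [hp.lift_fst, Limits.pullback.lift_fst]
  have hq : IsPullback (Limits.pullback.snd fst (W.chart i))
      (Limits.pullback.fst fst (W.chart i) ≫ snd) (W.chart i ≫ W.toSpec)
      (Spec.map (CommRingCat.ofHom f)) :=
    hp.paste_vert (IsPullback.of_hasPullback _ _)
  have hq' : IsPullback (Spec.map (CommRingCat.ofHom (W.chartMap f i)))
      ((W.map f).chart i ≫ (W.map f).toSpec) (W.chart i ≫ W.toSpec)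
      (Spec.map (CommRingCat.ofHom f)) := by
    rw [chart_toSpec, chart_toSpec]
    exact isPullback_SpecMap_of_isPushout _ _ _ _ (W.isPushout_chartRing f i)
  -- Both the chart of the base-changed cubic and the preimage of the chart in the fiber product are
  -- pullbacks of the same chart along `Spec f`.
  have : IsIso e := by
    have : e = (hq'.isoIsPullback _ _ hq).hom := by
      refine hq.hom_ext ?_ ?_
      · rw [hp.lift_fst, IsPullback.isoIsPullback_hom_fst]
      · rw [IsPullback.isoIsPullback_hom_snd, hp.lift_snd_assoc, Category.assoc,
          Limits.pullback.lift_snd]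
    rw [this]
    infer_instance
  have h2 := he.flip.isoPullback_hom_snd
  rw [← Iso.eq_inv_comp] at h2
  rw [h2]
  infer_instance

end BaseChange

section Fiber

variable {R S : Type u} [CommRing R] [CommRing S]

/-- The base change of `W.scheme` to `Spec (R / I)` is the plane cubic defined by the reduction of
the equation. -/
noncomputable def reductionIso (W : WeierstrassCurve R) (I : Ideal R) :
    (W.map (Ideal.Quotient.mk I)).scheme ≅ W.fiber I :=
  (W.isPullback_schemeChange_one (Ideal.Quotient.mk I)).isoPullback

theorem reductionIso_hom_fst (W : WeierstrassCurve R) (I : Ideal R) :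
    (W.reductionIso I).hom ≫ Limits.pullback.fst _ _ =
      schemeChange (Ideal.Quotient.mk I) 1 (one_smul _ _) :=
  IsPullback.isoPullback_hom_fst _

theorem reductionIso_hom_fiberToSpec (W : WeierstrassCurve R) (I : Ideal R) :
    (W.reductionIso I).hom ≫ W.fiberToSpec I = (W.map (Ideal.Quotient.mk I)).toSpec :=
  IsPullback.isoPullback_hom_snd _

theorem infinity_reductionIso_hom (W : WeierstrassCurve R) (I : Ideal R) :
    (W.map (Ideal.Quotient.mk I)).infinity ≫ (W.reductionIso I).hom = W.fiberInfinity I := by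
  refine Limits.pullback.hom_ext ?_ ?_
  · rw [Category.assoc, reductionIso_hom_fst, infinity_schemeChange, fiberInfinity,
      Limits.pullback.lift_fst]
  · rw [Category.assoc, reductionIso_hom_fiberToSpec, infinity_toSpec, fiberInfinity,
      Limits.pullback.lift_snd]

theorem map_mk_smul {W₁ : WeierstrassCurve R} {W₂ : WeierstrassCurve S} {φ : R →+* S}
    {C : VariableChange S} (h : C • W₁.map φ = W₂) {I : Ideal R} {J : Ideal S}
    (hIJ : I ≤ J.comap φ) :
    C.map (Ideal.Quotient.mk J) • (W₁.map (Ideal.Quotient.mk I)).map (Ideal.quotientMap J φ hIJ) =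
      W₂.map (Ideal.Quotient.mk J) := by
  rw [map_map, Ideal.quotientMap_comp_mk, ← map_map, map_variableChange, h]

/-- Under the identification of fibers with reduced cubics, the Galois action on fibers becomes the
reduced change of variables, which is what makes equivariance computable. -/
theorem reductionIso_hom_fiberChange {W₁ : WeierstrassCurve R} {W₂ : WeierstrassCurve S}
    {φ : R →+* S} {C : VariableChange S} (h : C • W₁.map φ = W₂) {I : Ideal R} {J : Ideal S}
    (hIJ : I ≤ J.comap φ) :
    (W₂.reductionIso J).hom ≫ fiberChange φ C h hIJ =
      schemeChange _ _ (map_mk_smul h hIJ) ≫ (W₁.reductionIso I).hom := by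
  refine Limits.pullback.hom_ext ?_ ?_
  · rw [Category.assoc, Category.assoc, fiberChange, Limits.pullback.lift_fst, reductionIso_hom_fst,
      ← Category.assoc, reductionIso_hom_fst]
    have h'' : C.map (Ideal.Quotient.mk J) • W₁.map ((Ideal.Quotient.mk J).comp φ) =
        W₂.map (Ideal.Quotient.mk J) := by
      rw [← map_map, map_variableChange, h]
    rw [schemeChange_comp _ _ h'' rfl (by rw [one_mul]),
      schemeChange_comp _ _ h'' (Ideal.quotientMap_comp_mk hIJ).symm]
    exact ((congrArg (_ * ·) (map_one (VariableChange.mapHom (Ideal.quotientMap J φ hIJ)))).trans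
      (mul_one _)).symm
  · rw [Category.assoc, Category.assoc, reductionIso_hom_fiberToSpec, fiberChange,
      Limits.pullback.lift_snd, ← Category.assoc, reductionIso_hom_fiberToSpec,
      schemeChange_toSpec]

end Fiber

section Iso

variable {R S : Type u} [CommRing R] [CommRing S]

theorem schemeChange_id (W : WeierstrassCurve R) {C : VariableChange R} {φ : R →+* R}
    (h : C • W.map φ = W) (hφ : φ = RingHom.id R) (hC : C = 1) :
    schemeChange φ C h = 𝟙 W.scheme := by
  subst hφ hC
  have e : gradedChange (RingHom.id R) 1 h = .id _ := by
    have : ringChange (RingHom.id R) 1 h = RingHom.id W.HomogRing := by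
      refine homogRing_hom_ext (fun r => ?_) fun i => ?_
      · rw [ringChange_algebraMap]
        rfl
      · match i with
        | 0 => exact (polyChange_X_zero W _ 1).trans (by simp [VariableChange.one_def])
        | 1 => exact (polyChange_X_one W _ 1).trans (by simp [VariableChange.one_def])
        | 2 => exact polyChange_X_two W _ 1
    exact DFunLike.ext _ _ fun x => RingHom.congr_fun this x
  unfold schemeChange
  rw [← Proj.map_id]
  congr 1

theorem inv_smul_map_symm {W₁ : WeierstrassCurve R} {W₂ : WeierstrassCurve S} (θ : R ≃+* S)
    {C : VariableChange S} (h : C • W₁.map θ.toRingHom = W₂) :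
    (C.map θ.symm.toRingHom)⁻¹ • W₂.map θ.symm.toRingHom = W₁ := by
  have e : θ.symm.toRingHom.comp θ.toRingHom = RingHom.id R := RingHom.ext θ.symm_apply_apply
  rw [← h, ← map_variableChange, inv_smul_smul, map_map, e, map_id]

/-- The isomorphism of plane cubics given by a change of variables over an isomorphism of rings. -/
noncomputable def schemeIso {W₁ : WeierstrassCurve R} {W₂ : WeierstrassCurve S} (θ : R ≃+* S)
    {C : VariableChange S} (h : C • W₁.map θ.toRingHom = W₂) : W₂.scheme ≅ W₁.scheme where
  hom := schemeChange θ.toRingHom C h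
  inv := schemeChange θ.symm.toRingHom (C.map θ.symm.toRingHom)⁻¹ (inv_smul_map_symm θ h)
  hom_inv_id := by
    have e : θ.toRingHom.comp θ.symm.toRingHom = RingHom.id S := RingHom.ext θ.apply_symm_apply
    rw [schemeChange_comp _ _ (φ := θ.symm.toRingHom) (χ := RingHom.id S) (C' := 1)
      (by rw [map_id, one_smul]) e.symm, schemeChange_id _ _ rfl rfl]
    have := map_inv (VariableChange.mapHom θ.toRingHom) (C.map θ.symm.toRingHom)
    refine (mul_inv_eq_one.mpr ?_).symm.trans (congrArg (C * ·) this.symm)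
    change C = (C.map θ.symm.toRingHom).map θ.toRingHom
    rw [VariableChange.map_map, e, VariableChange.map_id]
  inv_hom_id := by
    have e : θ.symm.toRingHom.comp θ.toRingHom = RingHom.id R := RingHom.ext θ.symm_apply_apply
    rw [schemeChange_comp _ _ (φ := θ.toRingHom) (χ := RingHom.id R) (C' := 1)
      (by rw [map_id, one_smul]) e.symm (by rw [inv_mul_cancel]), schemeChange_id _ _ rfl rfl]

/-- A change of variables between the reductions of two Weierstrass equations gives an isomorphism
of pointed schemes. -/
noncomputable def pointedFiberIso {W₁ : WeierstrassCurve R} {I : Ideal R}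
    {W₂ : WeierstrassCurve S} {J : Ideal S} (θ : R ⧸ I ≃+* S ⧸ J) {C : VariableChange (S ⧸ J)}
    (h : C • (W₁.map (Ideal.Quotient.mk I)).map θ.toRingHom = W₂.map (Ideal.Quotient.mk J)) :
    PointedFiberIso W₁ I W₂ J θ where
  iso := (W₁.reductionIso I).symm ≪≫ (schemeIso θ h).symm ≪≫ W₂.reductionIso J
  comp_toSpec := by
    simp only [Iso.trans_hom, Iso.symm_hom, Category.assoc]
    rw [← Category.assoc (W₂.reductionIso J).hom, reductionIso_hom_fiberToSpec,
      Iso.inv_comp_eq, Iso.inv_comp_eq,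
      reductionIso_hom_fiberToSpec]
    exact (schemeChange_toSpec _ _ _).symm
  pointed := by
    simp only [Iso.trans_hom, Iso.symm_hom]
    rw [← infinity_reductionIso_hom, ← infinity_reductionIso_hom, Category.assoc,
      Iso.hom_inv_id_assoc, ← Category.assoc, ← infinity_schemeChange h]
    change (_ ≫ (schemeIso θ h).hom) ≫ _ = _
    rw [Category.assoc, Iso.hom_inv_id_assoc]

end Iso
end WeierstrassCurve

/-! ### Laurent expansions at infinity and orders of poles. -/

namespace WeierstrassCurve

open HomogeneousLocalization

section Expansion

variable {R : Type u} [CommRing R] (W : WeierstrassCurve R)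

open PowerSeries in
/-- The Laurent expansions `x = κ / T²`, `y = κ / T³` of the coordinates at infinity. -/
theorem exists_expansion : ∃ κ : PowerSeries R, constantCoeff κ = 1 ∧
    κ ^ 2 + C W.a₁ * X * κ ^ 2 + C W.a₃ * X ^ 3 * κ =
      κ ^ 3 + C W.a₂ * X ^ 2 * κ ^ 2 + C W.a₄ * X ^ 4 * κ + C W.a₆ * X ^ 6 := by
  let b : PowerSeries R := 1 + C W.a₁ * X - C W.a₂ * X ^ 2
  let c : PowerSeries R := C W.a₃ * X ^ 3 - C W.a₄ * X ^ 4
  let q : Polynomial (PowerSeries R) := .X ^ 3 - .C b * .X ^ 2 - .C c * .X + .C (C W.a₆ * X ^ 6)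
  have hq : q.Monic := by
    unfold q
    monicity!
  -- Modulo `X` the polynomial `q` is the cube of its variable minus the square, which has 1 as a
  -- simple root, so Hensel's lemma applies.
  obtain ⟨κ, h1, h2⟩ := HenselianRing.is_henselian (I := Ideal.span {(X : PowerSeries R)}) q hq 1
    (by
      rw [Ideal.mem_span_singleton, X_dvd_iff]
      simp [q, b, c])
    (by
      have : q.derivative.eval 1 = 1 + X * (C W.a₂ * X * 2 - C W.a₁ * 2 - C W.a₃ * X ^ 2
          + C W.a₄ * X ^ 3) := by
        have hd (b c d : PowerSeries R) : (Polynomial.X ^ 3 - Polynomial.C b * Polynomial.X ^ 2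
            - Polynomial.C c * Polynomial.X + Polynomial.C d).derivative.eval 1 =
              3 - 2 * b - c := by
          simp
          ring
        rw [hd]
        ring
      rw [this, map_add, map_mul, Ideal.Quotient.eq_zero_iff_mem.mpr
        (Ideal.mem_span_singleton_self _), zero_mul, add_zero, map_one]
      exact isUnit_one)
  refine ⟨κ, ?_, ?_⟩
  · rw [Ideal.mem_span_singleton, X_dvd_iff, map_sub, map_one, sub_eq_zero] at h2
    exact h2
  · have h : q.eval κ = 0 := h1
    simp only [q, b, c, Polynomial.eval_add, Polynomial.eval_sub, Polynomial.eval_mul,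
      Polynomial.eval_pow, Polynomial.eval_X, Polynomial.eval_C] at h
    linear_combination -h

/-- The series `κ = T² x = T³ y`, where `T = x / y`. -/
noncomputable def expansion : PowerSeries R :=
  W.exists_expansion.choose

@[simp]
theorem constantCoeff_expansion : PowerSeries.constantCoeff W.expansion = 1 :=
  W.exists_expansion.choose_spec.1

theorem isUnit_expansion : IsUnit W.expansion := by
  rw [PowerSeries.isUnit_iff_constantCoeff, constantCoeff_expansion]
  exact isUnit_one

/-- The coordinates are those of `[κ / T² : κ / T³ : 1]` multiplied by `T³`, so that they are power
series and `Y` is a unit. -/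
theorem isPoint_expansion : W.IsPoint PowerSeries.C
    ![W.expansion * PowerSeries.X, W.expansion, PowerSeries.X ^ 3] := by
  have h := W.exists_expansion.choose_spec.2
  change W.expansion ^ 2 + _ * W.expansion ^ 2 + _ * W.expansion =
    W.expansion ^ 3 + _ * W.expansion ^ 2 + _ * W.expansion + _ at h
  simp only [IsPoint, Matrix.cons_val_zero, Matrix.cons_val_one, Matrix.cons_val]
  linear_combination PowerSeries.X ^ 3 * h

theorem isUnit_expansion_one : IsUnit
    ((![W.expansion * PowerSeries.X, W.expansion, PowerSeries.X ^ 3] : Fin 3 → PowerSeries R) 1) :=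
  W.isUnit_expansion

/-- The formal neighbourhood of the point at infinity. -/
noncomputable def formalPoint : Spec (.of (PowerSeries R)) ⟶ W.scheme :=
  point W.isPoint_expansion 1 W.isUnit_expansion_one

theorem formalPoint_toSpec :
    W.formalPoint ≫ W.toSpec = Spec.map (CommRingCat.ofHom PowerSeries.C) :=
  point_toSpec _ _

theorem specMap_constantCoeff_formalPoint :
    Spec.map (CommRingCat.ofHom PowerSeries.constantCoeff) ≫ W.formalPoint = W.infinity := by
  rw [formalPoint, specMap_point, infinity_eq_point]
  refine point_congr _ _ _ _ (RingHom.ext fun r => by simp) (funext fun i => ?_)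
  fin_cases i <;> simp

/-- The inclusion of the power series in the Laurent series. -/
noncomputable abbrev toLaurent (R : Type u) [CommRing R] : PowerSeries R →+* LaurentSeries R :=
  algebraMap _ _

theorem toLaurent_injective : Function.Injective (toLaurent R) :=
  HahnSeries.ofPowerSeries_injective

theorem isUnit_toLaurent_X : IsUnit (toLaurent R PowerSeries.X) :=
  IsLocalization.map_units (LaurentSeries R)
    (⟨PowerSeries.X, 1, pow_one _⟩ : Submonoid.powers (PowerSeries.X : PowerSeries R))

theorem isUnit_expansion_two : IsUnit ((toLaurent R ∘
    ![W.expansion * PowerSeries.X, W.expansion, PowerSeries.X ^ 3]) 2) := by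
  change IsUnit (toLaurent R (PowerSeries.X ^ 3))
  rw [map_pow]
  exact isUnit_toLaurent_X.pow 3

/-- The Laurent expansion at infinity of functions on the complement of infinity. -/
noncomputable def laurent : W.chartRing 2 →+* LaurentSeries R :=
  Proj.awayLift W.homogPart (evalPoint (W.isPoint_expansion.comp (toLaurent R)))
    (f := W.coord 2) (by
    rw [evalPoint_coord]
    exact W.isUnit_expansion_two)

theorem laurent_chartC (r : R) :
    W.laurent (W.chartC 2 r) = toLaurent R (PowerSeries.C r) :=
  awayLift_chartC _ _ _ _

theorem laurent_x : toLaurent R PowerSeries.X ^ 2 * W.laurent (W.chartCoord 2 0) =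
    toLaurent R W.expansion := by
  have : W.laurent (W.chartCoord 2 0) * toLaurent R (PowerSeries.X ^ 3) =
      toLaurent R (W.expansion * PowerSeries.X) :=
    awayLift_chartCoord (W.isPoint_expansion.comp (toLaurent R)) 2 0 (by
      rw [evalPoint_coord]
      exact W.isUnit_expansion_two)
  refine isUnit_toLaurent_X.mul_right_cancel ?_
  rw [← map_mul, ← this, map_pow]
  ring

theorem laurent_y : toLaurent R PowerSeries.X ^ 3 * W.laurent (W.chartCoord 2 1) =
    toLaurent R W.expansion := by
  have : W.laurent (W.chartCoord 2 1) * toLaurent R (PowerSeries.X ^ 3) =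
      toLaurent R W.expansion :=
    awayLift_chartCoord (W.isPoint_expansion.comp (toLaurent R)) 2 1 (by
      rw [evalPoint_coord]
      exact W.isUnit_expansion_two)
  rw [← this, map_pow]
  ring

/-- The punctured formal neighbourhood of infinity lies in the affine chart. Any morphism can
therefore be described there in two ways, which must agree. -/
theorem specMap_toLaurent_formalPoint :
    Spec.map (CommRingCat.ofHom (toLaurent R)) ≫ W.formalPoint =
      Spec.map (CommRingCat.ofHom W.laurent) ≫ W.chart 2 := by
  rw [formalPoint, specMap_point, point_congr _ (W.isPoint_expansion.comp (toLaurent R)) _ (j := 2)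
    W.isUnit_expansion_two rfl rfl]
  rfl

/-- The basis `1, x, y, x², xy, x³, …` of the ring of functions on the complement of infinity,
indexed by the order of the pole. -/
noncomputable def poleBasis : ℕ → W.chartRing 2
  | 0 => 1
  -- There is no simple pole: the value at index 1 is a filler, and index 1 is excluded in the
  -- statements about coefficients.
  | 1 => 0
  | 2 => W.chartCoord 2 0
  | 3 => W.chartCoord 2 1
  | n + 4 => W.chartCoord 2 0 * poleBasis (n + 2)

theorem exists_laurent_poleBasis : ∀ n, ∃ μ : PowerSeries R,
    toLaurent R PowerSeries.X ^ n * W.laurent (W.poleBasis n) = toLaurent R μ ∧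
      (n ≠ 1 → PowerSeries.constantCoeff μ = 1)
  | 0 => ⟨1, by simp [poleBasis], by simp⟩
  | 1 => ⟨0, by simp [poleBasis], by simp⟩
  | 2 => ⟨W.expansion, by simpa [poleBasis] using W.laurent_x, by simp⟩
  | 3 => ⟨W.expansion, by simpa [poleBasis] using W.laurent_y, by simp⟩
  | n + 4 => by
    obtain ⟨μ, h1, h2⟩ := exists_laurent_poleBasis (n + 2)
    refine ⟨W.expansion * μ, ?_, fun _ => by simp [h2]⟩
    rw [poleBasis, map_mul, map_mul, ← h1, ← laurent_x]
    ring

/-- The function `∑ dₖ fₖ`, where `fₖ` is `poleBasis`. -/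
noncomputable def poleSum : (ℕ →₀ R) →+ W.chartRing 2 :=
  Finsupp.liftAddHom fun k =>
    (AddMonoidHom.mulRight (W.poleBasis k)).comp (W.chartC 2).toAddMonoidHom

@[simp]
theorem poleSum_single (k : ℕ) (a : R) :
    W.poleSum (Finsupp.single k a) = W.chartC 2 a * W.poleBasis k := by
  simp [poleSum]

theorem affine_relation :
    W.chartCoord 2 1 ^ 2 + W.chartC 2 W.a₁ * W.chartCoord 2 0 * W.chartCoord 2 1
    + W.chartC 2 W.a₃ * W.chartCoord 2 1 = W.chartCoord 2 0 ^ 3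
    + W.chartC 2 W.a₂ * W.chartCoord 2 0 ^ 2 + W.chartC 2 W.a₄ * W.chartCoord 2 0
    + W.chartC 2 W.a₆ := by
  have h := isPoint_chartCoord (W := W) 2
  simp only [IsPoint, chartCoord_self] at h
  linear_combination h

theorem x_mul_poleBasis : ∀ k, W.chartCoord 2 0 * W.poleBasis k ∈ W.poleSum.range
  | 0 => ⟨.single 2 1, by simp [poleBasis]⟩
  | 1 => ⟨0, by simp [poleBasis]⟩
  | k + 2 => ⟨.single (k + 4) 1, by simp [poleBasis]⟩

theorem c_mul_mem (a : R) {f : W.chartRing 2} (hf : f ∈ W.poleSum.range) :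
    W.chartC 2 a * f ∈ W.poleSum.range := by
  obtain ⟨d, rfl⟩ := hf
  induction d using Finsupp.induction_linear with
  | zero => simp
  | add d e hd he => rw [map_add, mul_add]; exact add_mem hd he
  | single k b => exact ⟨.single k (a * b), by
    rw [poleSum_single, poleSum_single, map_mul, mul_assoc]⟩

theorem x_mul_mem {f : W.chartRing 2} (hf : f ∈ W.poleSum.range) :
    W.chartCoord 2 0 * f ∈ W.poleSum.range := by
  obtain ⟨d, rfl⟩ := hf
  induction d using Finsupp.induction_linear with
  | zero => simp
  | add d e hd he => rw [map_add, mul_add]; exact add_mem hd he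
  | single k b =>
    rw [poleSum_single, mul_left_comm]
    exact W.c_mul_mem _ (W.x_mul_poleBasis k)

theorem y_mul_poleBasis : ∀ k, W.chartCoord 2 1 * W.poleBasis k ∈ W.poleSum.range
  | 0 => ⟨.single 3 1, by simp [poleBasis]⟩
  | 1 => ⟨0, by simp [poleBasis]⟩
  | 2 => ⟨.single 5 1, by simp [poleBasis, mul_comm]⟩
  | 3 => ⟨.single 6 1 + .single 4 W.a₂ + .single 2 W.a₄ + .single 0 W.a₆ - .single 5 W.a₁
      - .single 3 W.a₃, by
    simp only [map_sub, map_add, poleSum_single, poleBasis, map_one]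
    linear_combination -W.affine_relation⟩
  | k + 4 => by
    rw [poleBasis, mul_left_comm]
    exact W.x_mul_mem (y_mul_poleBasis (k + 2))

theorem y_mul_mem {f : W.chartRing 2} (hf : f ∈ W.poleSum.range) :
    W.chartCoord 2 1 * f ∈ W.poleSum.range := by
  obtain ⟨d, rfl⟩ := hf
  induction d using Finsupp.induction_linear with
  | zero => simp
  | add d e hd he => rw [map_add, mul_add]; exact add_mem hd he
  | single k b =>
    rw [poleSum_single, mul_left_comm]
    exact W.c_mul_mem _ (W.y_mul_poleBasis k)

/-- The combinations of the `poleBasis` contain the constants and are stable under multiplication by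
`x` and `y`; the only nontrivial product is `y²`, which the equation rewrites. -/
theorem poleSum_surjective (f : W.chartRing 2) : ∃ d, W.poleSum d = f := by
  obtain ⟨q, rfl⟩ := exists_eq_eval₂ 2 f
  change _ ∈ W.poleSum.range
  induction q using MvPolynomial.induction_on with
  | C a => exact ⟨.single 0 a, by simp [poleBasis]⟩
  | add p q hp hq => rw [MvPolynomial.eval₂_add]; exact add_mem hp hq
  | mul_X p i hp =>
    rw [MvPolynomial.eval₂_mul, MvPolynomial.eval₂_X, mul_comm]
    match i with
    | 0 => exact W.x_mul_mem hp
    | 1 => exact W.y_mul_mem hp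
    | 2 => rwa [chartCoord_self, one_mul]

/-- The basis functions other than the filler have distinct pole orders and leading coefficient 1,
so over any ring the highest pole cannot cancel. With `N` the largest offending index, the constant
term of `T ^ N` times the expansion is `d N`, but it is also that of `T ^ (N - n) * g`, which is
zero. -/
theorem eq_zero_of_pole_le (d : ℕ →₀ R) (n : ℕ) (g : PowerSeries R)
    (h : toLaurent R PowerSeries.X ^ n * W.laurent (W.poleSum d) = toLaurent R g) (k : ℕ)
    (hk : n < k) (hk1 : k ≠ 1) : d k = 0 := by
  by_contra hd
  let s := d.support.filter fun k => n < k ∧ k ≠ 1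
  have hks : k ∈ s := by simp [s, hd, hk, hk1]
  let N := s.max' ⟨k, hks⟩
  obtain ⟨hN, hnN, hN1⟩ : d N ≠ 0 ∧ n < N ∧ N ≠ 1 := by
    simpa [s] using s.max'_mem ⟨k, hks⟩
  have hmax (j : ℕ) (hj : d j ≠ 0) : j ≤ N := by
    by_contra hlt
    refine hlt (s.le_max' j ?_)
    simp only [s, Finset.mem_filter, Finsupp.mem_support_iff]
    exact ⟨hj, by omega, by omega⟩
  choose μ hμ hμ' using W.exists_laurent_poleBasis
  have e1 : toLaurent R PowerSeries.X ^ N * W.laurent (W.poleSum d) =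
      toLaurent R (∑ j ∈ d.support, PowerSeries.C (d j) * μ j * PowerSeries.X ^ (N - j)) := by
    rw [poleSum, Finsupp.liftAddHom_apply, Finsupp.sum, map_sum, map_sum, Finset.mul_sum]
    refine Finset.sum_congr rfl fun j hj => ?_
    have hjN := hmax j (Finsupp.mem_support_iff.mp hj)
    change _ * W.laurent (W.chartC 2 (d j) * W.poleBasis j) = _
    rw [map_mul, laurent_chartC, map_mul, map_mul, ← hμ, map_pow]
    nth_rw 1 [← Nat.sub_add_cancel hjN]
    ring
  have e2 : toLaurent R PowerSeries.X ^ N * W.laurent (W.poleSum d) =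
      toLaurent R (PowerSeries.X ^ (N - n) * g) := by
    rw [map_mul, ← h, map_pow, ← mul_assoc, ← pow_add, Nat.sub_add_cancel hnN.le]
  have e3 := congrArg PowerSeries.constantCoeff (toLaurent_injective (e1.symm.trans e2))
  have hne : N - n ≠ 0 := by omega
  rw [map_sum, map_mul, map_pow, PowerSeries.constantCoeff_X, zero_pow hne, zero_mul,
    Finset.sum_eq_single N] at e3
  · simp [hμ' N hN1] at e3
    exact hN e3
  · intro j hj hjN
    have := hmax j (Finsupp.mem_support_iff.mp hj)
    have hne : N - j ≠ 0 := by omega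
    simp [hne]
  · intro h
    exact absurd (Finsupp.notMem_support_iff.mp h) hN

end Expansion

end WeierstrassCurve

namespace WeierstrassCurve

open HomogeneousLocalization

section Independence

variable {R : Type u} [CommRing R] (W : WeierstrassCurve R)

theorem chartC_two_injective : Function.Injective (W.chartC 2) := by
  intro a b h
  have := congrArg W.laurent h
  rw [laurent_chartC, laurent_chartC] at this
  exact PowerSeries.C_injective (toLaurent_injective this)

/-- The five functions have pairwise distinct pole orders 0, 2, 3, 4, 5. This independence lets
coefficients of equations and of changes of variables be compared. -/
theorem eq_zero_of_affine_eq_zero {c₀ c₂ c₃ c₄ c₅ : R}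
    (h : W.chartC 2 c₀ + W.chartC 2 c₂ * W.chartCoord 2 0 + W.chartC 2 c₃ * W.chartCoord 2 1
      + W.chartC 2 c₄ * W.chartCoord 2 0 ^ 2
      + W.chartC 2 c₅ * (W.chartCoord 2 0 * W.chartCoord 2 1) = 0) :
    c₀ = 0 ∧ c₂ = 0 ∧ c₃ = 0 ∧ c₄ = 0 ∧ c₅ = 0 := by
  let d : ℕ →₀ R := .single 0 c₀ + .single 2 c₂ + .single 3 c₃ + .single 4 c₄ + .single 5 c₅
  have hd : W.poleSum d = 0 := by
    simp only [d, map_add, poleSum_single, poleBasis]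
    linear_combination h
  have key (k : ℕ) (hk : 0 < k) (hk1 : k ≠ 1) : d k = 0 :=
    W.eq_zero_of_pole_le d 0 0 (by simp [hd]) k hk hk1
  have h2 : c₂ = 0 := by simpa [d] using key 2
  have h3 : c₃ = 0 := by simpa [d] using key 3
  have h4 : c₄ = 0 := by simpa [d] using key 4
  have h5 : c₅ = 0 := by simpa [d] using key 5
  refine ⟨?_, h2, h3, h4, h5⟩
  subst h2 h3 h4 h5
  apply W.chartC_two_injective
  simpa using h

theorem poleSum_eq_sum (d : ℕ →₀ R) (n : ℕ) (h : ∀ k, n < k → d k = 0) :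
    W.poleSum d = ∑ k ∈ Finset.range (n + 1), W.chartC 2 (d k) * W.poleBasis k := by
  rw [poleSum, Finsupp.liftAddHom_apply, Finsupp.sum_of_support_subset]
  · rfl
  · intro k hk
    rw [Finset.mem_range]
    by_contra hlt
    exact Finsupp.mem_support_iff.mp hk (h k (by omega))
  · simp

/-- This and the next lemma stand in for Riemann–Roch: they describe the functions with a pole of
order at most 2 or 3 at infinity, and identify the leading coefficient. -/
theorem eq_of_pole_le_two {f : W.chartRing 2} {g : PowerSeries R}
    (h : toLaurent R PowerSeries.X ^ 2 * W.laurent f = toLaurent R g) :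
    ∃ a, f = W.chartC 2 a + W.chartC 2 (PowerSeries.constantCoeff g) * W.chartCoord 2 0 := by
  obtain ⟨d, rfl⟩ := W.poleSum_surjective f
  have hs := W.poleSum_eq_sum d 2 fun k hk => W.eq_zero_of_pole_le d 2 g h k hk (by omega)
  simp only [Finset.sum_range_succ, Finset.sum_range_zero, poleBasis, mul_one, mul_zero, zero_add,
    add_zero] at hs
  refine ⟨d 0, ?_⟩
  suffices PowerSeries.constantCoeff g = d 2 by rw [this, hs]
  rw [hs, map_add, mul_add, map_mul, mul_left_comm, laurent_x, laurent_chartC, laurent_chartC,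
    ← map_pow, ← map_mul, ← map_mul, ← map_add] at h
  rw [← toLaurent_injective h]
  simp

theorem eq_of_pole_le_three {f : W.chartRing 2} {g : PowerSeries R}
    (h : toLaurent R PowerSeries.X ^ 3 * W.laurent f = toLaurent R g) :
    ∃ a b, f = W.chartC 2 a + W.chartC 2 b * W.chartCoord 2 0
      + W.chartC 2 (PowerSeries.constantCoeff g) * W.chartCoord 2 1 := by
  obtain ⟨d, rfl⟩ := W.poleSum_surjective f
  have hs := W.poleSum_eq_sum d 3 fun k hk => W.eq_zero_of_pole_le d 3 g h k hk (by omega)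
  simp only [Finset.sum_range_succ, Finset.sum_range_zero, poleBasis, mul_one, mul_zero, zero_add,
    add_zero] at hs
  refine ⟨d 0, d 2, ?_⟩
  suffices PowerSeries.constantCoeff g = d 3 by rw [this, hs]
  have e : toLaurent R g = toLaurent R (PowerSeries.X ^ 3 * PowerSeries.C (d 0)
      + PowerSeries.X * (PowerSeries.C (d 2) * W.expansion)
      + PowerSeries.C (d 3) * W.expansion) := by
    rw [← h, hs]
    simp only [map_add, map_mul, map_pow, laurent_chartC]
    rw [← W.laurent_y]
    linear_combination toLaurent R PowerSeries.X * toLaurent R (PowerSeries.C (d 2)) *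
      (W.laurent_x.trans W.laurent_y.symm)
  rw [toLaurent_injective e]
  simp

end Independence

/-! ### Isomorphisms of pointed cubics are changes of variables. -/

section Isomorphism

variable {R : Type u} [CommRing R] {W₁ W₂ : WeierstrassCurve R}

/-- An isomorphism respecting the sections at infinity maps the complement of one into the
complement of the other, hence is given there by affine coordinates. -/
theorem exists_chart_eq_point (f : W₁.scheme ≅ W₂.scheme) (hf : f.hom ≫ W₂.toSpec = W₁.toSpec)
    (hinf : W₁.infinity ≫ f.hom = W₂.infinity) :
    ∃ (p : Fin 3 → W₁.chartRing 2) (h : W₂.IsPoint (W₁.chartC 2) p) (hp : p 2 = 1),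
      W₁.chart 2 ≫ f.hom = point h 2 (hp ▸ isUnit_one) := by
  obtain ⟨φ, p, h, hp, e⟩ := W₂.exists_eq_point 2 (W₁.chart 2 ≫ f.hom) (by
    rintro _ ⟨y, rfl⟩
    by_contra hy
    obtain ⟨z, hz⟩ := (mem_range_infinity_iff _).mpr hy
    rw [← hinf, Scheme.Hom.comp_apply, Scheme.Hom.comp_apply] at hz
    have hz' := (Scheme.homeoOfIso f).injective hz
    refine (mem_range_infinity_iff _).mp ⟨z, hz'⟩ ?_
    rw [← SetLike.mem_coe, ← range_chart]
    exact ⟨y, rfl⟩)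
  have hφ : φ = W₁.chartC 2 := by
    have := point_toSpec h (hp ▸ isUnit_one)
    rw [← e, Category.assoc, hf, chart_toSpec] at this
    exact (congrArg CommRingCat.Hom.hom (Spec.map_injective this)).symm
  subst hφ
  exact ⟨p, h, hp, e⟩

/-- The variable `T` lies in every maximal ideal of the power series ring, so each point specializes
to one with `T = 0`. Such points go to infinity, where `Y` does not vanish, and open sets are stable
under generization. -/
theorem range_formalPoint_subset (f : W₁.scheme ⟶ W₂.scheme)
    (hinf : W₁.infinity ≫ f = W₂.infinity) :
    Set.range (W₁.formalPoint ≫ f) ⊆ Proj.basicOpen W₂.homogPart (W₂.coord 1) := by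
  rintro _ ⟨y, rfl⟩
  let U := (W₁.formalPoint ≫ f) ⁻¹ᵁ (Proj.basicOpen W₂.homogPart (W₂.coord 1))
  change y ∈ U
  obtain ⟨M, hM, hyM⟩ := Ideal.exists_le_maximal y.asIdeal y.isPrime.ne_top
  have hX : (PowerSeries.X : PowerSeries R) ∈ M := by
    by_contra hX
    obtain ⟨a, i, hi, e⟩ := hM.exists_inv hX
    refine hM.ne_top (Ideal.eq_top_of_isUnit_mem _ hi ?_)
    rw [PowerSeries.isUnit_iff_constantCoeff]
    have := congrArg PowerSeries.constantCoeff e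
    simp only [map_add, map_mul, PowerSeries.constantCoeff_X, mul_zero, zero_add, map_one] at this
    rw [this]
    exact isUnit_one
  let z : PrimeSpectrum (PowerSeries R) := ⟨M, hM.isPrime⟩
  have hs : y ⤳ z := (PrimeSpectrum.le_iff_specializes y z).mp hyM
  refine hs.mem_open U.isOpen ?_
  have hz : z ∈ Set.range (PrimeSpectrum.comap (PowerSeries.constantCoeff (R := R))) := by
    rw [range_comap_of_surjective _ _ PowerSeries.constantCoeff_surj,
      PrimeSpectrum.mem_zeroLocus]
    intro a ha
    obtain ⟨b, rfl⟩ := PowerSeries.X_dvd_iff.mpr ha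
    exact M.mul_mem_right _ hX
  obtain ⟨w, hw⟩ : ∃ w : Spec (.of R), PrimeSpectrum.comap PowerSeries.constantCoeff w = z := hz
  have hw' : Spec.map (CommRingCat.ofHom (PowerSeries.constantCoeff (R := R))) w = z := hw
  have e : (Spec.map (CommRingCat.ofHom (PowerSeries.constantCoeff (R := R))) ≫
      W₁.formalPoint ≫ f) w = W₂.infinity w := by
    rw [← Category.assoc, specMap_constantCoeff_formalPoint, hinf]
  rw [Scheme.Hom.comp_apply, hw'] at e
  change (W₁.formalPoint ≫ f) z ∈ Proj.basicOpen W₂.homogPart (W₂.coord 1)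
  rw [e, infinity_eq_point]
  exact range_point_subset _ _ ⟨w, rfl⟩

theorem exists_formalPoint_eq_point (f : W₁.scheme ⟶ W₂.scheme) (hf : f ≫ W₂.toSpec = W₁.toSpec)
    (hinf : W₁.infinity ≫ f = W₂.infinity) :
    ∃ (q : Fin 3 → PowerSeries R) (h : W₂.IsPoint PowerSeries.C q) (hq : q 1 = 1),
      W₁.formalPoint ≫ f = point h 1 (hq ▸ isUnit_one) ∧
      PowerSeries.constantCoeff (q 0) = 0 ∧ PowerSeries.constantCoeff (q 2) = 0 := by
  obtain ⟨φ, q, h, hq, e⟩ := W₂.exists_eq_point 1 _ (range_formalPoint_subset f hinf)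
  have hφ : φ = PowerSeries.C := by
    have := point_toSpec h (hq ▸ isUnit_one)
    rw [← e, Category.assoc, hf, formalPoint_toSpec] at this
    exact (congrArg CommRingCat.Hom.hom (Spec.map_injective this)).symm
  subst hφ
  refine ⟨q, h, hq, e, ?_⟩
  have e2 := congrArg
    (Spec.map (CommRingCat.ofHom (PowerSeries.constantCoeff (R := R))) ≫ ·) e
  rw [← Category.assoc, specMap_constantCoeff_formalPoint, hinf, infinity_eq_point,
    specMap_point] at e2
  have h0 := point_injective e2 0
  have h2 := point_injective e2 2
  simp at h0 h2
  exact ⟨h0.symm, h2.symm⟩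

theorem changePoint_inv_changePoint {Q : Type u} [CommRing Q] (φ : R →+* Q) (C : VariableChange R)
    (p : Fin 3 → Q) : changePoint φ C⁻¹ (changePoint φ C p) = p := by
  have hu : φ ((C.u⁻¹ : Rˣ) : R) * φ (C.u : R) = 1 := by rw [← map_mul, Units.inv_mul, map_one]
  funext i
  match i with
  | 0 =>
    simp only [changePoint, VariableChange.inv_def, Matrix.cons_val_zero, Matrix.cons_val, map_mul,
      map_pow, map_neg]
    linear_combination (p 0 * (φ ((C.u⁻¹ : Rˣ) : R) * φ (C.u : R) + 1)) * hu
  | 1 =>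
    simp only [changePoint, VariableChange.inv_def, Matrix.cons_val_zero, Matrix.cons_val_one,
      Matrix.cons_val, map_mul, map_pow, map_neg, map_sub]
    generalize φ ((C.u⁻¹ : Rˣ) : R) = v at *
    generalize φ (C.u : R) = u at *
    linear_combination (p 1 * (u ^ 2 * v ^ 2 + u * v + 1)) * hu
  | 2 => rfl

/-- With `Y = 1` the equation reads `Z * (1 + …) = X ^ 3`, the bracket having constant term 1 near
infinity. -/
theorem IsPoint.exists_formal_unit {q : Fin 3 → PowerSeries R} (h : W₂.IsPoint PowerSeries.C q)
    (hq : q 1 = 1) (h0 : PowerSeries.constantCoeff (q 0) = 0)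
    (h2 : PowerSeries.constantCoeff (q 2) = 0) :
    ∃ w : PowerSeries R, PowerSeries.constantCoeff w = 1 ∧ q 2 * w = q 0 ^ 3 := by
  refine ⟨1 + PowerSeries.C W₂.a₁ * q 0 + PowerSeries.C W₂.a₃ * q 2 - PowerSeries.C W₂.a₂ * q 0 ^ 2
    - PowerSeries.C W₂.a₄ * q 0 * q 2 - PowerSeries.C W₂.a₆ * q 2 ^ 2, by simp [h0, h2], ?_⟩
  simp only [IsPoint, hq] at h
  linear_combination h

/-- Modulo `q 0` the series `q 2` vanishes too, so the formal point becomes constant at infinity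
after composing with `f`. As `f` is a monomorphism it was already constant, that is, `T` vanishes
modulo `q 0`. Since conversely `T` divides `q 0`, the two differ by a unit. -/
theorem exists_formal_uniformizer (f : W₁.scheme ⟶ W₂.scheme) [Mono f]
    (hinf : W₁.infinity ≫ f = W₂.infinity) {q : Fin 3 → PowerSeries R}
    (h : W₂.IsPoint PowerSeries.C q) (hq : q 1 = 1)
    (e : W₁.formalPoint ≫ f = point h 1 (hq ▸ isUnit_one))
    (h0 : PowerSeries.constantCoeff (q 0) = 0) (h2 : PowerSeries.constantCoeff (q 2) = 0) :
    ∃ v : (PowerSeries R)ˣ, q 0 = PowerSeries.X * (v : PowerSeries R) := by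
  obtain ⟨w, hw, hqw⟩ := h.exists_formal_unit hq h0 h2
  have hwu : IsUnit w := by
    rw [PowerSeries.isUnit_iff_constantCoeff, hw]
    exact isUnit_one
  let ρ : PowerSeries R →+* PowerSeries R ⧸ Ideal.span {q 0} := Ideal.Quotient.mk _
  have hρ0 : ρ (q 0) = 0 := Ideal.Quotient.eq_zero_iff_mem.mpr (Ideal.mem_span_singleton_self _)
  have hρ2 : ρ (q 2) = 0 := by
    have := congrArg ρ hqw
    rw [map_mul, map_pow, hρ0, zero_pow three_ne_zero] at this
    exact (hwu.map ρ).mul_left_eq_zero.mp this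
  have e1 : Spec.map (CommRingCat.ofHom ρ) ≫ W₁.formalPoint =
      Spec.map (CommRingCat.ofHom (ρ.comp PowerSeries.C)) ≫ W₁.infinity := by
    rw [← cancel_mono f, Category.assoc, Category.assoc, e, hinf, specMap_point, infinity_eq_point,
      specMap_point]
    refine point_congr _ _ _ _ rfl (funext fun i => ?_)
    fin_cases i
    · simpa using hρ0
    · simp [hq]
    · simpa using hρ2
  rw [formalPoint, specMap_point, infinity_eq_point, specMap_point] at e1
  have e2 := point_injective e1 0
  simp only [Function.comp_apply, Matrix.cons_val_zero, Matrix.cons_val_one, map_one, mul_one,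
    map_zero, zero_mul, map_mul] at e2
  have e3 := (W₁.isUnit_expansion.map ρ).mul_right_eq_zero.mp e2
  obtain ⟨w', hw'⟩ := Ideal.mem_span_singleton.mp (Ideal.Quotient.eq_zero_iff_mem.mp e3)
  obtain ⟨v, hv⟩ := PowerSeries.X_dvd_iff.mpr h0
  have hvw : v * w' = 1 := by
    refine PowerSeries.X_mul_cancel ?_
    rw [mul_one, ← mul_assoc, ← hv, ← hw']
  exact ⟨⟨v, w', hvw, by rw [mul_comm, hvw]⟩, hv⟩

theorem laurent_eq_of_formalPoint (f : W₁.scheme ⟶ W₂.scheme) {p : Fin 3 → W₁.chartRing 2}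
    (hp : W₂.IsPoint (W₁.chartC 2) p) (hp2 : p 2 = 1)
    (ep : W₁.chart 2 ≫ f = point hp 2 (hp2 ▸ isUnit_one)) {q : Fin 3 → PowerSeries R}
    (hq : W₂.IsPoint PowerSeries.C q) (hq1 : q 1 = 1)
    (eq : W₁.formalPoint ≫ f = point hq 1 (hq1 ▸ isUnit_one))
    (hu : IsUnit (toLaurent R (q 2))) (j : Fin 3) :
    W₁.laurent (p j) * toLaurent R (q 2) = toLaurent R (q j) := by
  have e := congrArg (· ≫ f) W₁.specMap_toLaurent_formalPoint
  simp only [Category.assoc] at e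
  rw [ep, eq, specMap_point, specMap_point, point_congr (hq.comp (toLaurent R))
    (hq.comp (toLaurent R)) _ (j := 2) hu rfl rfl] at e
  have := point_injective e j
  simpa [hp2] using this.symm

/-- On expansions `p 0 = q 0 / q 2 = w / (T v)²` and `p 1 = 1 / q 2 = w / (T v)³`, where `q 0 = T v`
and `w` has constant term 1. The pole orders fix the shape of `p`, and the leading coefficients are
the square and the cube of one unit, the inverse of the constant term of `v`. -/
theorem coords_eq_of_iso (f : W₁.scheme ≅ W₂.scheme) (hf : f.hom ≫ W₂.toSpec = W₁.toSpec)
    (hinf : W₁.infinity ≫ f.hom = W₂.infinity) {p : Fin 3 → W₁.chartRing 2}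
    (hp : W₂.IsPoint (W₁.chartC 2) p) (hp2 : p 2 = 1)
    (ep : W₁.chart 2 ≫ f.hom = point hp 2 (hp2 ▸ isUnit_one)) :
    ∃ (u : Rˣ) (a b c : R), p 0 = W₁.chartC 2 a + W₁.chartC 2 (u ^ 2) * W₁.chartCoord 2 0 ∧
      p 1 = W₁.chartC 2 b + W₁.chartC 2 c * W₁.chartCoord 2 0
        + W₁.chartC 2 (u ^ 3) * W₁.chartCoord 2 1 := by
  obtain ⟨q, hq, hq1, eq, h0, h2⟩ := exists_formalPoint_eq_point f.hom hf hinf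
  obtain ⟨v, hv⟩ := exists_formal_uniformizer f.hom hinf hq hq1 eq h0 h2
  obtain ⟨w, hw, hqw⟩ := hq.exists_formal_unit hq1 h0 h2
  have hwu : IsUnit w := by
    rw [PowerSeries.isUnit_iff_constantCoeff, hw]
    exact isUnit_one
  have e2 : toLaurent R (q 2) * toLaurent R w =
      toLaurent R PowerSeries.X ^ 3 * toLaurent R v ^ 3 := by
    rw [← map_mul, hqw, hv, ← mul_pow, ← map_mul, map_pow]
  have hu : IsUnit (toLaurent R (q 2)) := by
    refine isUnit_of_mul_isUnit_left (y := toLaurent R w) ?_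
    rw [e2]
    exact (isUnit_toLaurent_X.pow 3).mul ((v.isUnit.map (toLaurent R)).pow 3)
  have key := laurent_eq_of_formalPoint f.hom hp hp2 ep hq hq1 eq hu
  have hvi : toLaurent R v * toLaurent R ((v⁻¹ : (PowerSeries R)ˣ) : PowerSeries R) = 1 := by
    rw [← map_mul, v.mul_inv, map_one]
  have k0 := key 0
  rw [hv, map_mul] at k0
  have k1 := key 1
  rw [hq1, map_one] at k1
  have l0 : toLaurent R PowerSeries.X ^ 2 * W₁.laurent (p 0) =
      toLaurent R (w * ((v⁻¹ : (PowerSeries R)ˣ) : PowerSeries R) ^ 2) := by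
    apply (isUnit_toLaurent_X (R := R)).mul_left_cancel
    rw [map_mul, map_pow]
    generalize toLaurent R ((v⁻¹ : (PowerSeries R)ˣ) : PowerSeries R) = v' at *
    generalize toLaurent R (v : PowerSeries R) = v at *
    generalize toLaurent R PowerSeries.X = X at *
    linear_combination (-(X ^ 3 * W₁.laurent (p 0) * (v ^ 2 * v' ^ 2 + v * v' + 1))
      + X * v' ^ 2 * toLaurent R w) * hvi
      - v' ^ 3 * W₁.laurent (p 0) * e2 + toLaurent R w * v' ^ 3 * k0
  have l1 : toLaurent R PowerSeries.X ^ 3 * W₁.laurent (p 1) =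
      toLaurent R (w * ((v⁻¹ : (PowerSeries R)ˣ) : PowerSeries R) ^ 3) := by
    rw [map_mul, map_pow]
    generalize toLaurent R ((v⁻¹ : (PowerSeries R)ˣ) : PowerSeries R) = v' at *
    generalize toLaurent R (v : PowerSeries R) = v at *
    generalize toLaurent R PowerSeries.X = X at *
    linear_combination (-(X ^ 3 * W₁.laurent (p 1) * (v ^ 2 * v' ^ 2 + v * v' + 1))) * hvi
      - v' ^ 3 * W₁.laurent (p 1) * e2 + toLaurent R w * v' ^ 3 * k1
  obtain ⟨a, ha⟩ := W₁.eq_of_pole_le_two l0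
  obtain ⟨b, c, hbc⟩ := W₁.eq_of_pole_le_three l1
  refine ⟨Units.map PowerSeries.constantCoeff.toMonoidHom v⁻¹, a, b, c, ?_, ?_⟩
  · simpa [hw] using ha
  · simpa [hw] using hbc

/-- An isomorphism of pointed Weierstrass cubics is given, on the complement of the point at
infinity, by a change of variables. -/
theorem exists_variableChange (f : W₁.scheme ≅ W₂.scheme) (hf : f.hom ≫ W₂.toSpec = W₁.toSpec)
    (hinf : W₁.infinity ≫ f.hom = W₂.infinity) :
    ∃ (D : VariableChange R) (hD : D • W₂.map (RingHom.id R) = W₁),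
      W₁.chart 2 ≫ f.hom = W₁.chart 2 ≫ schemeChange (RingHom.id R) D hD := by
  obtain ⟨p, hp, hp2, ep⟩ := exists_chart_eq_point f hf hinf
  obtain ⟨u, a, b, c, h0, h1⟩ := coords_eq_of_iso f hf hinf hp hp2 ep
  -- The coefficient of `X` in the second coordinate of a change of variables is `u²s`, which
  -- explains the division of `c` by `u²`.
  let D : VariableChange R := ⟨u, a, ((u⁻¹ : Rˣ) : R) ^ 2 * c, b⟩
  have hc : (u : R) ^ 2 * (((u⁻¹ : Rˣ) : R) ^ 2 * c) = c := by
    rw [← mul_assoc, ← mul_pow, u.mul_inv, one_pow, one_mul]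
  have hpD : p = changePoint (W₁.chartC 2) D (W₁.chartCoord 2) := by
    funext i
    match i with
    | 0 =>
      simp only [changePoint, D, h0, chartCoord_self, Matrix.cons_val_zero]
      ring
    | 1 =>
      simp only [changePoint, D, h1, chartCoord_self, Matrix.cons_val_one, Matrix.cons_val_zero, hc]
      ring
    | 2 =>
      rw [hp2, ← chartCoord_self]
      rfl
  have hmap : W₂.map (RingHom.id R) = W₂ := map_id W₂
  have hD : D • W₂.map (RingHom.id R) = W₁ := by
    rw [hmap]
    -- Undoing `D` shows that the coordinates `x`, `y` of `W₁` also satisfy the equation `D • W₂`.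
    -- Subtracting the equation of `W₁` removes `y²` and `x³`, and the independence of `1, x, y, x²,
    -- xy` identifies the coefficients.
    have hback : W₂ = D⁻¹ • (D • W₂).map (RingHom.id R) := by
      rw [map_id, inv_smul_smul]
    have h3 := isPoint_changePoint hback.symm hp
    have hcc : changePoint (W₁.chartC 2) D⁻¹ p = W₁.chartCoord 2 := by
      rw [hpD, changePoint_inv_changePoint]
    rw [hcc] at h3
    have h4 := W₁.affine_relation
    simp only [IsPoint, chartCoord_self, RingHom.comp_id] at h3
    have h5 := W₁.eq_zero_of_affine_eq_zero (c₀ := (D • W₂).a₆ - W₁.a₆) (c₂ := (D • W₂).a₄ - W₁.a₄)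
      (c₃ := -((D • W₂).a₃ - W₁.a₃)) (c₄ := (D • W₂).a₂ - W₁.a₂) (c₅ := -((D • W₂).a₁ - W₁.a₁)) (by
        simp only [map_sub, map_neg]
        linear_combination -h3 + h4)
    simp only [sub_eq_zero, neg_eq_zero] at h5
    exact WeierstrassCurve.ext h5.2.2.2.2 h5.2.2.2.1 h5.2.2.1 h5.2.1 h5.1
  refine ⟨D, hD, ?_⟩
  rw [ep, chart_eq_point, point_schemeChange hD _ _ (i := 2) (by
    rw [← hpD, hp2]; exact isUnit_one)]
  exact point_congr _ _ _ _ rfl hpD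

end Isomorphism

end WeierstrassCurve

/-! ### Equivariance as a relation between changes of variables. -/

namespace WeierstrassCurve

section Equivariance

variable {R S : Type u} [CommRing R] [CommRing S]

/-- Comparing coefficients gives `r`, `t`, `u²s`, `u²` and `u³`; the unit `u` is then recovered from
its square and cube. -/
theorem variableChange_eq_of_chart {W₁ : WeierstrassCurve R} {W₂ : WeierstrassCurve S}
    {φ : R →+* S} {C C' : VariableChange S} {h : C • W₁.map φ = W₂} {h' : C' • W₁.map φ = W₂}
    (H : W₂.chart 2 ≫ schemeChange φ C h = W₂.chart 2 ≫ schemeChange φ C' h') : C = C' := by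
  have hu (D : VariableChange S) : IsUnit (changePoint (W₂.chartC 2) D (W₂.chartCoord 2) 2) := by
    change IsUnit (W₂.chartCoord 2 2)
    rw [chartCoord_self]
    exact isUnit_one
  rw [chart_eq_point, point_schemeChange h _ _ (hu C), point_schemeChange h' _ _ (hu C')] at H
  have h0 := point_injective H 0
  have h1 := point_injective H 1
  simp only [changePoint, Matrix.cons_val_zero, Matrix.cons_val_one, Matrix.cons_val,
    chartCoord_self, mul_one] at h0 h1
  have k0 := W₂.eq_zero_of_affine_eq_zero (c₀ := C.r - C'.r) (c₂ := (C.u : S) ^ 2 - C'.u ^ 2)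
    (c₃ := 0) (c₄ := 0) (c₅ := 0) (by
      simp only [map_sub, map_zero]
      linear_combination h0)
  have k1 := W₂.eq_zero_of_affine_eq_zero (c₀ := C.t - C'.t)
    (c₂ := (C.u : S) ^ 2 * C.s - C'.u ^ 2 * C'.s) (c₃ := (C.u : S) ^ 3 - C'.u ^ 3) (c₄ := 0)
    (c₅ := 0) (by
      simp only [map_sub, map_zero]
      linear_combination h1)
  simp only [sub_eq_zero] at k0 k1
  have hu2 : C.u ^ 2 = C'.u ^ 2 := Units.ext k0.2.1
  have hu3 : C.u ^ 3 = C'.u ^ 3 := Units.ext k1.2.2.1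
  have hueq : C.u = C'.u := by
    rw [pow_succ, pow_succ C'.u, hu2] at hu3
    exact mul_left_cancel hu3
  refine VariableChange.ext hueq k0.1 ?_ k1.1
  have := k1.2.1
  rw [hueq] at this
  exact (C'.u.isUnit.pow 2).mul_left_cancel this

theorem PointedFiberIso.exists_variableChange {W₁ : WeierstrassCurve R} {I : Ideal R}
    {W₂ : WeierstrassCurve S} {J : Ideal S} {θ : R ⧸ I ≃+* S ⧸ J}
    (Φ : PointedFiberIso W₁ I W₂ J θ) :
    ∃ (H : VariableChange (S ⧸ J)) (hH : H • (W₁.map (Ideal.Quotient.mk I)).map θ.toRingHom =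
        W₂.map (Ideal.Quotient.mk J)),
      (W₂.map (Ideal.Quotient.mk J)).chart 2 ≫
          (W₂.reductionIso J).hom ≫ Φ.iso.inv ≫ (W₁.reductionIso I).inv =
        (W₂.map (Ideal.Quotient.mk J)).chart 2 ≫ schemeChange θ.toRingHom H hH := by
  -- Composing with the base change along `θ` turns a semilinear isomorphism into one over the
  -- single ring `S ⧸ J`, to which the linear statement applies.
  let T := schemeIso (W₁ := W₁.map (Ideal.Quotient.mk I)) θ (C := 1) (one_smul _ _)
  let f := W₂.reductionIso J ≪≫ Φ.iso.symm ≪≫ (W₁.reductionIso I).symm ≪≫ T.symm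
  have hT : T.hom = schemeChange θ.toRingHom 1 (one_smul _ _) := rfl
  have hTS : T.inv ≫ ((W₁.map (Ideal.Quotient.mk I)).map θ.toRingHom).toSpec ≫
      Spec.map (CommRingCat.ofHom θ.toRingHom) = (W₁.map (Ideal.Quotient.mk I)).toSpec := by
    rw [Iso.inv_comp_eq, hT, schemeChange_toSpec]
  have hmono : IsIso (Spec.map (CommRingCat.ofHom θ.toRingHom)) :=
    inferInstanceAs (IsIso (Spec.map θ.toCommRingCatIso.hom))
  have hf : f.hom ≫ ((W₁.map (Ideal.Quotient.mk I)).map θ.toRingHom).toSpec =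
      (W₂.map (Ideal.Quotient.mk J)).toSpec := by
    rw [← cancel_mono (Spec.map (CommRingCat.ofHom θ.toRingHom))]
    simp only [f, Iso.trans_hom, Iso.symm_hom, Category.assoc]
    rw [hTS, ← reductionIso_hom_fiberToSpec, ← reductionIso_hom_fiberToSpec,
      Iso.inv_hom_id_assoc, ← Φ.comp_toSpec, Iso.inv_hom_id_assoc, Category.assoc]
  have hinf : (W₂.map (Ideal.Quotient.mk J)).infinity ≫ f.hom =
      ((W₁.map (Ideal.Quotient.mk I)).map θ.toRingHom).infinity := by
    simp only [f, Iso.trans_hom, Iso.symm_hom]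
    rw [← Category.assoc, infinity_reductionIso_hom, ← Φ.pointed]
    simp only [Category.assoc, Iso.hom_inv_id_assoc]
    rw [← infinity_reductionIso_hom, Category.assoc, Iso.hom_inv_id_assoc, ← Category.assoc,
      Iso.comp_inv_eq, hT, infinity_schemeChange]
  obtain ⟨H, hH, e⟩ := WeierstrassCurve.exists_variableChange f hf hinf
  have hH' : H • (W₁.map (Ideal.Quotient.mk I)).map θ.toRingHom = W₂.map (Ideal.Quotient.mk J) := by
    rw [← hH, map_id]
  refine ⟨H, hH', ?_⟩
  have e2 := congrArg (· ≫ T.hom) e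
  simp only [f, Iso.trans_hom, Iso.symm_hom, Category.assoc, Iso.inv_hom_id,
    Category.comp_id] at e2
  rw [e2, hT, schemeChange_comp _ hH hH' (RingHom.id_comp _).symm]
  have := map_one (VariableChange.mapHom (RingHom.id (S ⧸ J)))
  change VariableChange.map 1 _ = 1 at this
  rw [this, mul_one]

/-- An equivariant isomorphism of fibers yields a compatible change of variables. -/
theorem galoisChange_relation {W₁ : WeierstrassCurve R} {I : Ideal R}
    {W₂ : WeierstrassCurve S} {J : Ideal S} {θ : R ⧸ I ≃+* S ⧸ J}
    (Φ : PointedFiberIso W₁ I W₂ J θ) {H : VariableChange (S ⧸ J)}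
    (hH : H • (W₁.map (Ideal.Quotient.mk I)).map θ.toRingHom = W₂.map (Ideal.Quotient.mk J))
    (hΦH : (W₂.map (Ideal.Quotient.mk J)).chart 2 ≫
          (W₂.reductionIso J).hom ≫ Φ.iso.inv ≫ (W₁.reductionIso I).inv =
        (W₂.map (Ideal.Quotient.mk J)).chart 2 ≫ schemeChange θ.toRingHom H hH)
    {σ : R →+* R} {D : VariableChange R} (hD : D • W₁.map σ = W₁) (hI : I ≤ I.comap σ)
    {τ : S →+* S} {D' : VariableChange S} (hD' : D' • W₂.map τ = W₂) (hJ : J ≤ J.comap τ)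
    (hθ : θ.toRingHom.comp (Ideal.quotientMap I σ hI) =
      (Ideal.quotientMap J τ hJ).comp θ.toRingHom)
    (hΦ : fiberChange σ D hD hI ≫ Φ.iso.hom = Φ.iso.hom ≫ fiberChange τ D' hD' hJ) :
    D'.map (Ideal.Quotient.mk J) * H.map (Ideal.quotientMap J τ hJ) =
      H * (D.map (Ideal.Quotient.mk I)).map θ.toRingHom := by
  have e1 := reductionIso_hom_fiberChange hD hI
  have e2 := reductionIso_hom_fiberChange hD' hJ
  obtain ⟨a, ha⟩ := chart_two_schemeChange (map_mk_smul hD' hJ)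
  have key : ((W₂.reductionIso J).hom ≫ Φ.iso.inv ≫ (W₁.reductionIso I).inv) ≫
      schemeChange _ _ (map_mk_smul hD hI) = schemeChange _ _ (map_mk_smul hD' hJ) ≫
        (W₂.reductionIso J).hom ≫ Φ.iso.inv ≫ (W₁.reductionIso I).inv := by
    rw [← Category.assoc (schemeChange _ _ (map_mk_smul hD' hJ)), ← e2]
    simp only [Category.assoc, Iso.cancel_iso_hom_left]
    rw [Iso.inv_comp_eq, ← Category.assoc (Φ.iso.hom), ← hΦ]
    simp only [Category.assoc, Iso.hom_inv_id_assoc]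
    rw [Iso.inv_comp_eq, ← Category.assoc, e1, Category.assoc, Iso.hom_inv_id, Category.comp_id]
  have h1 : (D'.map (Ideal.Quotient.mk J) * H.map (Ideal.quotientMap J τ hJ)) •
      (W₁.map (Ideal.Quotient.mk I)).map ((Ideal.quotientMap J τ hJ).comp θ.toRingHom) =
        W₂.map (Ideal.Quotient.mk J) := by
    rw [mul_smul, ← map_map, map_variableChange, hH, map_mk_smul hD' hJ]
  have h2 : (H * (D.map (Ideal.Quotient.mk I)).map θ.toRingHom) •
      (W₁.map (Ideal.Quotient.mk I)).map ((Ideal.quotientMap J τ hJ).comp θ.toRingHom) =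
        W₂.map (Ideal.Quotient.mk J) := by
    rw [mul_smul, ← hθ, ← map_map, map_variableChange, map_mk_smul hD hI, hH]
  have c1 := schemeChange_comp hH (map_mk_smul hD' hJ) h1 rfl rfl
  have c2 := schemeChange_comp (map_mk_smul hD hI) hH h2 hθ.symm rfl
  refine variableChange_eq_of_chart (h := h1) (h' := h2) ?_
  -- The two sides induce the same morphism on the affine chart. The factorization `a` is needed
  -- because `H` describes the isomorphism only there.
  rw [← c1, ← c2, ← Category.assoc, ha, Category.assoc, ← hΦH, ← Category.assoc, ← ha,
    Category.assoc, ← key, ← Category.assoc, hΦH, Category.assoc]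

end Equivariance

end WeierstrassCurve

/-! ### Substitutions whose scaling factor need not be invertible. -/

namespace WeierstrassCurve

/-- The substitution `X ↦ u²X + r`, `Y ↦ u³Y + u²sX + t`, where `u` need not be invertible. -/
@[ext]
structure Substitution (R : Type*) where
  /-- The scaling factor. -/
  u : R
  /-- The translation of `X`. -/
  r : R
  /-- The shear. -/
  s : R
  /-- The translation of `Y`. -/
  t : R

namespace Substitution

variable {R S T : Type*} [CommRing R] [CommRing S] [CommRing T]

instance : Mul (Substitution R) where
  mul C C' := ⟨C.u * C'.u, C.r * C'.u ^ 2 + C'.r, C'.u * C.s + C'.s,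
    C.t * C'.u ^ 3 + C.r * C'.s * C'.u ^ 2 + C'.t⟩

theorem mul_def (C C' : Substitution R) : C * C' = ⟨C.u * C'.u, C.r * C'.u ^ 2 + C'.r,
    C'.u * C.s + C'.s, C.t * C'.u ^ 3 + C.r * C'.s * C'.u ^ 2 + C'.t⟩ :=
  rfl

protected theorem mul_assoc (C C' C'' : Substitution R) : C * C' * C'' = C * (C' * C'') := by
  simp only [mul_def]
  ext <;> ring

/-- The image of a substitution under a ring homomorphism. -/
def map (φ : R →+* S) (C : Substitution R) : Substitution S :=
  ⟨φ C.u, φ C.r, φ C.s, φ C.t⟩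

theorem map_mul (φ : R →+* S) (C C' : Substitution R) :
    (C * C').map φ = C.map φ * C'.map φ := by
  simp [map, mul_def]

theorem map_map (φ : R →+* S) (ψ : S →+* T) (C : Substitution R) :
    (C.map φ).map ψ = C.map (ψ.comp φ) :=
  rfl

theorem map_injective {φ : R →+* S} (hφ : Function.Injective φ) :
    Function.Injective (map φ) := by
  intro C C' h
  simp only [map, Substitution.mk.injEq] at h
  exact Substitution.ext (hφ h.1) (hφ h.2.1) (hφ h.2.2.1) (hφ h.2.2.2)

theorem exists_map_eq {φ : R →+* S} (hφ : Function.Surjective φ) (C : Substitution S) :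
    ∃ C' : Substitution R, C'.map φ = C := by
  obtain ⟨u, hu⟩ := hφ C.u
  obtain ⟨r, hr⟩ := hφ C.r
  obtain ⟨s, hs⟩ := hφ C.s
  obtain ⟨t, ht⟩ := hφ C.t
  exact ⟨⟨u, r, s, t⟩, Substitution.ext hu hr hs ht⟩

/-- The substitution given by a change of variables. -/
def ofChange (C : VariableChange R) : Substitution R :=
  ⟨C.u, C.r, C.s, C.t⟩

theorem ofChange_mul (C C' : VariableChange R) :
    ofChange (C * C') = ofChange C * ofChange C' := by
  simp [ofChange, mul_def, VariableChange.mul_def]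

theorem ofChange_map (φ : R →+* S) (C : VariableChange R) :
    ofChange (C.map φ) = (ofChange C).map φ := by
  simp [ofChange, map, VariableChange.map]

/-- The Weierstrass equation over `R` satisfied by `(u²X + r, u³Y + u²sX + t)` if `(X, Y)` satisfies
the equation `W`. -/
def apply (C : Substitution R) (W : WeierstrassCurve R) : WeierstrassCurve R where
  a₁ := C.u * W.a₁ - 2 * C.s
  a₂ := C.u ^ 2 * W.a₂ + C.s * (C.u * W.a₁ - 2 * C.s) - 3 * C.r + C.s ^ 2
  a₃ := C.u ^ 3 * W.a₃ - C.r * (C.u * W.a₁ - 2 * C.s) - 2 * C.t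
  a₄ := C.u ^ 4 * W.a₄ + C.s * (C.u ^ 3 * W.a₃ - C.r * (C.u * W.a₁ - 2 * C.s) - 2 * C.t)
    - 2 * C.r * (C.u ^ 2 * W.a₂ + C.s * (C.u * W.a₁ - 2 * C.s) - 3 * C.r + C.s ^ 2)
    + (C.t + C.r * C.s) * (C.u * W.a₁ - 2 * C.s) - 3 * C.r ^ 2 + 2 * C.s * C.t
  a₆ := C.u ^ 6 * W.a₆ - C.r * (C.u ^ 4 * W.a₄
      + C.s * (C.u ^ 3 * W.a₃ - C.r * (C.u * W.a₁ - 2 * C.s) - 2 * C.t)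
      - 2 * C.r * (C.u ^ 2 * W.a₂ + C.s * (C.u * W.a₁ - 2 * C.s) - 3 * C.r + C.s ^ 2)
      + (C.t + C.r * C.s) * (C.u * W.a₁ - 2 * C.s) - 3 * C.r ^ 2 + 2 * C.s * C.t)
    - C.r ^ 2 * (C.u ^ 2 * W.a₂ + C.s * (C.u * W.a₁ - 2 * C.s) - 3 * C.r + C.s ^ 2) - C.r ^ 3
    + C.t * (C.u ^ 3 * W.a₃ - C.r * (C.u * W.a₁ - 2 * C.s) - 2 * C.t) + C.t ^ 2
    + C.r * C.t * (C.u * W.a₁ - 2 * C.s)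

theorem apply_mul (C C' : Substitution R) (W : WeierstrassCurve R) :
    (C * C').apply W = C'.apply (C.apply W) := by
  ext <;> simp only [apply, mul_def] <;> ring

theorem map_apply (φ : R →+* S) (C : Substitution R) (W : WeierstrassCurve R) :
    (C.apply W).map φ = (C.map φ).apply (W.map φ) := by
  ext <;> simp only [apply, map, WeierstrassCurve.map, map_add, map_sub, _root_.map_mul, map_pow,
    map_ofNat]

/-- A change of variables divides by powers of `u`, and `apply` multiplies by them; this direction
remains meaningful when `u` is not a unit. -/
theorem ofChange_apply_smul (C : VariableChange R) (W : WeierstrassCurve R) :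
    (ofChange C).apply (C • W) = W := by
  have hu : (C.u : R) * ((C.u⁻¹ : Rˣ) : R) = 1 := C.u.mul_inv
  have e₁ : (C.u : R) * (C • W).a₁ = W.a₁ + 2 * C.s := by
    rw [variableChange_a₁]
    linear_combination (W.a₁ + 2 * C.s) * hu
  have e₂ : (C.u : R) ^ 2 * (C • W).a₂ = W.a₂ - C.s * W.a₁ + 3 * C.r - C.s ^ 2 := by
    rw [variableChange_a₂]
    linear_combination (W.a₂ - C.s * W.a₁ + 3 * C.r - C.s ^ 2) * pow_mul_pow_eq_one 2 hu
  have e₃ : (C.u : R) ^ 3 * (C • W).a₃ = W.a₃ + C.r * W.a₁ + 2 * C.t := by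
    rw [variableChange_a₃]
    linear_combination (W.a₃ + C.r * W.a₁ + 2 * C.t) * pow_mul_pow_eq_one 3 hu
  have e₄ : (C.u : R) ^ 4 * (C • W).a₄ = W.a₄ - C.s * W.a₃ + 2 * C.r * W.a₂
      - (C.t + C.r * C.s) * W.a₁ + 3 * C.r ^ 2 - 2 * C.s * C.t := by
    rw [variableChange_a₄]
    linear_combination (W.a₄ - C.s * W.a₃ + 2 * C.r * W.a₂
      - (C.t + C.r * C.s) * W.a₁ + 3 * C.r ^ 2 - 2 * C.s * C.t) * pow_mul_pow_eq_one 4 hu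
  have e₆ : (C.u : R) ^ 6 * (C • W).a₆ = W.a₆ + C.r * W.a₄ + C.r ^ 2 * W.a₂ + C.r ^ 3
      - C.t * W.a₃ - C.t ^ 2 - C.r * C.t * W.a₁ := by
    rw [variableChange_a₆]
    linear_combination (W.a₆ + C.r * W.a₄ + C.r ^ 2 * W.a₂ + C.r ^ 3
      - C.t * W.a₃ - C.t ^ 2 - C.r * C.t * W.a₁) * pow_mul_pow_eq_one 6 hu
  simp only [apply, ofChange, e₁, e₂, e₃, e₄, e₆]
  ext <;> ring

theorem ofChange_apply_eq_iff (C : VariableChange R) {W W' : WeierstrassCurve R} :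
    (ofChange C).apply W' = W ↔ C • W = W' := by
  constructor
  · rintro rfl
    have h1 := ofChange_apply_smul C ((ofChange C).apply W')
    have h2 := congrArg (ofChange C⁻¹).apply h1
    rw [← apply_mul, ← apply_mul, ← ofChange_mul, mul_inv_cancel] at h2
    simpa [apply, ofChange, VariableChange.one_def, WeierstrassCurve.ext_iff] using h2
  · rintro rfl
    exact ofChange_apply_smul C W

theorem apply_Δ (C : Substitution R) (W : WeierstrassCurve R) :
    (C.apply W).Δ = C.u ^ 12 * W.Δ := by
  simp only [Δ, b₂, b₄, b₆, b₈, apply]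
  ring

end Substitution

end WeierstrassCurve

/-! ### Traces and the different. -/

section Trace

variable {A K L B G : Type u} [CommRing A] [IsDomain A] [IsDiscreteValuationRing A] [Field K]
  [Algebra A K] [IsFractionRing A K] [Field L] [Algebra K L] [Algebra A L] [IsScalarTower A K L]
  [Group G] [Fintype G] [MulSemiringAction G L] [IsGaloisGroup G K L]
  [CommRing B] [IsDedekindDomain B] [Algebra A B] [Module.IsTorsionFree A B] [Algebra B L]
  [IsScalarTower A B L] [IsFractionRing B L] [IsIntegralClosure B A L]

theorem algebraMap_trace_eq_sum_smul (x : L) :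
    algebraMap K L (Algebra.trace K L x) = ∑ g : G, g • x := by
  have := IsGaloisGroup.isGalois G K L
  have := IsGaloisGroup.finiteDimensional G K L
  rw [trace_eq_sum_automorphisms]
  exact (Fintype.sum_equiv (IsGaloisGroup.mulEquivAlgEquiv G K L).toEquiv _ _ fun g => rfl).symm

/-- If all traces lie in `ϖ ^ j A`, then `ϖ ^ (-j)` belongs to the trace dual of `B`, so the
different is contained in `ϖ ^ j B`. At `P` this gives `e * j ≤ v_P` of the different. -/
theorem mul_le_multiplicity_differentIdeal [FiniteDimensional K L] [Algebra.IsSeparable K L]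
    {ϖ : A} (hϖ : Irreducible ϖ) (P : Ideal B) [P.IsMaximal] {j : ℕ}
    (hj : ∀ x : B, ∃ a : A, Algebra.trace K L (algebraMap B L x) = algebraMap A K (ϖ ^ j * a)) :
    j ≤ ⌊valDifferent A P⌋₊ := by
  have := IsIntegralClosure.finite A K L B
  have hinj : Function.Injective (algebraMap A B) := FaithfulSMul.algebraMap_injective A B
  have hle : differentIdeal A B ≤ Ideal.span {algebraMap A B (ϖ ^ j)} := by
    intro d hd
    have hd' : algebraMap B L d ∈ (1 / Submodule.traceDual A K 1 : Submodule B L) := by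
      rw [← coeSubmodule_differentIdeal A K]
      exact ⟨d, hd, rfl⟩
    rw [Submodule.mem_div_iff_forall_mul_mem] at hd'
    have h0 : algebraMap A L (ϖ ^ j) ≠ 0 := by
      rw [IsScalarTower.algebraMap_apply A B L]
      simp [hϖ.ne_zero]
    have hdual : (algebraMap A L (ϖ ^ j))⁻¹ ∈ (Submodule.traceDual A K 1 : Submodule B L) := by
      rw [Submodule.mem_traceDual]
      rintro _ ⟨x, rfl⟩
      obtain ⟨a, ha⟩ := hj x
      refine ⟨a, ?_⟩
      have h1 : (algebraMap A L (ϖ ^ j))⁻¹ * algebraMap B L x =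
          (algebraMap A K (ϖ ^ j))⁻¹ • algebraMap B L x := by
        rw [Algebra.smul_def, map_inv₀, ← IsScalarTower.algebraMap_apply A K L]
      have h2 : algebraMap A K (ϖ ^ j) ≠ 0 := by
        simp [hϖ.ne_zero]
      rw [LinearMap.toSpanSingleton_apply, Algebra.smul_def, mul_one, Algebra.traceForm_apply,
        h1, map_smul, ha, smul_eq_mul, map_mul, inv_mul_cancel_left₀ h2]
    obtain ⟨y, hy⟩ := hd' _ hdual
    rw [Ideal.mem_span_singleton]
    refine ⟨y, IsFractionRing.injective B L ?_⟩
    rw [LinearMap.toSpanSingleton_apply, Algebra.smul_def, mul_one] at hy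
    rw [map_mul, hy, ← IsScalarTower.algebraMap_apply A B L]
    field_simp
  have hD : differentIdeal A B ≠ ⊥ := by
    rw [ne_eq, ← FractionalIdeal.coeIdeal_inj (K := L), coeIdeal_differentIdeal A K]
    simp
  have hmax : IsLocalRing.maximalIdeal A = Ideal.span {ϖ} := hϖ.maximalIdeal_eq
  have hover : P.LiesOver (IsLocalRing.maximalIdeal A) :=
    ⟨(IsLocalRing.eq_maximalIdeal (Ideal.isMaximal_comap_of_isIntegral_of_isMaximal P)).symm⟩
  have hne : (IsLocalRing.maximalIdeal A).map (algebraMap A B) ≠ ⊥ := by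
    rw [hmax, Ideal.map_span, Set.image_singleton, ne_eq, Ideal.span_singleton_eq_bot]
    simpa using (map_ne_zero_iff _ hinj).mpr hϖ.ne_zero
  have hP : P ≠ ⊥ := ne_bot_of_le_ne_bot hne (Ideal.map_le_of_le_comap hover.over.le)
  have hdvd : P ^ (P.ramificationIdx A * j) ∣ differentIdeal A B := by
    rw [Ideal.dvd_iff_le, ← Ideal.ramificationIdx'_eq_ramificationIdx' _ P hne, pow_mul]
    refine hle.trans ?_
    have := Ideal.pow_right_mono (Ideal.le_pow_ramificationIdx'
      (p := IsLocalRing.maximalIdeal A) (P := P)) j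
    rwa [← Ideal.map_pow, hmax, Ideal.span_singleton_pow, Ideal.map_span,
      Set.image_singleton, ← hmax] at this
  have hfin : FiniteMultiplicity P (differentIdeal A B) :=
    FiniteMultiplicity.of_prime_left (Ideal.prime_of_isPrime hP inferInstance) hD
  have hmul := hfin.le_multiplicity_of_pow_dvd hdvd
  have he : 0 < P.ramificationIdx A := Ideal.ramificationIdx_pos P A
  refine Nat.le_floor ?_
  rw [valDifferent, le_div_iff₀ (by exact_mod_cast he)]
  exact_mod_cast (mul_comm _ _).trans_le hmul

end Trace

/-- The trace ideal is `ϖ ^ j` with `j` at most the valuation of the different. -/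
theorem exists_sum_smul_eq_pow {A B : Type u} (K L G : Type u) [CommRing A] [IsDomain A]
    [IsDiscreteValuationRing A] [Field K] [Algebra A K] [IsFractionRing A K] [Field L] [Algebra K L]
    [Algebra A L] [IsScalarTower A K L] [Group G] [Fintype G] [MulSemiringAction G L]
    [IsGaloisGroup G K L] [CommRing B] [IsDedekindDomain B] [Algebra A B] [Module.IsTorsionFree A B]
    [Algebra B L] [IsScalarTower A B L] [IsFractionRing B L] [IsIntegralClosure B A L]
    [MulSemiringAction G B] [SMulDistribClass G B L] {ϖ : A} (hϖ : Irreducible ϖ) (P : Ideal B)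
    [P.IsMaximal] :
    ∃ (b : B) (j : ℕ), ∑ g : G, g • b = algebraMap A B (ϖ ^ j) ∧ j ≤ ⌊valDifferent A P⌋₊ := by
  have := IsGaloisGroup.isGalois G K L
  have := IsGaloisGroup.finiteDimensional G K L
  have tr (x : B) : ∃ a : A, algebraMap A K a = Algebra.trace K L (algebraMap B L x) :=
    IsIntegrallyClosed.isIntegral_iff.mp
      (Algebra.isIntegral_trace (IsIntegralClosure.isIntegral_iff.mpr ⟨x, rfl⟩))
  choose τ hτ using tr
  have hAK := IsFractionRing.injective A K
  -- By separability the trace is nonzero on `L`, and every element of `L` has a nonzero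
  -- `A`-multiple in `B`.
  have hne : ∃ x, τ x ≠ 0 := by
    by_contra! h0
    refine Algebra.trace_ne_zero K L (LinearMap.ext fun z => ?_)
    obtain ⟨a, ha, hz⟩ := IsAlgebraic.exists_integral_multiple
      ((IsFractionRing.isAlgebraic_iff A K L).mpr (Algebra.IsAlgebraic.isAlgebraic z))
    obtain ⟨x, hx⟩ := (IsIntegralClosure.isIntegral_iff (A := B)).mp hz
    have h1 := hτ x
    rw [h0, hx, map_zero, ← algebraMap_smul K, map_smul] at h1
    simpa [ha] using h1.symm
  have hval : ∃ n x, Associated (τ x) (ϖ ^ n) := by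
    obtain ⟨x, hx⟩ := hne
    obtain ⟨n, hn⟩ := IsDiscreteValuationRing.associated_pow_irreducible hx hϖ
    exact ⟨n, x, hn⟩
  classical
  -- Here `x` has a trace of minimal valuation. Multiplying `x` by the unit `v` makes the trace
  -- exactly a power of `ϖ`, and minimality shows that this power divides all traces.
  obtain ⟨x, v, hv⟩ := Nat.find_spec hval
  refine ⟨algebraMap A B v * x, Nat.find hval, ?_,
    mul_le_multiplicity_differentIdeal (K := K) (L := L) hϖ P fun y => ?_⟩
  · apply IsFractionRing.injective B L
    rw [map_sum]
    simp only [algebraMap.smul']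
    rw [← algebraMap_trace_eq_sum_smul (K := K), map_mul, ← IsScalarTower.algebraMap_apply A B L,
      IsScalarTower.algebraMap_apply A K L, ← Algebra.smul_def, map_smul, ← hτ, smul_eq_mul,
      ← map_mul, mul_comm, hv, ← IsScalarTower.algebraMap_apply A K L,
      ← IsScalarTower.algebraMap_apply A B L]
  · rw [← hτ]
    by_cases hy : τ y = 0
    · exact ⟨0, by rw [hy, mul_zero]⟩
    · obtain ⟨n, hn⟩ := IsDiscreteValuationRing.associated_pow_irreducible hy hϖ
      obtain ⟨a, ha⟩ := (pow_dvd_pow ϖ (Nat.find_le ⟨y, hn⟩ : Nat.find hval ≤ n)).trans hn.symm.dvd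
      exact ⟨a, by rw [ha]⟩

/-! ### Divisibility in an integral extension of a discrete valuation ring. -/

section Integral

variable {A B : Type*} [CommRing A] [IsDomain A] [IsDiscreteValuationRing A] [CommRing B]
  [Algebra A B]

/-- In `A` either `c` divides `a` or `a` divides `c`. In the second case, for nonzero `a`, the
quotient becomes a unit of `B`, hence is a unit of `A` by integrality. -/
theorem dvd_of_algebraMap_dvd [IsDomain B] [FaithfulSMul A B] [Algebra.IsIntegral A B] {c a : A}
    (h : algebraMap A B c ∣ algebraMap A B a) : c ∣ a := by
  rcases ValuationRing.dvd_total c a with h' | ⟨d, rfl⟩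
  · exact h'
  · by_cases ha : a = 0
    · rw [ha]
      exact dvd_zero _
    · obtain ⟨y, hy⟩ := h
      have ha' : algebraMap A B a ≠ 0 := by simpa using ha
      have h1 : algebraMap A B d * y = 1 := by
        refine mul_left_cancel₀ ha' ?_
        rw [← mul_assoc, ← map_mul, ← hy, mul_one]
      have hd : IsUnit d := (isUnit_map_iff (algebraMap A B) d).mp (.of_mul_eq_one _ h1)
      exact hd.mul_right_dvd.mpr dvd_rfl

/-- All maximal ideals of `B` lie above that of `A`, so `ϖ` is in the Jacobson radical of `B`. -/
theorem isUnit_one_add_mul [Algebra.IsIntegral A B] {ϖ : A}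
    (hϖ : ϖ ∈ IsLocalRing.maximalIdeal A) (y : B) : IsUnit (1 + algebraMap A B ϖ * y) := by
  by_contra h
  obtain ⟨M, hM, hmem⟩ := exists_max_ideal_of_mem_nonunits h
  have hc := IsLocalRing.eq_maximalIdeal
    (Ideal.isMaximal_comap_of_isIntegral_of_isMaximal (R := A) M)
  rw [← hc, Ideal.mem_comap] at hϖ
  exact hM.ne_top ((Ideal.eq_top_iff_one _).mpr
    ((Ideal.add_mem_iff_left _ (M.mul_mem_right _ hϖ)).mp hmem))

theorem isUnit_of_isUnit_mk [Algebra.IsIntegral A B] {ϖ : A}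
    (hϖ : ϖ ∈ IsLocalRing.maximalIdeal A) {n : ℕ} (hn : n ≠ 0)
    {x : B} (hx : IsUnit (Ideal.Quotient.mk (Ideal.span {algebraMap A B ϖ ^ n}) x)) : IsUnit x := by
  obtain ⟨y, hy⟩ := hx.exists_right_inv
  obtain ⟨y, rfl⟩ := Ideal.Quotient.mk_surjective y
  rw [← map_mul, ← map_one (Ideal.Quotient.mk _), Ideal.Quotient.eq,
    Ideal.mem_span_singleton] at hy
  obtain ⟨n, rfl⟩ := Nat.exists_eq_succ_of_ne_zero hn
  obtain ⟨z, hz⟩ := hy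
  refine isUnit_of_mul_isUnit_left (y := y) ?_
  have := isUnit_one_add_mul hϖ (algebraMap A B ϖ ^ n * z)
  rwa [← mul_assoc, ← pow_succ', ← hz, add_sub_cancel] at this

variable {G : Type*} [Group G] [Fintype G] [IsDomain B] [MulSemiringAction G B]
  [IsGaloisGroup G A B]

/-- Such a `u` has the same valuation at all primes of `B`. Its power of exponent the order of `G`
is associated to its norm, hence to a power of `ϖ`; these powers are comparable, and integral
closedness allows the extraction of roots. -/
theorem dvd_pow_or_pow_dvd [IsIntegrallyClosed B] {ϖ : A} (hϖ : Irreducible ϖ) {u : B} (hu : u ≠ 0)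
    (h : ∀ g : G, Associated u (g • u)) (c : ℕ) :
    u ∣ algebraMap A B ϖ ^ c ∨ algebraMap A B ϖ ^ c ∣ u := by
  obtain ⟨a, ha⟩ := Algebra.IsInvariant.isInvariant (A := A) (G := G) (∏ g : G, g • u) (by
    intro g
    rw [Finset.smul_prod']
    simp only [smul_smul]
    exact Fintype.prod_equiv (Equiv.mulLeft g) _ _ fun _ => rfl)
  have h1 : Associated (u ^ Fintype.card G) (∏ g : G, g • u) := by
    have := Associated.prod Finset.univ (fun _ => u) (fun g : G => g • u) fun g _ => h g
    rwa [Finset.prod_const, Finset.card_univ] at this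
  have ha0 : a ≠ 0 := by
    rintro rfl
    rw [map_zero] at ha
    obtain ⟨g, -, hg⟩ := Finset.prod_eq_zero_iff.mp ha.symm
    exact hu ((smul_eq_zero_iff_eq g).mp hg)
  obtain ⟨v, hv⟩ := IsDiscreteValuationRing.associated_pow_irreducible ha0 hϖ
  have h2 : Associated (u ^ Fintype.card G) (algebraMap A B ϖ ^ v) := by
    rw [← map_pow]
    exact h1.trans (ha ▸ hv.map (algebraMap A B))
  have hG : Fintype.card G ≠ 0 := Fintype.card_ne_zero
  rcases le_total v (c * Fintype.card G) with hle | hle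
  · left
    rw [← IsIntegrallyClosed.pow_dvd_pow_iff hG, ← pow_mul]
    exact h2.dvd.trans (pow_dvd_pow _ hle)
  · right
    rw [← IsIntegrallyClosed.pow_dvd_pow_iff hG, ← pow_mul]
    exact (pow_dvd_pow _ hle).trans h2.symm.dvd

end Integral

/-! ### Averaging over the Galois group. -/

section Average

variable {A K L B G : Type*} [CommRing A] [IsDomain A] [IsDiscreteValuationRing A] [Field K]
  [Algebra A K] [IsFractionRing A K] [Field L] [Algebra K L] [Algebra A L] [IsScalarTower A K L]
  [CommRing B] [Algebra B L]

theorem exists_algebraMap_eq_of_integral [IsIntegralClosure B A L] {x : K} {y : B}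
    (h : algebraMap K L x = algebraMap B L y) : ∃ a : A, algebraMap A K a = x := by
  refine IsIntegrallyClosed.isIntegral_iff.mp ?_
  rw [← isIntegral_algebraMap_iff (algebraMap K L).injective, h]
  exact IsIntegralClosure.isIntegral_iff.mpr ⟨y, rfl⟩

variable [Algebra A B] [IsScalarTower A B L] [Group G] [Fintype G] [MulSemiringAction G L]
  [IsGaloisGroup G K L] [MulSemiringAction G B] [SMulDistribClass G B L]

/-- An almost invariant element of `L` is close to an element of `K`. -/
theorem exists_close_of_sub_smul {ϖ : A} (hϖ : ϖ ≠ 0) {b : B} {j : ℕ}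
    (hb : ∑ g : G, g • b = algebraMap A B ϖ ^ j) {n : ℕ} (hn : j ≤ n) {x : L}
    (hx : ∀ g : G, ∃ y : B, x - g • x = algebraMap B L (algebraMap A B ϖ ^ n * y)) :
    ∃ (a : K) (y : B), algebraMap K L a = x + algebraMap B L (algebraMap A B ϖ ^ (n - j) * y) := by
  choose y hy using hx
  -- The weighted average is the trace of `b * x` divided by `ϖ ^ j`, the trace of `b`. It differs
  -- from `x` by the sum of the terms `g b * (g x - x)` divided by `ϖ ^ j`, so only `j` powers of
  -- `ϖ` are lost.
  obtain ⟨a, ha⟩ := Algebra.IsInvariant.isInvariant (A := K) (G := G)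
    (∑ g : G, g • (algebraMap B L b * x)) (by
      intro g
      rw [Finset.smul_sum]
      simp only [smul_smul]
      exact Fintype.sum_equiv (Equiv.mulLeft g) _ _ fun _ => rfl)
  have hK : algebraMap A K ϖ ≠ 0 := by simpa using hϖ
  have hL : algebraMap A L ϖ ≠ 0 := by
    rw [IsScalarTower.algebraMap_apply A K L]
    simpa using hϖ
  refine ⟨(algebraMap A K ϖ ^ j)⁻¹ * a, - ∑ g : G, g • b * y g, ?_⟩
  refine mul_left_cancel₀ (pow_ne_zero j hL) ?_
  have hb' : ∑ g : G, algebraMap B L (g • b) = algebraMap A L ϖ ^ j := by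
    rw [← map_sum, hb, map_pow, ← IsScalarTower.algebraMap_apply]
  rw [map_mul, map_inv₀, map_pow, ← IsScalarTower.algebraMap_apply, mul_inv_cancel_left₀
    (pow_ne_zero j hL), ha, map_mul, map_pow, ← IsScalarTower.algebraMap_apply A B L, mul_add,
    ← mul_assoc, ← pow_add, Nat.add_sub_cancel' hn, map_neg, map_sum, ← hb', Finset.sum_mul,
    mul_neg, ← sub_eq_add_neg, Finset.mul_sum, ← Finset.sum_sub_distrib]
  refine Finset.sum_congr rfl fun g _ => ?_
  have := hy g
  rw [map_mul, map_pow, ← IsScalarTower.algebraMap_apply A B L] at this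
  rw [smul_mul', algebraMap.smul', map_mul, algebraMap.smul']
  linear_combination (g • algebraMap B L b) * (-this)

end Average

/-- An almost invariant element of `B` is close to an element of `A`. -/
theorem exists_close_of_dvd_sub_smul {A B : Type*} (K L : Type*) {G : Type*} [CommRing A]
    [IsDomain A] [IsDiscreteValuationRing A] [Field K] [Algebra A K] [IsFractionRing A K] [Field L]
    [Algebra K L] [Algebra A L] [IsScalarTower A K L] [CommRing B] [Algebra A B] [Algebra B L]
    [IsScalarTower A B L] [IsFractionRing B L] [Group G] [Fintype G] [MulSemiringAction G L]
    [IsGaloisGroup G K L] [MulSemiringAction G B] [SMulDistribClass G B L] [IsIntegralClosure B A L]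
    {ϖ : A} (hϖ : ϖ ≠ 0) {b : B} {j : ℕ}
    (hb : ∑ g : G, g • b = algebraMap A B ϖ ^ j) {n : ℕ} (hn : j ≤ n) {x : B}
    (hx : ∀ g : G, algebraMap A B ϖ ^ n ∣ x - g • x) :
    ∃ a : A, algebraMap A B ϖ ^ (n - j) ∣ x - algebraMap A B a := by
  obtain ⟨a, y, h⟩ := exists_close_of_sub_smul (K := K) (L := L) (x := algebraMap B L x) hϖ hb hn
    (fun g => by
      obtain ⟨y, hy⟩ := hx g
      exact ⟨y, by rw [← hy, map_sub, algebraMap.smul']⟩)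
  rw [← map_add] at h
  obtain ⟨a, rfl⟩ := exists_algebraMap_eq_of_integral (A := A) h
  rw [← IsScalarTower.algebraMap_apply, IsScalarTower.algebraMap_apply A B L] at h
  refine ⟨a, -y, ?_⟩
  rw [IsFractionRing.injective B L h]
  ring

/-! ### Integrality of substitutions and the bound on the scaling factor. -/

namespace WeierstrassCurve

open Substitution

section IntegralChange

variable {R F : Type*} [CommRing R] [IsIntegrallyClosed R] [Field F] [Algebra R F]
  [IsFractionRing R F]

/-- A change of variables over the fraction field between integral Weierstrass equations has
integral coefficients as soon as `u` is integral. -/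
theorem exists_substitution {W₁ W₂ : WeierstrassCurve R} {C : VariableChange F}
    (h : C • W₁.map (algebraMap R F) = W₂.map (algebraMap R F)) {u : R}
    (hu : algebraMap R F u = C.u) :
    ∃ c : Substitution R, c.map (algebraMap R F) = ofChange C ∧ c.apply W₂ = W₁ ∧ c.u = u := by
  have lift {x : F} (hx : _root_.IsIntegral R x) : ∃ y, algebraMap R F y = x :=
    IsIntegrallyClosed.isIntegral_iff.mp hx
  have hu0 : (C.u : F) ≠ 0 := C.u.ne_zero
  have e₂ := congrArg a₂ h
  have e₆ := congrArg a₆ h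
  have eb₆ := congrArg b₆ h
  have eb₈ := congrArg b₈ h
  rw [variableChange_b₆, map_b₂, map_b₄, map_b₆, map_b₆] at eb₆
  rw [variableChange_b₈, map_b₂, map_b₄, map_b₆, map_b₈, map_b₈] at eb₈
  rw [variableChange_a₂, map_a₁, map_a₂, map_a₂] at e₂
  rw [variableChange_a₆, map_a₁, map_a₂, map_a₃, map_a₄, map_a₆, map_a₆] at e₆
  have hinv : ((C.u⁻¹ : Fˣ) : F) = (C.u : F)⁻¹ := by simp
  rw [hinv] at eb₆ eb₈ e₂ e₆
  field_simp at eb₆ eb₈ e₂ e₆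
  rw [← hu] at eb₆ eb₈ e₂ e₆
  -- In `r` times the transformation law of `b₆` minus that of `b₈`, the terms in `b₂ r³` cancel and
  -- `4 r⁴ - 3 r⁴` remains: a monic quartic for `r`. The laws of `a₂` and `a₆` are then monic
  -- quadratics for `s` and `t`.
  obtain ⟨r, hr⟩ := lift (x := C.r) (by
    refine ⟨.X ^ 4 - .C W₁.b₄ * .X ^ 2 - .C (2 * W₁.b₆ + u ^ 6 * W₂.b₆) * .X
      - .C (W₁.b₈ - u ^ 8 * W₂.b₈), by monicity!, ?_⟩
    simp only [Polynomial.eval₂_sub, Polynomial.eval₂_mul, Polynomial.eval₂_pow,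
      Polynomial.eval₂_X, Polynomial.eval₂_C]
    simp only [map_add, map_sub, _root_.map_mul, map_pow, map_ofNat]
    linear_combination C.r * eb₆ - eb₈)
  rw [← hr] at e₂ e₆
  obtain ⟨s, hs⟩ := lift (x := C.s) (by
    refine ⟨.X ^ 2 + .C W₁.a₁ * .X + .C (u ^ 2 * W₂.a₂ - W₁.a₂ - 3 * r), by monicity!, ?_⟩
    simp only [Polynomial.eval₂_add, Polynomial.eval₂_mul, Polynomial.eval₂_pow,
      Polynomial.eval₂_X, Polynomial.eval₂_C]
    simp only [map_sub, _root_.map_mul, map_pow, map_ofNat]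
    linear_combination -e₂)
  obtain ⟨t, ht⟩ := lift (x := C.t) (by
    refine ⟨.X ^ 2 + .C (W₁.a₃ + r * W₁.a₁) * .X
      + .C (u ^ 6 * W₂.a₆ - W₁.a₆ - r * W₁.a₄ - r ^ 2 * W₁.a₂ - r ^ 3), by monicity!, ?_⟩
    simp only [Polynomial.eval₂_add, Polynomial.eval₂_mul, Polynomial.eval₂_pow,
      Polynomial.eval₂_X, Polynomial.eval₂_C]
    simp only [map_add, map_sub, _root_.map_mul, map_pow]
    linear_combination -e₆)
  have hc : (⟨u, r, s, t⟩ : Substitution R).map (algebraMap R F) = ofChange C :=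
    Substitution.ext hu hr hs ht
  refine ⟨_, hc, map_injective (IsFractionRing.injective R F) ?_, rfl⟩
  change (Substitution.apply _ W₂).map _ = W₁.map _
  rw [map_apply, hc, ← h, ofChange_apply_smul]

end IntegralChange

section Bound

variable {A K B G : Type*} [CommRing A] [IsDomain A] [IsDiscreteValuationRing A] [Field K]
  [Algebra A K] [IsFractionRing A K] [CommRing B] [IsDomain B] [Algebra A B] [FaithfulSMul A B]
  [Algebra.IsIntegral A B] [Group G] [Fintype G] [MulSemiringAction G B] [IsGaloisGroup G A B]

/-- The substitution factors as `(u, r, s, t)` followed by scaling by `ϖ`, so each `aᵢ` of `V` is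
divisible by `ϖ ^ i` in `B`, hence in `A`. -/
theorem exists_scaled {V : WeierstrassCurve A} {ϖ : A} {W' : WeierstrassCurve B} {u r s t : B}
    (h : (⟨algebraMap A B ϖ * u, algebraMap A B ϖ ^ 2 * r, algebraMap A B ϖ * s,
      algebraMap A B ϖ ^ 3 * t⟩ : Substitution B).apply W' = V.map (algebraMap A B)) :
    ∃ V' : WeierstrassCurve A, (⟨ϖ, 0, 0, 0⟩ : Substitution A).apply V' = V := by
  have e : (⟨algebraMap A B ϖ * u, algebraMap A B ϖ ^ 2 * r, algebraMap A B ϖ * s,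
      algebraMap A B ϖ ^ 3 * t⟩ : Substitution B) =
      ⟨u, r, s, t⟩ * ⟨algebraMap A B ϖ, 0, 0, 0⟩ := by
    simp only [mul_def]
    ext <;> ring
  rw [e, apply_mul] at h
  have key (i : ℕ) (a : A) (y : B) (hy : algebraMap A B ϖ ^ i * y = algebraMap A B a) :
      ∃ a', ϖ ^ i * a' = a := by
    obtain ⟨a', ha'⟩ := dvd_of_algebraMap_dvd (A := A) (B := B) (c := ϖ ^ i) (a := a)
      ⟨y, by rw [map_pow, hy]⟩
    exact ⟨a', ha'.symm⟩
  have h₁ := congrArg a₁ h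
  have h₂ := congrArg a₂ h
  have h₃ := congrArg a₃ h
  have h₄ := congrArg a₄ h
  have h₆ := congrArg a₆ h
  generalize (⟨u, r, s, t⟩ : Substitution B).apply W' = U at h₁ h₂ h₃ h₄ h₆
  simp only [apply, map_a₁, map_a₂, map_a₃, map_a₄, map_a₆, mul_zero, zero_mul, sub_zero, add_zero,
    ne_eq, OfNat.ofNat_ne_zero, not_false_eq_true, zero_pow] at h₁ h₂ h₃ h₄ h₆
  obtain ⟨b₁, k₁⟩ := key 1 V.a₁ U.a₁ (by rw [pow_one, h₁])
  obtain ⟨b₂, k₂⟩ := key 2 _ _ h₂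
  obtain ⟨b₃, k₃⟩ := key 3 _ _ h₃
  obtain ⟨b₄, k₄⟩ := key 4 _ _ h₄
  obtain ⟨b₆, k₆⟩ := key 6 _ _ h₆
  refine ⟨⟨b₁, b₂, b₃, b₄, b₆⟩, ?_⟩
  ext <;> simp [apply, ← k₁, ← k₂, ← k₃, ← k₄, ← k₆]

/-- The minimal equations over `A` and `B` cannot differ too much. -/
theorem u_dvd_pow [IsIntegrallyClosed B] {W : WeierstrassCurve A} {W' : WeierstrassCurve B}
    {c : Substitution B}
    (hc : c.apply W' = W.map (algebraMap A B)) {D : G → VariableChange B}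
    (hD : ∀ g, ofChange (D g) * c.map (MulSemiringAction.toRingHom G B g) = c) (hΔ : W.Δ ≠ 0)
    (hmin : ∀ (V : WeierstrassCurve A) (Q : VariableChange K),
      Q • W.map (algebraMap A K) = V.map (algebraMap A K) → W.Δ ∣ V.Δ)
    {ϖ : A} (hϖ : Irreducible ϖ) {j : ℕ}
    (havg : ∀ (n : ℕ) (x : B), j ≤ n → (∀ g : G, algebraMap A B ϖ ^ n ∣ x - g • x) →
      ∃ a : A, algebraMap A B ϖ ^ (n - j) ∣ x - algebraMap A B a) :
    c.u ∣ algebraMap A B ϖ ^ (j + 1) := by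
  have hu0 : c.u ≠ 0 := by
    intro h0
    have := congrArg Δ hc
    rw [apply_Δ, h0, map_Δ, zero_pow (by norm_num), zero_mul] at this
    exact hΔ ((map_eq_zero_iff _ (FaithfulSMul.algebraMap_injective A B)).mp this.symm)
  have hu (g : G) : ((D g).u : B) * g • c.u = c.u := congrArg Substitution.u (hD g)
  have hr (g : G) : (D g).r * (g • c.u) ^ 2 + g • c.r = c.r := congrArg Substitution.r (hD g)
  have hs (g : G) : g • c.u * (D g).s + g • c.s = c.s := congrArg Substitution.s (hD g)
  have ht (g : G) : (D g).t * (g • c.u) ^ 3 + (D g).r * g • c.s * (g • c.u) ^ 2 + g • c.t = c.t :=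
    congrArg Substitution.t (hD g)
  -- The descent relation makes `c.u` associated to its conjugates, hence comparable with `ϖ ^ (j +
  -- 1)`. It remains to exclude that `ϖ ^ (j + 1)` divides `c.u`.
  refine (dvd_pow_or_pow_dvd (G := G) hϖ hu0 (fun g => ?_) _).resolve_right ?_
  · exact ((associated_unit_mul_left _ _ (D g).u.isUnit).symm.trans (.of_eq (hu g))).symm
  intro hdvd
  set π := algebraMap A B ϖ with hπ
  have hπg (g : G) : g • π = π := smul_algebraMap g ϖ
  have hgu (g : G) : ∃ y, g • c.u = π ^ (j + 1) * y := by
    obtain ⟨y, hy⟩ := hdvd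
    exact ⟨g • y, by rw [hy, smul_mul', smul_pow', hπg]⟩
  -- The relation for `r` shows that `c.r` is invariant modulo `u²`, that is modulo `ϖ ^ (2 * (j +
  -- 1))`. After averaging the precision is `j + 2`, and 2 is needed; likewise `s` is kept modulo
  -- `ϖ`.
  obtain ⟨ρ, hρ⟩ := havg (2 * (j + 1)) c.r (by omega) fun g => by
    obtain ⟨y, hy⟩ := hgu g
    refine ⟨(D g).r * y ^ 2, ?_⟩
    have := hr g
    rw [hy] at this
    linear_combination -this
  obtain ⟨σ, hσ⟩ := havg (j + 1) c.s (by omega) fun g => by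
    obtain ⟨y, hy⟩ := hgu g
    refine ⟨y * (D g).s, ?_⟩
    have := hs g
    rw [hy] at this
    linear_combination -this
  rw [Nat.add_sub_cancel_left, pow_one] at hσ
  obtain ⟨s₁, hs₁⟩ := hσ
  have hσg (g : G) : g • algebraMap A B σ = algebraMap A B σ := smul_algebraMap g σ
  -- Subtracting `r * σ` replaces `g s` by `g s - σ`, a multiple of `ϖ`, in the defect of
  -- invariance. This gains the extra factor `ϖ`; after averaging, the precision `j + 3` covers the
  -- 3 needed for `t`.
  obtain ⟨τ, hτ⟩ := havg (2 * (j + 1) + 1) (c.t - c.r * algebraMap A B σ) (by omega) fun g => by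
    obtain ⟨y, hy⟩ := hgu g
    refine ⟨(D g).t * y ^ 3 * π ^ j + (D g).r * y ^ 2 * g • s₁, ?_⟩
    have h1 := ht g
    have h2 := hr g
    have h3 : g • c.s - algebraMap A B σ = π * g • s₁ := by
      rw [← hσg g, ← smul_sub, hs₁, smul_mul', hπg]
    rw [hy] at h1 h2
    rw [smul_sub, smul_mul', hσg]
    linear_combination -h1 + algebraMap A B σ * h2 + (D g).r * π ^ (2 * (j + 1)) * y ^ 2 * h3
  obtain ⟨u₁, hu₁⟩ : π ∣ c.u := (dvd_pow_self _ (by omega)).trans hdvd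
  obtain ⟨r₁, hr₁⟩ := (pow_dvd_pow π (by omega : 2 ≤ 2 * (j + 1) - j)).trans hρ
  obtain ⟨t₁, ht₁⟩ := (pow_dvd_pow π (by omega : 3 ≤ 2 * (j + 1) + 1 - j)).trans hτ
  -- Translating by the approximations over `A` makes the substitution divisible by `ϖ` with the
  -- weights 1, 2, 1, 3, so the equation over `A` can be scaled down.
  let T : VariableChange A := ⟨1, -ρ, -σ, -τ⟩
  have hcT : c * (ofChange T).map (algebraMap A B) =
      ⟨π * u₁, π ^ 2 * r₁, π * s₁, π ^ 3 * t₁⟩ := by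
    rw [← hu₁, ← hr₁, ← hs₁, ← ht₁]
    simp only [mul_def, ofChange, Substitution.map, T, Units.val_one, map_one, map_neg]
    ext <;> ring
  have hV : (⟨π * u₁, π ^ 2 * r₁, π * s₁, π ^ 3 * t₁⟩ : Substitution B).apply W' =
      ((ofChange T).apply W).map (algebraMap A B) := by
    rw [← hcT, apply_mul, hc, map_apply]
  obtain ⟨V, hV⟩ := exists_scaled hV
  have hΔV : ϖ ^ 12 * V.Δ = W.Δ := by
    have := congrArg Δ hV
    rwa [apply_Δ, apply_Δ, ofChange, Units.val_one, one_pow, one_mul] at this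
  let S : VariableChange K := ⟨Units.mk0 (algebraMap A K ϖ) (by simpa using hϖ.ne_zero), 0, 0, 0⟩
  have hQ : (S * (T.map (algebraMap A K))⁻¹) • W.map (algebraMap A K) = V.map (algebraMap A K) := by
    have h1 : (T.map (algebraMap A K))⁻¹ • W.map (algebraMap A K) =
        ((ofChange T).apply W).map (algebraMap A K) := by
      rw [inv_smul_eq_iff, eq_comm, map_variableChange]
      congr 1
      exact (ofChange_apply_eq_iff T).mp rfl
    rw [mul_smul, h1, ← ofChange_apply_eq_iff, ← hV, map_apply]
    congr 1
    simp [Substitution.map, ofChange, S]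
  -- The scaled equation has discriminant `W.Δ / ϖ ^ 12`, contradicting minimality.
  obtain ⟨x, hx⟩ := hmin V _ hQ
  have hV0 : V.Δ ≠ 0 := by
    rintro h0
    exact hΔ (by rw [← hΔV, h0, mul_zero])
  refine hϖ.not_isUnit (.of_mul_eq_one (ϖ ^ 11 * x) (mul_left_cancel₀ hV0 ?_))
  rw [← hΔV] at hx
  linear_combination -hx

end Bound

end WeierstrassCurve

/-! ### From approximate descent to exact descent. -/

namespace WeierstrassCurve

open Substitution

section Approximation

variable {A K L B G : Type*} [CommRing A] [IsDomain A] [IsDiscreteValuationRing A] [Field K]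
  [Algebra A K] [IsFractionRing A K] [Field L] [Algebra K L] [Algebra A L] [IsScalarTower A K L]
  [CommRing B] [Algebra A B] [Algebra B L] [IsScalarTower A B L] [IsFractionRing B L]
  [Group G] [Fintype G] [MulSemiringAction G L] [IsGaloisGroup G K L] [MulSemiringAction G B]
  [SMulDistribClass G B L]

/-- A substitution which is almost a descent datum is close to an actual one. -/
theorem exists_close_change {c : Substitution B} (hc0 : c.u ≠ 0) {D : G → VariableChange B}
    (hD : ∀ g, ofChange (D g) * c.map (MulSemiringAction.toRingHom G B g) = c)
    {ϖ : A} (hϖ : ϖ ≠ 0) {b : B} {j k M : ℕ} (hb : ∑ g : G, g • b = algebraMap A B ϖ ^ j)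
    (hM : k + 3 * j ≤ M) (hcu : c.u ∣ algebraMap A B ϖ ^ k) {d : Substitution B} {S : Type*}
    [CommRing S] {q : B →+* S} (hq : RingHom.ker q = Ideal.span {algebraMap A B ϖ ^ M})
    (hd : ∀ g, (ofChange (D g) * d.map (MulSemiringAction.toRingHom G B g)).map q = d.map q) :
    ∃ (p : Substitution K) (e f : Substitution B),
      e.map (algebraMap B L) = c.map (algebraMap B L) * p.map (algebraMap K L) ∧
      e.u = d.u + algebraMap A B ϖ ^ (M - k - j) * f.u ∧
      e.r = d.r + algebraMap A B ϖ ^ (M - k - 3 * j) * f.r ∧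
      e.s = d.s + algebraMap A B ϖ ^ (M - k - 3 * j) * f.s ∧
      e.t = d.t + algebraMap A B ϖ ^ (M - k - 3 * j) * f.t := by
  have hdvd {x y : B} (h : q x = q y) : ∃ z, y = x + algebraMap A B ϖ ^ M * z := by
    rw [eq_comm, ← sub_eq_zero, ← map_sub, ← RingHom.mem_ker, hq, Ideal.mem_span_singleton] at h
    obtain ⟨z, hz⟩ := h
    exact ⟨z, by rw [← hz, add_sub_cancel]⟩
  have hu (g : G) : ((D g).u : B) * g • c.u = c.u := congrArg Substitution.u (hD g)
  have hr (g : G) : (D g).r * (g • c.u) ^ 2 + g • c.r = c.r := congrArg Substitution.r (hD g)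
  have hs (g : G) : g • c.u * (D g).s + g • c.s = c.s := congrArg Substitution.s (hD g)
  have ht (g : G) : (D g).t * (g • c.u) ^ 3 + (D g).r * g • c.s * (g • c.u) ^ 2 + g • c.t = c.t :=
    congrArg Substitution.t (hD g)
  have hdu (g : G) : ∃ z, d.u = ((D g).u : B) * g • d.u + algebraMap A B ϖ ^ M * z :=
    hdvd (congrArg Substitution.u (hd g))
  have hdr (g : G) : ∃ z, d.r = (D g).r * (g • d.u) ^ 2 + g • d.r + algebraMap A B ϖ ^ M * z :=
    hdvd (congrArg Substitution.r (hd g))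
  have hds (g : G) : ∃ z, d.s = g • d.u * (D g).s + g • d.s + algebraMap A B ϖ ^ M * z :=
    hdvd (congrArg Substitution.s (hd g))
  have hdt (g : G) : ∃ z, d.t = (D g).t * (g • d.u) ^ 3 + (D g).r * g • d.s * (g • d.u) ^ 2
      + g • d.t + algebraMap A B ϖ ^ M * z :=
    hdvd (congrArg Substitution.t (hd g))
  let ι := algebraMap B L
  have hιg (g : G) (x : B) : g • ι x = ι (g • x) := (algebraMap.smul' g x L).symm
  have hKg (g : G) (a : K) : g • algebraMap K L a = algebraMap K L a := smul_algebraMap g a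
  -- Here `M₃` is the precision left at the end. Dividing by `c.u` costs `k`; three successive
  -- averagings cost `j` each, since `ρ` and `σ` use the approximation `α`, and `τ` uses `σ`.
  obtain ⟨M₃, rfl⟩ := Nat.exists_eq_add_of_le hM
  have hM₁ : k + 3 * j + M₃ - k - j = M₃ + j + j := by omega
  have hM₂ : k + 3 * j + M₃ - k - 3 * j = M₃ := by omega
  rw [hM₁, hM₂]
  have hπM : algebraMap A B ϖ ^ (k + 3 * j + M₃) = algebraMap A B ϖ ^ M₃ * algebraMap A B ϖ ^ j *
      algebraMap A B ϖ ^ j * algebraMap A B ϖ ^ j * algebraMap A B ϖ ^ k := by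
    ring
  have hinj : Function.Injective ι := IsFractionRing.injective B L
  have hιu : ι c.u ≠ 0 := by simpa [ι] using hc0
  -- the scaling factor
  obtain ⟨y₀, hy₀⟩ := hcu
  obtain ⟨α, y₁, hα⟩ := exists_close_of_sub_smul (K := K) (L := L) (x := ι d.u / ι c.u) hϖ hb
    (n := M₃ + j + j + j) (by omega) (fun g => by
      obtain ⟨z, hz⟩ := hdu g
      refine ⟨z * y₀, ?_⟩
      have hg : ι (g • c.u) ≠ 0 := by
        intro h0
        have := congrArg ι (hu g)
        rw [_root_.map_mul, h0, mul_zero] at this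
        exact hιu this.symm
      have h1 := congrArg ι (hu g)
      have h2 := congrArg ι hz
      have h3 := congrArg ι hy₀
      rw [hπM] at h2
      simp only [_root_.map_mul, map_add, map_pow] at h1 h2 h3
      rw [smul_div₀', hιg, hιg]
      simp only [_root_.map_mul, map_pow, pow_add]
      rw [div_sub_div _ _ hιu hg, div_eq_iff (mul_ne_zero hιu hg)]
      change _ = ι _ ^ _ * ι _ ^ _ * ι _ ^ _ * ι _ ^ _ * (ι _ * ι _) * _
      linear_combination ι (g • c.u) * h2 + ι (g • d.u) * h1 + ι (algebraMap A B ϖ) ^ M₃ *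
        ι (algebraMap A B ϖ) ^ j * ι (algebraMap A B ϖ) ^ j * ι (algebraMap A B ϖ) ^ j * ι z *
        ι (g • c.u) * h3)
  rw [Nat.add_sub_cancel] at hα
  -- From here on `w` replaces `d.u`: it is close to `d.u` and is exactly `α` times `c.u`, so its
  -- conjugates are known through those of `c.u`.
  let w := d.u + algebraMap A B ϖ ^ (M₃ + j + j) * (y₁ * c.u)
  have hw : ι w = ι c.u * algebraMap K L α := by
    rw [hα, mul_add, mul_div_cancel₀ _ hιu]
    change _ = ι _ + ι _ * ι _
    rw [← _root_.map_mul, ← map_add]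
    congr 1
    ring
  have hπg (g : G) : g • algebraMap A B ϖ = algebraMap A B ϖ := by
    apply hinj
    rw [← hιg]
    change g • algebraMap B L _ = algebraMap B L _
    rw [← IsScalarTower.algebraMap_apply, IsScalarTower.algebraMap_apply A K L, hKg]
  have hwg (g : G) : g • w = g • d.u + algebraMap A B ϖ ^ (M₃ + j + j) * (g • y₁ * g • c.u) := by
    simp only [w, smul_add, smul_mul', smul_pow', hπg]
  have hwK (g : G) : ι (g • w) = ι (g • c.u) * algebraMap K L α := by
    rw [← hιg, hw, smul_mul', hιg, hKg]
  -- the translation of the first coordinate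
  obtain ⟨ρ, y₂, hρ⟩ := exists_close_of_sub_smul (K := K) (L := L)
    (x := ι d.r - ι c.r * algebraMap K L α ^ 2) hϖ hb (n := M₃ + j + j) (by omega) (fun g => by
      obtain ⟨z, hz⟩ := hdr g
      refine ⟨algebraMap A B ϖ ^ j * algebraMap A B ϖ ^ k * z
        - (D g).r * (g • y₁ * g • c.u) * (g • w + g • d.u), ?_⟩
      have h1 := congrArg ι (hr g)
      have h2 := congrArg ι hz
      have h3 := congrArg ι (hwg g)
      rw [hπM] at h2
      have h4 := hwK g
      rw [pow_add, pow_add] at h3 ⊢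
      simp only [_root_.map_mul, map_add, map_sub] at h1 h2 h3 ⊢
      rw [map_pow] at h1 h2
      rw [smul_sub, smul_mul', smul_pow', hKg, hιg, hιg]
      change _ = ι _ * ι _ * ι _ * (ι _ * ι _ * ι _ - ι _ * (ι _ * ι _) * (ι _ + ι _))
      linear_combination h2 + algebraMap K L α ^ 2 * h1
        - ι (D g).r * (ι (g • w) + ι (g • d.u)) * h3 + ι (D g).r * (ι (g • w) + ι (g • c.u) * algebraMap K L α) * h4)
  rw [Nat.add_sub_cancel] at hρ
  -- the shear
  obtain ⟨σ, y₃, hσ⟩ := exists_close_of_sub_smul (K := K) (L := L)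
    (x := ι d.s - algebraMap K L α * ι c.s) hϖ hb (n := M₃ + j + j) (by omega) (fun g => by
      obtain ⟨z, hz⟩ := hds g
      refine ⟨algebraMap A B ϖ ^ j * algebraMap A B ϖ ^ k * z
        - (D g).s * (g • y₁ * g • c.u), ?_⟩
      have h1 := congrArg ι (hs g)
      have h2 := congrArg ι hz
      have h3 := congrArg ι (hwg g)
      rw [hπM] at h2
      have h4 := hwK g
      rw [pow_add, pow_add] at h3 ⊢
      simp only [_root_.map_mul, map_add, map_sub] at h1 h2 h3 ⊢
      rw [smul_sub, smul_mul', hKg, hιg, hιg]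
      change _ = ι _ * ι _ * ι _ * (ι _ * ι _ * ι _ - ι _ * (ι _ * ι _))
      linear_combination h2 + algebraMap K L α * h1 - ι (D g).s * h3 + ι (D g).s * h4)
  rw [Nat.add_sub_cancel] at hσ
  -- Similarly `s₃` is close to `d.s` and equals exactly the shear of the product of `c` with the
  -- approximations found so far.
  let s₃ := d.s + algebraMap A B ϖ ^ (M₃ + j) * y₃
  have hs₃ : ι s₃ = algebraMap K L α * ι c.s + algebraMap K L σ := by
    rw [hσ]
    simp only [s₃, map_add]
    ring
  have hs₃g (g : G) : g • s₃ = g • d.s + algebraMap A B ϖ ^ (M₃ + j) * g • y₃ := by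
    simp only [s₃, smul_add, smul_mul', smul_pow', hπg]
  have hs₃K (g : G) : ι (g • s₃) = algebraMap K L α * ι (g • c.s) + algebraMap K L σ := by
    rw [← hιg, hs₃, smul_add, smul_mul', hιg, hKg, hKg]
  -- the translation of the second coordinate
  obtain ⟨τ, y₄, hτ⟩ := exists_close_of_sub_smul (K := K) (L := L)
    (x := ι d.t - ι c.t * algebraMap K L α ^ 3
      - ι c.r * algebraMap K L σ * algebraMap K L α ^ 2) hϖ hb (n := M₃ + j) (by omega) (fun g => by
      obtain ⟨z, hz⟩ := hdt g
      let p := algebraMap A B ϖ ^ j * (g • y₁ * g • c.u)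
      let U := g • d.u
      refine ⟨algebraMap A B ϖ ^ j * algebraMap A B ϖ ^ j * algebraMap A B ϖ ^ k * z
        - (D g).t * p * (U ^ 2 + U * g • w + (g • w) ^ 2)
        - (D g).r * (g • y₃ * (g • w) ^ 2 + g • d.s * p * (U + g • w)), ?_⟩
      -- In the approximate relation for `t`, the conjugates of `d.u` and `d.s` are replaced by
      -- those of `w` and `s₃`. The factorizations of differences of squares and cubes collect the
      -- errors.
      have e : algebraMap A B ϖ ^ (M₃ + j) * (algebraMap A B ϖ ^ j * algebraMap A B ϖ ^ j *
          algebraMap A B ϖ ^ k * z - (D g).t * p * (U ^ 2 + U * g • w + (g • w) ^ 2)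
          - (D g).r * (g • y₃ * (g • w) ^ 2 + g • d.s * p * (U + g • w))) =
          d.t - g • d.t - ((D g).t * (g • w) ^ 3 + (D g).r * g • s₃ * (g • w) ^ 2) := by
        have h3 := hwg g
        have h5 := hs₃g g
        rw [hπM] at hz
        rw [pow_add, pow_add] at h3
        rw [pow_add] at h5 ⊢
        simp only [p]
        linear_combination -hz + ((D g).t * (U ^ 2 + U * g • w + (g • w) ^ 2)
          + (D g).r * g • d.s * (U + g • w)) * h3 + (D g).r * (g • w) ^ 2 * h5
      rw [e]
      have h1 := congrArg ι (hr g)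
      have h2 := congrArg ι (ht g)
      have h4 := hwK g
      have h6 := hs₃K g
      simp only [_root_.map_mul, map_add, map_pow] at h1 h2
      rw [smul_sub, smul_sub, smul_mul', smul_mul', smul_mul', smul_pow', smul_pow', hKg, hKg,
        hιg, hιg, hιg]
      simp only [_root_.map_mul, map_add, map_sub, map_pow]
      change _ = ι _ - ι _ - (ι _ * ι _ ^ 3 + ι _ * ι _ * ι _ ^ 2)
      rw [h4, h6]
      linear_combination algebraMap K L α ^ 3 * h2 + algebraMap K L σ * algebraMap K L α ^ 2 * h1)
  rw [Nat.add_sub_cancel] at hτ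
  refine ⟨⟨α, ρ, σ, τ⟩, ⟨w, d.r + algebraMap A B ϖ ^ (M₃ + j) * y₂, s₃,
    d.t + algebraMap A B ϖ ^ M₃ * y₄⟩, ⟨y₁ * c.u, algebraMap A B ϖ ^ j * y₂,
    algebraMap A B ϖ ^ j * y₃, y₄⟩, ?_, rfl, ?_, ?_, rfl⟩
  · simp only [Substitution.map, mul_def]
    refine Substitution.ext hw ?_ hs₃ ?_
    · change ι (_ + _) = ι _ * _ + _
      rw [hρ, map_add]
      ring
    · change ι (_ + _) = ι _ * _ + ι _ * _ * _ + _
      rw [hτ, map_add]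
      ring
  · simp only [pow_add]
    ring
  · simp only [s₃, pow_add]
    ring

end Approximation

end WeierstrassCurve

namespace WeierstrassCurve

open Substitution

theorem map_eq_map_of_ker_le {R S T : Type*} [CommRing R] [CommRing S] [CommRing T] {φ : R →+* S}
    {ψ : R →+* T} (hφψ : RingHom.ker φ ≤ RingHom.ker ψ) {V W : WeierstrassCurve R}
    (h : V.map φ = W.map φ) : V.map ψ = W.map ψ := by
  have key {x y : R} (hxy : φ x = φ y) : ψ x = ψ y := by
    rw [← sub_eq_zero, ← map_sub] at hxy ⊢
    exact hφψ hxy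
  exact WeierstrassCurve.ext (key (congrArg a₁ h)) (key (congrArg a₂ h)) (key (congrArg a₃ h))
    (key (congrArg a₄ h)) (key (congrArg a₆ h))

section Approximation

variable {A K L B G : Type*} [CommRing A] [IsDomain A] [IsDiscreteValuationRing A] [Field K]
  [Algebra A K] [IsFractionRing A K] [Field L] [Algebra K L] [Algebra A L] [IsScalarTower A K L]
  [CommRing B] [Algebra A B] [Algebra B L] [IsScalarTower A B L] [IsFractionRing B L]
  [IsIntegralClosure B A L]

/-- Inside `L`, the intersection of `K` and `B` is `A`. -/
theorem exists_map_eq_of_map_eq {V : WeierstrassCurve K} {U : WeierstrassCurve B}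
    (h : V.map (algebraMap K L) = U.map (algebraMap B L)) :
    ∃ V₀ : WeierstrassCurve A, V₀.map (algebraMap A K) = V ∧ V₀.map (algebraMap A B) = U := by
  obtain ⟨a₁, h₁⟩ := exists_algebraMap_eq_of_integral (A := A) (congrArg a₁ h)
  obtain ⟨a₂, h₂⟩ := exists_algebraMap_eq_of_integral (A := A) (congrArg a₂ h)
  obtain ⟨a₃, h₃⟩ := exists_algebraMap_eq_of_integral (A := A) (congrArg a₃ h)
  obtain ⟨a₄, h₄⟩ := exists_algebraMap_eq_of_integral (A := A) (congrArg a₄ h)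
  obtain ⟨a₆, h₆⟩ := exists_algebraMap_eq_of_integral (A := A) (congrArg a₆ h)
  have hV : (⟨a₁, a₂, a₃, a₄, a₆⟩ : WeierstrassCurve A).map (algebraMap A K) = V :=
    WeierstrassCurve.ext h₁ h₂ h₃ h₄ h₆
  refine ⟨_, hV, map_injective (IsFractionRing.injective B L) ?_⟩
  change (WeierstrassCurve.map _ _).map _ = U.map _
  rw [← h, ← hV, WeierstrassCurve.map_map, WeierstrassCurve.map_map,
    ← IsScalarTower.algebraMap_eq, ← IsScalarTower.algebraMap_eq]

theorem map_mk_eq_of_algebraMap [IsDomain B] [FaithfulSMul A B] [Algebra.IsIntegral A B]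
    {V W : WeierstrassCurve A} {c : A}
    (h : (V.map (algebraMap A B)).map (Ideal.Quotient.mk (Ideal.span {algebraMap A B c})) =
      (W.map (algebraMap A B)).map (Ideal.Quotient.mk (Ideal.span {algebraMap A B c}))) :
    V.map (Ideal.Quotient.mk (Ideal.span {c})) = W.map (Ideal.Quotient.mk (Ideal.span {c})) := by
  have key {x y : A} (hxy : Ideal.Quotient.mk (Ideal.span {algebraMap A B c}) (algebraMap A B x) =
      Ideal.Quotient.mk _ (algebraMap A B y)) :
      Ideal.Quotient.mk (Ideal.span {c}) x = Ideal.Quotient.mk _ y := by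
    rw [Ideal.Quotient.eq, Ideal.mem_span_singleton, ← map_sub] at hxy
    rw [Ideal.Quotient.eq, Ideal.mem_span_singleton]
    exact dvd_of_algebraMap_dvd hxy
  exact WeierstrassCurve.ext (key (congrArg a₁ h)) (key (congrArg a₂ h)) (key (congrArg a₃ h))
    (key (congrArg a₄ h)) (key (congrArg a₆ h))

end Approximation

/-- If the equation `W'` has an approximate descent `(d, X)` to `A`, and an actual one `(c, W)`,
then `W` has an integral change of variables close to `X`. -/
theorem exists_close_model {A K B G : Type*} (L : Type*) [CommRing A] [IsDomain A]
    [IsDiscreteValuationRing A] [Field K] [Algebra A K] [IsFractionRing A K] [Field L] [Algebra K L]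
    [Algebra A L] [IsScalarTower A K L] [CommRing B] [IsDomain B] [Algebra A B] [FaithfulSMul A B]
    [Algebra.IsIntegral A B] [Algebra B L] [IsScalarTower A B L] [IsFractionRing B L]
    [IsIntegralClosure B A L] [Group G] [Fintype G] [MulSemiringAction G L] [IsGaloisGroup G K L]
    [MulSemiringAction G B] [SMulDistribClass G B L]
    {W : WeierstrassCurve A} {W' : WeierstrassCurve B} {c : Substitution B}
    (hc : c.apply W' = W.map (algebraMap A B)) {D : G → VariableChange B}
    (hD : ∀ g, ofChange (D g) * c.map (MulSemiringAction.toRingHom G B g) = c)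
    {ϖ : A} (hϖ : Irreducible ϖ) {b : B} {j k M : ℕ} (hb : ∑ g : G, g • b = algebraMap A B ϖ ^ j)
    (hM : k + 3 * j ≤ M) (hM' : 2 * k + j < M) (hcu : c.u ∣ algebraMap A B ϖ ^ k)
    {d : Substitution B} (hdu : d.u ∣ algebraMap A B ϖ ^ k) {S : Type*} [CommRing S] {q : B →+* S}
    (hq : RingHom.ker q = Ideal.span {algebraMap A B ϖ ^ M})
    (hd : ∀ g, (ofChange (D g) * d.map (MulSemiringAction.toRingHom G B g)).map q = d.map q)
    {X : WeierstrassCurve A} (hX : (d.apply W').map q = (X.map (algebraMap A B)).map q) :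
    ∃ (V : WeierstrassCurve A) (Q : VariableChange K) (v : B),
      Q • W.map (algebraMap A K) = V.map (algebraMap A K) ∧ IsUnit v ∧
      algebraMap A B V.Δ = (d.u * v) ^ 12 * W'.Δ ∧
      V.map (Ideal.Quotient.mk (Ideal.span {ϖ ^ (M - k - 3 * j)})) =
        X.map (Ideal.Quotient.mk (Ideal.span {ϖ ^ (M - k - 3 * j)})) := by
  have hπ0 : algebraMap A B ϖ ≠ 0 := by simpa using hϖ.ne_zero
  have hc0 : c.u ≠ 0 := fun h0 => pow_ne_zero k hπ0 (zero_dvd_iff.mp (h0 ▸ hcu))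
  have hd0 : d.u ≠ 0 := fun h0 => pow_ne_zero k hπ0 (zero_dvd_iff.mp (h0 ▸ hdu))
  obtain ⟨p, e, f, he, hu, hr, hs, ht⟩ :=
    exists_close_change (K := K) (L := L) hc0 hD hϖ.ne_zero hb hM hcu hq hd
  obtain ⟨y, hy⟩ := hdu
  -- The error in `e.u` is a multiple of `ϖ ^ (M - k - j)` with exponent larger than `k`, whereas
  -- `d.u` divides `ϖ ^ k`. Hence `e.u` is `d.u` times an element `1 + ϖ * …`, which is a unit.
  let v := 1 + algebraMap A B ϖ * (algebraMap A B ϖ ^ (M - 2 * k - j - 1) * y * f.u)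
  have hv : IsUnit v := isUnit_one_add_mul
    ((IsLocalRing.mem_maximalIdeal _).mpr hϖ.not_isUnit) _
  have huv : e.u = d.u * v := by
    have : M - k - j = k + 1 + (M - 2 * k - j - 1) := by omega
    rw [hu, this, pow_add, pow_add, hy]
    simp only [v]
    ring
  have hq0 : p.u ≠ 0 := by
    intro h0
    have := congrArg Substitution.u he
    simp only [Substitution.map, mul_def, h0, map_zero, mul_zero, huv] at this
    rw [map_eq_zero_iff _ (IsFractionRing.injective B L)] at this
    exact mul_ne_zero hd0 hv.ne_zero this
  let Q : VariableChange K := ⟨Units.mk0 p.u hq0, p.r, p.s, p.t⟩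
  -- As `e` is `c` followed by `p`, transforming `W'` by `e` is transforming `W` by `p`. The result
  -- has coefficients in both `B` and `K`, hence in `A`.
  obtain ⟨V, hVK, hVB⟩ := exists_map_eq_of_map_eq (A := A) (V := p.apply (W.map (algebraMap A K)))
    (U := e.apply W') (L := L) (by
      rw [map_apply, map_apply, he, apply_mul, ← map_apply (algebraMap B L) c, hc,
        WeierstrassCurve.map_map,
        WeierstrassCurve.map_map, ← IsScalarTower.algebraMap_eq, ← IsScalarTower.algebraMap_eq])
  refine ⟨V, Q⁻¹, v, ?_, hv, ?_, ?_⟩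
  · rw [inv_smul_eq_iff, hVK, eq_comm]
    exact (ofChange_apply_eq_iff Q).mp rfl
  · rw [← map_Δ, hVB, apply_Δ, huv]
  · refine map_mk_eq_of_algebraMap (B := B) ?_
    rw [hVB, map_pow]
    have hmk {x y z : B} {i : ℕ} (hi : M - k - 3 * j ≤ i) (h : x = y + algebraMap A B ϖ ^ i * z) :
        Ideal.Quotient.mk (Ideal.span {algebraMap A B ϖ ^ (M - k - 3 * j)}) x =
          Ideal.Quotient.mk _ y := by
      rw [Ideal.Quotient.eq, Ideal.mem_span_singleton, h, add_sub_cancel_left]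
      exact (pow_dvd_pow _ hi).mul_right z
    have hed : e.map (Ideal.Quotient.mk (Ideal.span {algebraMap A B ϖ ^ (M - k - 3 * j)})) =
        d.map (Ideal.Quotient.mk _) :=
      Substitution.ext (hmk (by omega) hu) (hmk le_rfl hr) (hmk le_rfl hs) (hmk le_rfl ht)
    rw [map_apply, hed, ← map_apply]
    refine map_eq_map_of_ker_le ?_ hX
    rw [hq, Ideal.mk_ker]
    exact Ideal.span_singleton_le_span_singleton.mpr (pow_dvd_pow _ (by omega))

end WeierstrassCurve

/-! ### Models over `A` as descents of the minimal model over `B`. -/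

namespace WeierstrassCurve

open Substitution

section Model

variable {R F : Type u} [CommRing R] [Field F] [Algebra R F] {E : WeierstrassCurve F}

theorem Model.Δ_ne_zero [E.IsElliptic] (M : Model R E) : M.eqn.Δ ≠ 0 := by
  intro h0
  have := congrArg Δ M.change_smul
  rw [map_Δ, h0, map_zero, variableChange_Δ] at this
  simp [E.isUnit_Δ.ne_zero] at this

theorem Model.IsMinimal.Δ_dvd {M : Model R E} (hM : M.IsMinimal) {V : WeierstrassCurve R}
    {Q : VariableChange F} (h : Q • M.eqn.map (algebraMap R F) = V.map (algebraMap R F)) :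
    M.eqn.Δ ∣ V.Δ :=
  Ideal.span_singleton_le_span_singleton.mp
    (hM ⟨V, Q * M.change, by rw [mul_smul, M.change_smul, h]⟩)

end Model

/-- A Weierstrass model of `E` over `A` is obtained from the minimal model of `E_L` over `B` by an
integral substitution, compatible with the action of the Galois group. -/
theorem Model.exists_substitution {A K B L G : Type u} [CommRing A] [Field K] [Algebra A K]
    [CommRing B] [IsDomain B] [IsIntegrallyClosed B] [Algebra A B] [Field L] [Algebra K L]
    [Algebra A L] [Algebra B L] [IsScalarTower A B L] [IsScalarTower A K L] [IsFractionRing B L]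
    [Group G] [MulSemiringAction G B] [MulSemiringAction G L] [SMulDistribClass G B L]
    [SMulCommClass G K L] {E : WeierstrassCurve K} [E.IsElliptic] (W : Model A E)
    (W' : Model B (E.map (algebraMap K L))) (hW' : W'.IsMinimal) :
    ∃ c : Substitution B, c.apply W'.eqn = W.eqn.map (algebraMap A B) ∧
      ∀ g : G,
        ofChange (W'.galoisChange hW' g) * c.map (MulSemiringAction.toRingHom G B g) = c := by
  have hWL : W.change.map (algebraMap K L) • E.map (algebraMap K L) =
      (W.eqn.map (algebraMap A B)).map (algebraMap B L) := by
    rw [map_variableChange, W.change_smul, WeierstrassCurve.map_map, WeierstrassCurve.map_map,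
      ← IsScalarTower.algebraMap_eq, ← IsScalarTower.algebraMap_eq]
  let C : VariableChange L := W'.change * (W.change.map (algebraMap K L))⁻¹
  have hC : C • (W.eqn.map (algebraMap A B)).map (algebraMap B L) =
      W'.eqn.map (algebraMap B L) := by
    rw [mul_smul, ← hWL, inv_smul_smul, W'.change_smul]
  -- Minimality over `B` makes `W'.eqn.Δ` divide the discriminant of `W`. The quotient is the
  -- twelfth power of the scaling factor, which is therefore integral.
  obtain ⟨x, hx⟩ := hW'.Δ_dvd (Q := C⁻¹) (V := W.eqn.map (algebraMap A B))
    (by rw [inv_smul_eq_iff, hC])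
  have hΔ : algebraMap B L W'.eqn.Δ ≠ 0 := by
    simpa using W'.Δ_ne_zero
  have hu : (C.u : L) ^ 12 = algebraMap B L x := by
    have h := congrArg Δ ((ofChange_apply_eq_iff C).mpr hC)
    rw [apply_Δ, map_Δ, map_Δ, hx, _root_.map_mul, mul_comm] at h
    exact mul_left_cancel₀ hΔ h
  obtain ⟨u, hu⟩ : ∃ u, algebraMap B L u = C.u := IsIntegrallyClosed.isIntegral_iff.mp
    (.of_pow (n := 12) (by norm_num) (hu ▸ isIntegral_algebraMap))
  obtain ⟨c, hcC, hc, -⟩ := WeierstrassCurve.exists_substitution hC hu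
  refine ⟨c, hc, fun g => Substitution.map_injective (IsFractionRing.injective B L) ?_⟩
  rw [Substitution.map_mul, ← ofChange_map, W'.galoisChange_map, Substitution.map_map,
    algebraMap_comp_toRingHom (L := L), ← Substitution.map_map, hcC, ← ofChange_map,
    ← ofChange_mul]
  congr 1
  -- The change of variables of `W` is defined over `K`, hence is invariant, and the conjugates of
  -- `W'.change` cancel: this is the descent relation.
  have hg : (W.change.map (algebraMap K L)).map (MulSemiringAction.toRingHom G L g) =
      W.change.map (algebraMap K L) := by
    rw [VariableChange.map_map]
    congr 1
    ext a
    exact smul_algebraMap g a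
  change _ * (VariableChange.mapHom (MulSemiringAction.toRingHom G L g)) C = C
  rw [_root_.map_mul, map_inv]
  change _ * (_ * ((W.change.map (algebraMap K L)).map _)⁻¹) = _
  rw [hg, mul_assoc]
  exact congrArg _ (inv_mul_cancel_left _ _)

end WeierstrassCurve

/-! ### Transfer of descents between the two fields. -/

namespace WeierstrassCurve

open Substitution

/-- The equation `W` over `A` is minimal, and it is obtained from the equation `W'` over `B` by the
integral substitution `c`, which is compatible with the changes of variables `D g`; its scaling
factor is bounded in terms of an element of `B` of trace `ϖ ^ j`. -/
structure IsDescent {A B G : Type*} (K : Type*) [CommRing A] [Field K] [Algebra A K] [CommRing B]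
    [Algebra A B] [Group G] [Fintype G] [MulSemiringAction G B] (W : WeierstrassCurve A)
    (W' : WeierstrassCurve B) (D : G → VariableChange B) (c : Substitution B) (ϖ : A) (j : ℕ) :
    Prop where
  irreducible : Irreducible ϖ
  Δ_ne_zero : W.Δ ≠ 0
  Δ_dvd (V : WeierstrassCurve A) (Q : VariableChange K)
    (h : Q • W.map (algebraMap A K) = V.map (algebraMap A K)) : W.Δ ∣ V.Δ
  apply_eq : c.apply W' = W.map (algebraMap A B)
  mul_map_eq (g : G) : ofChange (D g) * c.map (MulSemiringAction.toRingHom G B g) = c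
  exists_sum_smul_eq : ∃ b : B, ∑ g : G, g • b = algebraMap A B ϖ ^ j
  u_dvd : c.u ∣ algebraMap A B ϖ ^ (j + 1)

/-- Common quotients `R` of `A` and `A₀` and `S` of `B` and `B₀`, and a change of variables `H` over
`S` between the equations `W'` and `W₀'`, compatible with the changes of variables `D g` and
`D₀ g`. -/
structure IsLink {A A₀ B B₀ R S G : Type*} [CommRing A] [CommRing A₀] [CommRing B] [CommRing B₀]
    [CommRing R] [CommRing S] [Algebra A B] [Algebra A₀ B₀] [Group G] [MulSemiringAction G B]
    [MulSemiringAction G B₀] (p : A →+* R) (p₀ : A₀ →+* R) (q : B →+* S) (q₀ : B₀ →+* S)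
    (γ : G → S →+* S) (W' : WeierstrassCurve B) (W₀' : WeierstrassCurve B₀)
    (D : G → VariableChange B) (D₀ : G → VariableChange B₀) (ϖ : A) (ϖ₀ : A₀) (M : ℕ)
    (H : VariableChange S) : Prop where
  surjective_left : Function.Surjective p
  surjective_left₀ : Function.Surjective p₀
  surjective_right : Function.Surjective q
  surjective_right₀ : Function.Surjective q₀
  ker_eq : RingHom.ker q = Ideal.span {algebraMap A B ϖ ^ M}
  ker_eq₀ : RingHom.ker q₀ = Ideal.span {algebraMap A₀ B₀ ϖ₀ ^ M}
  eq_of_eq (a : A) (a₀ : A₀) (h : p a = p₀ a₀) :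
    q (algebraMap A B a) = q₀ (algebraMap A₀ B₀ a₀)
  uniformizer_eq : p ϖ = p₀ ϖ₀
  comp_eq (g : G) : (γ g).comp q = q.comp (MulSemiringAction.toRingHom G B g)
  comp_eq₀ (g : G) : (γ g).comp q₀ = q₀.comp (MulSemiringAction.toRingHom G B₀ g)
  smul_eq : H • W'.map q = W₀'.map q₀
  mul_eq (g : G) : (D₀ g).map q₀ * H.map (γ g) = H * (D g).map q

section Ring

variable {A A₀ B B₀ R S G : Type*} [CommRing A] [CommRing A₀] [CommRing B] [CommRing B₀]
  [CommRing R] [CommRing S] [Algebra A B] [Algebra A₀ B₀] [Group G] [MulSemiringAction G B]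
  [MulSemiringAction G B₀] {p : A →+* R} {p₀ : A₀ →+* R} {q : B →+* S} {q₀ : B₀ →+* S}
  {γ : G → S →+* S} {W' : WeierstrassCurve B} {W₀' : WeierstrassCurve B₀}
  {D : G → VariableChange B} {D₀ : G → VariableChange B₀} {ϖ : A} {ϖ₀ : A₀} {M : ℕ}
  {H : VariableChange S}

theorem IsLink.symm (h : IsLink p p₀ q q₀ γ W' W₀' D D₀ ϖ ϖ₀ M H) :
    IsLink p₀ p q₀ q γ W₀' W' D₀ D ϖ₀ ϖ M H⁻¹ where
  surjective_left := h.surjective_left₀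
  surjective_left₀ := h.surjective_left
  surjective_right := h.surjective_right₀
  surjective_right₀ := h.surjective_right
  ker_eq := h.ker_eq₀
  ker_eq₀ := h.ker_eq
  eq_of_eq a₀ a ha := (h.eq_of_eq a a₀ ha.symm).symm
  uniformizer_eq := h.uniformizer_eq.symm
  comp_eq := h.comp_eq₀
  comp_eq₀ := h.comp_eq
  smul_eq := by rw [inv_smul_eq_iff, h.smul_eq]
  mul_eq g := by
    have e : H⁻¹.map (γ g) = (H.map (γ g))⁻¹ := map_inv (VariableChange.mapHom (γ g)) H
    rw [e, mul_inv_eq_iff_eq_mul, mul_assoc, eq_inv_mul_iff_mul_eq, h.mul_eq]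

theorem IsLink.algebraMap_uniformizer_eq (h : IsLink p p₀ q q₀ γ W' W₀' D D₀ ϖ ϖ₀ M H) :
    q (algebraMap A B ϖ) = q₀ (algebraMap A₀ B₀ ϖ₀) :=
  h.eq_of_eq _ _ h.uniformizer_eq

/-- Take for `d` any lift of `H * c`. Modulo the kernels, `D₀ g * g(H) * g(c) = H * D g * g(c) = H *
c`, so `d` satisfies the descent relation of `W₀'` up to `ϖ₀ ^ M`. -/
theorem IsLink.exists_approximate_descent (h : IsLink p p₀ q q₀ γ W' W₀' D D₀ ϖ ϖ₀ M H)
    {W : WeierstrassCurve A} {c : Substitution B} (hc : c.apply W' = W.map (algebraMap A B))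
    (hD : ∀ g : G, ofChange (D g) * c.map (MulSemiringAction.toRingHom G B g) = c) :
    ∃ (d : Substitution B₀) (X : WeierstrassCurve A₀), X.map p₀ = W.map p ∧
      q₀ d.u = H.u * q c.u ∧
      (∀ g : G, (ofChange (D₀ g) * d.map (MulSemiringAction.toRingHom G B₀ g)).map q₀ = d.map q₀) ∧
      (d.apply W₀').map q₀ = (X.map (algebraMap A₀ B₀)).map q₀ := by
  obtain ⟨d, hd⟩ := exists_map_eq h.surjective_right₀ (ofChange H * c.map q)
  obtain ⟨a₁, h₁⟩ := h.surjective_left₀ (p W.a₁)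
  obtain ⟨a₂, h₂⟩ := h.surjective_left₀ (p W.a₂)
  obtain ⟨a₃, h₃⟩ := h.surjective_left₀ (p W.a₃)
  obtain ⟨a₄, h₄⟩ := h.surjective_left₀ (p W.a₄)
  obtain ⟨a₆, h₆⟩ := h.surjective_left₀ (p W.a₆)
  refine ⟨d, ⟨a₁, a₂, a₃, a₄, a₆⟩, WeierstrassCurve.ext h₁ h₂ h₃ h₄ h₆,
    congrArg Substitution.u hd, fun g => ?_, ?_⟩
  · rw [Substitution.map_mul, Substitution.map_map, ← h.comp_eq₀, ← Substitution.map_map, hd,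
      Substitution.map_mul, Substitution.map_map, h.comp_eq, ← Substitution.map_map,
      ← ofChange_map, ← ofChange_map, ← Substitution.mul_assoc, ← ofChange_mul, h.mul_eq,
      ofChange_mul, ofChange_map, Substitution.mul_assoc, ← Substitution.map_mul, hD]
  · rw [map_apply, hd, apply_mul, (ofChange_apply_eq_iff H).mpr h.smul_eq, ← map_apply, hc]
    exact WeierstrassCurve.ext (h.eq_of_eq _ _ h₁.symm) (h.eq_of_eq _ _ h₂.symm)
      (h.eq_of_eq _ _ h₃.symm) (h.eq_of_eq _ _ h₄.symm) (h.eq_of_eq _ _ h₆.symm)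

/-- A lift of a complementary factor gives `y * w` congruent to `ϖ₀ ^ k` modulo `ϖ₀ ^ M`. As `k <
M`, the product is `ϖ₀ ^ k` times a unit. -/
theorem IsLink.dvd_pow [IsDomain A₀] [IsDiscreteValuationRing A₀] [Algebra.IsIntegral A₀ B₀]
    (h : IsLink p p₀ q q₀ γ W' W₀' D D₀ ϖ ϖ₀ M H) (hϖ₀ : Irreducible ϖ₀) {k : ℕ} (hk : k < M)
    {x : B} (hx : x ∣ algebraMap A B ϖ ^ k) {y : B₀} (hy : q₀ y = H.u * q x) :
    y ∣ algebraMap A₀ B₀ ϖ₀ ^ k := by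
  obtain ⟨z, hz⟩ := hx
  obtain ⟨w, hw⟩ := h.surjective_right₀ (((H.u⁻¹ : Sˣ) : S) * q z)
  have h1 : q₀ (y * w) = q₀ (algebraMap A₀ B₀ ϖ₀ ^ k) := by
    rw [_root_.map_mul, hy, hw, map_pow, ← h.algebraMap_uniformizer_eq, ← map_pow, hz,
      _root_.map_mul]
    linear_combination (q x * q z) * H.u.mul_inv
  rw [← sub_eq_zero, ← map_sub, ← RingHom.mem_ker, h.ker_eq₀, Ideal.mem_span_singleton] at h1
  obtain ⟨v, hv⟩ := h1
  obtain ⟨i, rfl⟩ := Nat.exists_eq_add_of_lt hk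
  have hunit : IsUnit (1 + algebraMap A₀ B₀ ϖ₀ * (algebraMap A₀ B₀ ϖ₀ ^ i * v)) :=
    isUnit_one_add_mul ((IsLocalRing.mem_maximalIdeal _).mpr hϖ₀.not_isUnit) _
  refine (hunit.dvd_mul_right).mp ⟨w, ?_⟩
  rw [sub_eq_iff_eq_add] at hv
  rw [hv]
  ring

end Ring

end WeierstrassCurve

namespace WeierstrassCurve

open Substitution

section Transfer

variable {A K B A₀ K₀ B₀ R S G : Type*} [CommRing A] [Field K] [Algebra A K] [CommRing B]
  [Algebra A B] [Group G] [Fintype G] [MulSemiringAction G B] [CommRing A₀] [Field K₀]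
  [Algebra A₀ K₀] [CommRing B₀] [Algebra A₀ B₀] [MulSemiringAction G B₀] [CommRing R] [CommRing S]
  {p : A →+* R} {p₀ : A₀ →+* R} {q : B →+* S} {q₀ : B₀ →+* S} {γ : G → S →+* S}
  {W : WeierstrassCurve A} {W₀ : WeierstrassCurve A₀} {W' : WeierstrassCurve B}
  {W₀' : WeierstrassCurve B₀} {D : G → VariableChange B} {D₀ : G → VariableChange B₀}
  {c : Substitution B} {c₀ : Substitution B₀} {ϖ : A} {ϖ₀ : A₀} {j M : ℕ} {H : VariableChange S}

theorem IsDescent.algebraMap_Δ (h : IsDescent K W W' D c ϖ j) :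
    algebraMap A B W.Δ = c.u ^ 12 * W'.Δ := by
  rw [← map_Δ, ← h.apply_eq, apply_Δ]

/-- The minimal equation `W` has an integral transform `V` which is close to a lift `X` of the
reduction of the minimal equation `W₀`, and has a scaling factor `x` close to the one of `W₀`. -/
theorem IsDescent.exists_close (L : Type*) [IsDomain A] [IsDiscreteValuationRing A]
    [IsFractionRing A K] [Field L] [Algebra K L] [Algebra A L] [IsScalarTower A K L] [IsDomain B]
    [IsIntegrallyClosed B] [FaithfulSMul A B] [Algebra.IsIntegral A B] [Algebra B L]
    [IsScalarTower A B L] [IsFractionRing B L] [IsIntegralClosure B A L] [MulSemiringAction G L]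
    [IsGaloisGroup G K L] [SMulDistribClass G B L]
    (h : IsDescent K W W' D c ϖ j) (h₀ : IsDescent K₀ W₀ W₀' D₀ c₀ ϖ₀ j)
    (hl : IsLink p₀ p q₀ q γ W₀' W' D₀ D ϖ₀ ϖ M H) (hM : 4 * j + 2 < M) :
    ∃ (V X : WeierstrassCurve A) (Q : VariableChange K) (x v : B),
      Q • W.map (algebraMap A K) = V.map (algebraMap A K) ∧ IsUnit v ∧
      algebraMap A B V.Δ = (x * v) ^ 12 * W'.Δ ∧ X.map p = W₀.map p₀ ∧
      V.map (Ideal.Quotient.mk (Ideal.span {ϖ ^ (M - (j + 1) - 3 * j)})) =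
        X.map (Ideal.Quotient.mk (Ideal.span {ϖ ^ (M - (j + 1) - 3 * j)})) ∧
      q x = H.u * q₀ c₀.u ∧ x ∣ algebraMap A B ϖ ^ (j + 1) ∧ c.u ∣ x := by
  obtain ⟨d, X, hX, hdu, hd, hdX⟩ := hl.exists_approximate_descent h₀.apply_eq h₀.mul_map_eq
  have hdvd := hl.dvd_pow h.irreducible (by omega) h₀.u_dvd hdu
  obtain ⟨b, hb⟩ := h.exists_sum_smul_eq
  obtain ⟨V, Q, v, hQ, hv, hΔ, hV⟩ := exists_close_model (K := K) L h.apply_eq h.mul_map_eq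
    h.irreducible hb (k := j + 1) (M := M) (by omega) (by omega) h.u_dvd hdvd hl.ker_eq₀ hd hdX
  refine ⟨V, X, Q, d.u, v, hQ, hv, hΔ, hX, hV, hdu, hdvd, ?_⟩
  -- Minimality of `W` compares its discriminant with that of `V`; cancelling `W'.Δ`, taking twelfth
  -- roots and removing the unit `v` gives `c.u ∣ x`.
  have h1 := map_dvd (algebraMap A B) (h.Δ_dvd V Q hQ)
  rw [h.algebraMap_Δ, hΔ] at h1
  have hW' : W'.Δ ≠ 0 := by
    intro h0
    have := h.algebraMap_Δ
    rw [h0, mul_zero, map_eq_zero_iff _ (FaithfulSMul.algebraMap_injective A B)] at this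
    exact h.Δ_ne_zero this
  exact hv.dvd_mul_right.mp ((IsIntegrallyClosed.pow_dvd_pow_iff (by norm_num)).mp
    ((mul_dvd_mul_iff_right hW').mp h1))

end Transfer

/-- Minimal equations over `A` and `A₀` coming from linked equations over `B` and `B₀` agree up to
an integral change of variables modulo a power of the uniformizer. -/
theorem IsDescent.exists_variableChange {A K L B A₀ K₀ L₀ B₀ R S G : Type u} [CommRing A]
    [IsDomain A] [IsDiscreteValuationRing A] [Field K] [Algebra A K] [IsFractionRing A K] [Field L]
    [Algebra K L] [Algebra A L] [IsScalarTower A K L] [CommRing B] [IsDomain B]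
    [IsIntegrallyClosed B] [Algebra A B] [FaithfulSMul A B] [Algebra B L]
    [IsScalarTower A B L] [IsFractionRing B L] [IsIntegralClosure B A L] [Group G] [Fintype G]
    [MulSemiringAction G L] [IsGaloisGroup G K L] [MulSemiringAction G B] [SMulDistribClass G B L]
    [CommRing A₀] [IsDomain A₀] [IsDiscreteValuationRing A₀] [Field K₀] [Algebra A₀ K₀]
    [IsFractionRing A₀ K₀] [Field L₀] [Algebra K₀ L₀] [Algebra A₀ L₀] [IsScalarTower A₀ K₀ L₀]
    [CommRing B₀] [IsDomain B₀] [IsIntegrallyClosed B₀] [Algebra A₀ B₀] [FaithfulSMul A₀ B₀]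
    [Algebra B₀ L₀] [IsScalarTower A₀ B₀ L₀] [IsFractionRing B₀ L₀]
    [IsIntegralClosure B₀ A₀ L₀] [MulSemiringAction G L₀] [IsGaloisGroup G K₀ L₀]
    [MulSemiringAction G B₀] [SMulDistribClass G B₀ L₀] [CommRing R] [CommRing S]
    {p : A →+* R} {p₀ : A₀ →+* R} {q : B →+* S} {q₀ : B₀ →+* S} {γ : G → S →+* S}
    {W : WeierstrassCurve A} {W₀ : WeierstrassCurve A₀} {W' : WeierstrassCurve B}
    {W₀' : WeierstrassCurve B₀} {D : G → VariableChange B} {D₀ : G → VariableChange B₀}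
    {c : Substitution B} {c₀ : Substitution B₀} {ϖ : A} {ϖ₀ : A₀} {j M : ℕ} {H : VariableChange S}
    (h : IsDescent K W W' D c ϖ j) (h₀ : IsDescent K₀ W₀ W₀' D₀ c₀ ϖ₀ j)
    (hl : IsLink p p₀ q q₀ γ W' W₀' D D₀ ϖ ϖ₀ M H) (hM : 4 * j + 2 < M) :
    ∃ (X : WeierstrassCurve A₀) (C : VariableChange A₀), X.map p₀ = W.map p ∧
      (C • X).map (Ideal.Quotient.mk (Ideal.span {ϖ₀ ^ (M - (j + 1) - 3 * j)})) =
        W₀.map (Ideal.Quotient.mk (Ideal.span {ϖ₀ ^ (M - (j + 1) - 3 * j)})) := by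
  have := IsIntegralClosure.isIntegral_algebra A (A := B) L
  have := IsIntegralClosure.isIntegral_algebra A₀ (A := B₀) L₀
  -- From the direction with the roles of the two fields exchanged only the divisibility of scaling
  -- factors is kept.
  obtain ⟨-, -, -, y, -, -, -, -, -, -, hy, -, hcy⟩ := h.exists_close L h₀ hl.symm hM
  obtain ⟨V, X, Q, x, v, hQ, hv, hΔ, hX, hV, hx, hxϖ, hcx⟩ := h₀.exists_close L₀ h hl hM
  -- Through the link, `c.u ∣ y` becomes `x ∣ c₀.u` modulo `ϖ₀ ^ M`. The congruence is a true
  -- divisibility because `x` itself divides `ϖ₀ ^ M`.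
  have hxc : x ∣ c₀.u := by
    obtain ⟨z, rfl⟩ := hcy
    obtain ⟨w, hw⟩ := hl.surjective_right₀ (q z)
    have h1 : q₀ (x * w) = q₀ c₀.u := by
      rw [_root_.map_mul, hx, hw, mul_assoc, ← _root_.map_mul, hy, ← mul_assoc]
      exact (congrArg (· * q₀ c₀.u) H.u.mul_inv).trans (one_mul _)
    rw [← sub_eq_zero, ← map_sub, ← RingHom.mem_ker, hl.ker_eq₀, Ideal.mem_span_singleton] at h1
    exact (dvd_sub_right (dvd_mul_right x w)).mp
      ((hxϖ.trans (pow_dvd_pow _ (by omega))).trans h1)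
  have hVW : V.Δ ∣ W₀.Δ := by
    refine dvd_of_algebraMap_dvd (B := B₀) ?_
    rw [hΔ, h₀.algebraMap_Δ]
    exact mul_dvd_mul_right (pow_dvd_pow_of_dvd (hv.mul_right_dvd.mpr hxc) 12) _
  have hQ' : Q⁻¹ • V.map (algebraMap A₀ K₀) = W₀.map (algebraMap A₀ K₀) := by
    rw [inv_smul_eq_iff, hQ]
  obtain ⟨C, -, hC⟩ := exists_integral_change hQ'
    (fun h0 => h₀.Δ_ne_zero (zero_dvd_iff.mp (h0 ▸ hVW)))
    (associated_of_dvd_dvd hVW (h₀.Δ_dvd V Q hQ))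
  refine ⟨X, C, hX, ?_⟩
  rw [← map_variableChange, ← hV, map_variableChange, hC]

end WeierstrassCurve

/-! ### Reductions modulo powers of the uniformizer. -/

section Level

open WeierstrassCurve

theorem WeierstrassCurve.level_eq_span {A B : Type u} [CommRing A] [IsDomain A]
    [IsDiscreteValuationRing A] [CommRing B] [Algebra A B] {ϖ : A} (hϖ : Irreducible ϖ) (n : ℕ) :
    level A B n = Ideal.span {algebraMap A B ϖ ^ (n + 1)} := by
  rw [level, hϖ.maximalIdeal_eq, Ideal.span_singleton_pow, Ideal.map_span, Set.image_singleton,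
    map_pow]

theorem WeierstrassCurve.mk_level_eq_mk_iff {A B : Type u} [CommRing A] [IsDomain A]
    [IsDiscreteValuationRing A] [CommRing B] [Algebra A B] {ϖ : A} (hϖ : Irreducible ϖ) {n : ℕ}
    {x y : B} : Ideal.Quotient.mk (level A B n) x = Ideal.Quotient.mk (level A B n) y ↔
      algebraMap A B ϖ ^ (n + 1) ∣ x - y := by
  rw [Ideal.Quotient.eq, level_eq_span hϖ, Ideal.mem_span_singleton]

theorem WeierstrassCurve.level_antitone {A B : Type u} [CommRing A] [IsLocalRing A] [CommRing B]
    [Algebra A B] {n m : ℕ} (h : n ≤ m) : level A B m ≤ level A B n :=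
  Ideal.map_mono (Ideal.pow_le_pow_right (by omega))

variable {A A₀ : Type u} [CommRing A] [IsDomain A] [IsDiscreteValuationRing A] [CommRing A₀]
  [IsDomain A₀] [IsDiscreteValuationRing A₀] {m : ℕ} (ψ : A ⧸ level A A m ≃+* A₀ ⧸ level A₀ A₀ m)

theorem WeierstrassCurve.isUnit_mk_level_iff {a : A} :
    IsUnit (Ideal.Quotient.mk (level A A m) a) ↔ IsUnit a := by
  obtain ⟨ϖ, hϖ⟩ := IsDiscreteValuationRing.exists_irreducible A
  refine ⟨fun h => ?_, fun h => h.map _⟩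
  refine isUnit_of_isUnit_mk (n := m + 1) (A := A) (B := A)
    ((IsLocalRing.mem_maximalIdeal _).mpr hϖ.not_isUnit) (by omega) ?_
  rwa [← level_eq_span hϖ]

/-- Lifts of uniformizers are uniformizers. -/
theorem WeierstrassCurve.irreducible_of_map_mk_eq (hm : m ≠ 0) {ϖ : A} (hϖ : Irreducible ϖ)
    {ϖ₀ : A₀} (h : ψ (Ideal.Quotient.mk _ ϖ) = Ideal.Quotient.mk _ ϖ₀) : Irreducible ϖ₀ := by
  obtain ⟨p₀, hp₀⟩ := IsDiscreteValuationRing.exists_irreducible A₀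
  have dvd_of {A : Type u} [CommRing A] [IsDomain A] [IsDiscreteValuationRing A] {ϖ a : A}
      (hϖ : Irreducible ϖ) (ha : ¬ IsUnit a) : ϖ ∣ a := by
    rw [← Ideal.mem_span_singleton, ← hϖ.maximalIdeal_eq]
    exact ha
  have hunit : ¬ IsUnit ϖ₀ := by
    rw [← isUnit_mk_level_iff (m := m), ← h, MulEquiv.isUnit_map, isUnit_mk_level_iff]
    exact hϖ.not_isUnit
  refine (associated_of_dvd_dvd (dvd_of hp₀ hunit) ?_).irreducible hp₀
  obtain ⟨p, hp⟩ := Ideal.Quotient.mk_surjective (ψ.symm (Ideal.Quotient.mk _ p₀))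
  rw [RingEquiv.eq_symm_apply] at hp
  obtain ⟨a, rfl⟩ := dvd_of hϖ (a := p) (by
    rw [← isUnit_mk_level_iff (m := m), ← MulEquiv.isUnit_map ψ, hp, isUnit_mk_level_iff]
    exact hp₀.not_isUnit)
  obtain ⟨a₀, ha₀⟩ := Ideal.Quotient.mk_surjective (ψ (Ideal.Quotient.mk _ a))
  rw [map_mul, map_mul, h, ← ha₀, ← map_mul, mk_level_eq_mk_iff hp₀] at hp
  obtain ⟨z, hz⟩ := hp
  -- The modulus is `p₀ ^ (m + 1)`, so `m ≠ 0` leaves an error divisible by `p₀ ^ 2`, which is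
  -- absorbed into a unit factor of `p₀`.
  obtain ⟨i, rfl⟩ := Nat.exists_eq_add_one_of_ne_zero hm
  have hu : IsUnit (1 + algebraMap A₀ A₀ p₀ * (p₀ ^ i * z)) :=
    isUnit_one_add_mul ((IsLocalRing.mem_maximalIdeal _).mpr hp₀.not_isUnit) _
  refine hu.dvd_mul_right.mp ⟨a₀, ?_⟩
  rw [Algebra.algebraMap_self_apply] at hz ⊢
  rw [sub_eq_iff_eq_add] at hz
  rw [hz]
  ring

theorem WeierstrassCurve.mem_level_of_map_mk_eq {ϖ : A} (hϖ : Irreducible ϖ) {ϖ₀ : A₀}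
    (hϖ₀ : Irreducible ϖ₀) (h : ψ (Ideal.Quotient.mk _ ϖ) = Ideal.Quotient.mk _ ϖ₀) {n : ℕ}
    (hn : n ≤ m) {a : A} {a₀ : A₀} (ha : ψ (Ideal.Quotient.mk _ a) = Ideal.Quotient.mk _ a₀)
    (hmem : a ∈ level A A n) : a₀ ∈ level A₀ A₀ n := by
  rw [level_eq_span hϖ, Ideal.mem_span_singleton, Algebra.algebraMap_self_apply] at hmem
  obtain ⟨y, rfl⟩ := hmem
  obtain ⟨y₀, hy₀⟩ := Ideal.Quotient.mk_surjective (ψ (Ideal.Quotient.mk _ y))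
  rw [map_mul, map_pow, map_mul, map_pow, h, ← hy₀, ← map_pow, ← map_mul, eq_comm,
    Ideal.Quotient.eq] at ha
  refine (Submodule.sub_mem_iff_left _ ?_).mp (level_antitone hn ha)
  rw [level_eq_span hϖ₀, Ideal.mem_span_singleton, Algebra.algebraMap_self_apply]
  exact dvd_mul_right _ _

/-- The isomorphism of lower level induced by an isomorphism of finite level. -/
theorem WeierstrassCurve.exists_level_ringEquiv (hm : m ≠ 0) {n : ℕ} (hn : n ≤ m) :
    ∃ ψn : A ⧸ level A A n ≃+* A₀ ⧸ level A₀ A₀ n,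
      ∀ (a : A) (a₀ : A₀), ψ (Ideal.Quotient.mk _ a) = Ideal.Quotient.mk _ a₀ →
        ψn (Ideal.Quotient.mk _ a) = Ideal.Quotient.mk _ a₀ := by
  obtain ⟨ϖ, hϖ⟩ := IsDiscreteValuationRing.exists_irreducible A
  obtain ⟨ϖ₀, h⟩ := Ideal.Quotient.mk_surjective (ψ (Ideal.Quotient.mk _ ϖ))
  have hϖ₀ := irreducible_of_map_mk_eq ψ hm hϖ h.symm
  let f : A →+* A₀ ⧸ level A₀ A₀ n := (Ideal.Quotient.factor (level_antitone hn)).comp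
    (ψ.toRingHom.comp (Ideal.Quotient.mk (level A A m)))
  have hf (a : A) (a₀ : A₀) (ha : ψ (Ideal.Quotient.mk _ a) = Ideal.Quotient.mk _ a₀) :
      f a = Ideal.Quotient.mk _ a₀ := by
    change Ideal.Quotient.factor (level_antitone hn) (ψ (Ideal.Quotient.mk _ a)) = _
    rw [ha, Ideal.Quotient.factor_mk]
  have hsurj : Function.Surjective f :=
    (Ideal.Quotient.factor_surjective (level_antitone hn)).comp
      (ψ.surjective.comp Ideal.Quotient.mk_surjective)
  have hker : level A A n = RingHom.ker f := by
    ext a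
    obtain ⟨a₀, ha⟩ := Ideal.Quotient.mk_surjective (ψ (Ideal.Quotient.mk _ a))
    rw [RingHom.mem_ker, hf a a₀ ha.symm, Ideal.Quotient.eq_zero_iff_mem]
    refine ⟨mem_level_of_map_mk_eq ψ hϖ hϖ₀ h.symm hn ha.symm,
      mem_level_of_map_mk_eq ψ.symm hϖ₀ hϖ ?_ hn ?_⟩
    · rw [h, RingEquiv.symm_apply_apply]
    · rw [ha, RingEquiv.symm_apply_apply]
  refine ⟨(Ideal.quotEquivOfEq hker).trans (RingHom.quotientKerEquivOfSurjective hsurj),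
    fun a a₀ ha => ?_⟩
  rw [RingEquiv.trans_apply, Ideal.quotEquivOfEq_mk]
  exact hf a a₀ ha

/-- Elements of trace a power of the uniformizer can be lifted. -/
theorem WeierstrassCurve.exists_sum_smul_eq_of_map_mk_eq {B B₀ G : Type u} [CommRing B]
    [Algebra A B] [CommRing B₀] [IsDomain B₀] [Algebra A₀ B₀] [FaithfulSMul A₀ B₀]
    [Algebra.IsIntegral A₀ B₀] [Group G] [Fintype G] [MulSemiringAction G B]
    [MulSemiringAction G B₀] [SMulCommClass G A₀ B₀] {ϖ : A} {ϖ₀ : A₀} (hϖ₀ : Irreducible ϖ₀)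
    (θ : B ⧸ level A B m ≃+* B₀ ⧸ level A₀ B₀ m)
    (hθ : ∀ (g : G) (b : B) (b₀ : B₀), θ (Ideal.Quotient.mk _ b) = Ideal.Quotient.mk _ b₀ →
      θ (Ideal.Quotient.mk _ (g • b)) = Ideal.Quotient.mk _ (g • b₀))
    (h : θ (Ideal.Quotient.mk _ (algebraMap A B ϖ)) = Ideal.Quotient.mk _ (algebraMap A₀ B₀ ϖ₀))
    {b : B} {j : ℕ} (hj : j ≤ m) (hb : ∑ g : G, g • b = algebraMap A B ϖ ^ j) :
    ∃ b₀ : B₀, ∑ g : G, g • b₀ = algebraMap A₀ B₀ ϖ₀ ^ j := by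
  obtain ⟨b₀, hb₀⟩ := Ideal.Quotient.mk_surjective (θ (Ideal.Quotient.mk _ b))
  have h1 : Ideal.Quotient.mk (level A₀ B₀ m) (∑ g : G, g • b₀) =
      Ideal.Quotient.mk _ (algebraMap A₀ B₀ ϖ₀ ^ j) := by
    rw [map_pow, ← h, ← map_pow, ← map_pow, ← hb, map_sum, map_sum, map_sum]
    exact Finset.sum_congr rfl fun g _ => (hθ g b b₀ hb₀.symm).symm
  rw [mk_level_eq_mk_iff hϖ₀] at h1
  obtain ⟨z, hz⟩ := h1
  obtain ⟨i, rfl⟩ := Nat.exists_eq_add_of_le hj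
  -- The trace of a lift of the image of `b` is `ϖ₀ ^ j` up to `ϖ₀ ^ (m + 1)`, hence `ϖ₀ ^ j` times
  -- a unit `v` since `j ≤ m`. This unit is invariant, so dividing the lift by `v` corrects its
  -- trace.
  obtain ⟨v, hv⟩ : IsUnit (1 + algebraMap A₀ B₀ ϖ₀ * (algebraMap A₀ B₀ ϖ₀ ^ i * z)) :=
    isUnit_one_add_mul ((IsLocalRing.mem_maximalIdeal _).mpr hϖ₀.not_isUnit) _
  have hsum : ∑ g : G, g • b₀ = algebraMap A₀ B₀ ϖ₀ ^ j * v := by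
    rw [sub_eq_iff_eq_add] at hz
    rw [hz, hv]
    ring
  have hπ : algebraMap A₀ B₀ ϖ₀ ^ j ≠ 0 := pow_ne_zero _ (by simpa using hϖ₀.ne_zero)
  have hvg (g : G) : g • (v : B₀) = v := by
    refine mul_left_cancel₀ hπ ?_
    have h2 : g • (algebraMap A₀ B₀ ϖ₀ ^ j * (v : B₀)) = algebraMap A₀ B₀ ϖ₀ ^ j * v := by
      rw [← hsum, Finset.smul_sum]
      simp only [smul_smul]
      exact Fintype.sum_equiv (Equiv.mulLeft g) _ _ fun _ => rfl
    rwa [smul_mul', smul_pow', smul_algebraMap] at h2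
  have hvg' (g : G) : g • ((v⁻¹ : B₀ˣ) : B₀) = ((v⁻¹ : B₀ˣ) : B₀) := by
    refine v.isUnit.mul_left_cancel ?_
    conv_lhs => rw [← hvg g]
    rw [← smul_mul', Units.mul_inv, smul_one]
  refine ⟨b₀ * ((v⁻¹ : B₀ˣ) : B₀), ?_⟩
  simp only [smul_mul', hvg']
  rw [← Finset.sum_mul, hsum, mul_assoc, Units.mul_inv, mul_one]

end Level

/-! ### Assembly of the proof. -/

namespace WeierstrassCurve

/-- The scaling factor between the minimal models of `E` over `A` and of `E_L` over `B` is bounded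
in terms of the traces of the elements of `B`. -/
theorem Model.exists_isDescent {A K B L G : Type u} [CommRing A] [IsDomain A]
    [IsDiscreteValuationRing A] [Field K] [Algebra A K] [IsFractionRing A K] [CommRing B]
    [IsDomain B] [IsIntegrallyClosed B] [Algebra A B] [FaithfulSMul A B] [Field L] [Algebra K L]
    [Algebra A L] [Algebra B L] [IsScalarTower A B L] [IsScalarTower A K L] [IsFractionRing B L]
    [IsIntegralClosure B A L] [Group G] [Fintype G] [MulSemiringAction G B] [MulSemiringAction G L]
    [SMulDistribClass G B L] [IsGaloisGroup G K L] {E : WeierstrassCurve K} [E.IsElliptic]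
    (W : Model A E) (hW : W.IsMinimal) (W' : Model B (E.map (algebraMap K L)))
    (hW' : W'.IsMinimal) {ϖ : A} (hϖ : Irreducible ϖ) {b : B} {j : ℕ}
    (hb : ∑ g : G, g • b = algebraMap A B ϖ ^ j) :
    ∃ c : Substitution B, IsDescent K W.eqn W'.eqn (W'.galoisChange (G := G) hW') c ϖ j := by
  obtain ⟨c, hc, hD⟩ := Model.exists_substitution (G := G) W W' hW'
  have := IsIntegralClosure.isIntegral_algebra A (A := B) L
  have := IsGaloisGroup.of_isFractionRing G A B K L
  have hmin (V : WeierstrassCurve A) (Q : VariableChange K)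
      (h : Q • W.eqn.map (algebraMap A K) = V.map (algebraMap A K)) : W.eqn.Δ ∣ V.Δ :=
    hW.Δ_dvd h
  exact ⟨c, hϖ, W.Δ_ne_zero, hmin, hc, hD, ⟨b, hb⟩, u_dvd_pow hc hD W.Δ_ne_zero hmin hϖ
    fun n x hn hx => exists_close_of_dvd_sub_smul K L hϖ.ne_zero hb hn hx⟩

end WeierstrassCurve

theorem theorem2p3p2
    -- the discrete valuation field `K` with valuation ring `A = O_K` and perfect residue field
    {A K : Type u} [CommRing A] [IsDomain A] [IsDiscreteValuationRing A] [Field K] [Algebra A K]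
    [IsFractionRing A K] [PerfectField (IsLocalRing.ResidueField A)]
    -- the finite Galois extension `L / K` of group `G`, and the integral closure `B = O_L`
    {L B G : Type u} [Field L] [Algebra K L] [Algebra A L] [IsScalarTower A K L]
    [Group G] [Finite G] [MulSemiringAction G L] [IsGaloisGroup G K L]
    [CommRing B] [IsDedekindDomain B] [Algebra A B] [Module.IsTorsionFree A B] [Algebra B L]
    [IsScalarTower A B L] [IsFractionRing B L] [IsIntegralClosure B A L]
    [MulSemiringAction G B] [SMulDistribClass G B L]
    -- the elliptic curve `E / K`, its minimal Weierstrass models `W` over `O_K` and `W'` over `O_L`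
    (E : WeierstrassCurve K) [E.IsElliptic]
    (W : WeierstrassCurve.Model A E) (hW : W.IsMinimal)
    (W' : WeierstrassCurve.Model B (E.map (algebraMap K L))) (hW' : W'.IsMinimal)
    -- the analogous objects over a second discrete valuation field `K₀`, with the same group `G`
    {A₀ K₀ : Type u} [CommRing A₀] [IsDomain A₀] [IsDiscreteValuationRing A₀] [Field K₀]
    [Algebra A₀ K₀] [IsFractionRing A₀ K₀] [PerfectField (IsLocalRing.ResidueField A₀)]
    {L₀ B₀ : Type u} [Field L₀] [Algebra K₀ L₀] [Algebra A₀ L₀] [IsScalarTower A₀ K₀ L₀]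
    [MulSemiringAction G L₀] [IsGaloisGroup G K₀ L₀]
    [CommRing B₀] [IsDedekindDomain B₀] [Algebra A₀ B₀] [Module.IsTorsionFree A₀ B₀] [Algebra B₀ L₀]
    [IsScalarTower A₀ B₀ L₀] [IsFractionRing B₀ L₀] [IsIntegralClosure B₀ A₀ L₀]
    [MulSemiringAction G B₀] [SMulDistribClass G B₀ L₀]
    (E₀ : WeierstrassCurve K₀) [E₀.IsElliptic]
    (W₀ : WeierstrassCurve.Model A₀ E₀) (hW₀ : W₀.IsMinimal)
    (W₀' : WeierstrassCurve.Model B₀ (E₀.map (algebraMap K₀ L₀))) (hW₀' : W₀'.IsMinimal)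
    -- the integers `N ≥ 0` and `m ≥ N + 12 [v_K(𝔇)] + 19`
    (N m : ℕ) (P : Ideal B) [P.IsMaximal] (hm : N + 12 * ⌊valDifferent A P⌋₊ + 19 ≤ m)
    -- compatible `G`-equivariant isomorphisms `O_{K,m} ≃ O_{K₀,m}`, `O_{L,m} ≃ O_{L₀,m}` and
    -- `W'_m ≃ W'_{0,m}`, the last one preserving the sections
    (ψ : A ⧸ WeierstrassCurve.level A A m ≃+* A₀ ⧸ WeierstrassCurve.level A₀ A₀ m)
    (θ : B ⧸ WeierstrassCurve.level A B m ≃+* B₀ ⧸ WeierstrassCurve.level A₀ B₀ m)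
    (hψθ : ∀ (a : A) (a₀ : A₀), ψ (Ideal.Quotient.mk _ a) = Ideal.Quotient.mk _ a₀ →
      θ (Ideal.Quotient.mk _ (algebraMap A B a)) = Ideal.Quotient.mk _ (algebraMap A₀ B₀ a₀))
    (hθ : ∀ (g : G) (b : B) (b₀ : B₀), θ (Ideal.Quotient.mk _ b) = Ideal.Quotient.mk _ b₀ →
      θ (Ideal.Quotient.mk _ (g • b)) = Ideal.Quotient.mk _ (g • b₀))
    (Φ : WeierstrassCurve.PointedFiberIso W'.eqn (WeierstrassCurve.level A B m)
      W₀'.eqn (WeierstrassCurve.level A₀ B₀ m) θ)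
    (hΦ : ∀ g : G, W'.galoisLevelMap A hW' m g ≫ Φ.iso.hom =
      Φ.iso.hom ≫ W₀'.galoisLevelMap A₀ hW₀' m g) :
    -- `W_N ≃ W_{0,N}` as pointed schemes, over the isomorphism `O_{K,N} ≃ O_{K₀,N}` induced by `ψ`
    ∃ ψN : A ⧸ WeierstrassCurve.level A A N ≃+* A₀ ⧸ WeierstrassCurve.level A₀ A₀ N,
      (∀ (a : A) (a₀ : A₀), ψ (Ideal.Quotient.mk _ a) = Ideal.Quotient.mk _ a₀ →
        ψN (Ideal.Quotient.mk _ a) = Ideal.Quotient.mk _ a₀) ∧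
      Nonempty (WeierstrassCurve.PointedFiberIso W.eqn (WeierstrassCurve.level A A N)
        W₀.eqn (WeierstrassCurve.level A₀ A₀ N) ψN) := by
  have := Fintype.ofFinite G
  have := IsIntegralClosure.isIntegral_algebra A (A := B) L
  have := IsIntegralClosure.isIntegral_algebra A₀ (A := B₀) L₀
  have := IsGaloisGroup.of_isFractionRing G A₀ B₀ K₀ L₀
  obtain ⟨ϖ, hϖ⟩ := IsDiscreteValuationRing.exists_irreducible A
  obtain ⟨ϖ₀, hψϖ⟩ := Ideal.Quotient.mk_surjective (ψ (Ideal.Quotient.mk _ ϖ))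
  have hϖ₀ := WeierstrassCurve.irreducible_of_map_mk_eq ψ (by omega) hϖ hψϖ.symm
  obtain ⟨b, j, hb, hj⟩ := exists_sum_smul_eq_pow K L G hϖ P
  rw [map_pow] at hb
  -- The same exponent `j` serves for both fields, so the different of `L / K` alone bounds the
  -- losses.
  obtain ⟨b₀, hb₀⟩ := WeierstrassCurve.exists_sum_smul_eq_of_map_mk_eq hϖ₀ θ hθ
    (hψθ _ _ hψϖ.symm) (by omega) hb
  obtain ⟨c, hc⟩ := W.exists_isDescent hW W' hW' hϖ hb
  obtain ⟨c₀, hc₀⟩ := W₀.exists_isDescent hW₀ W₀' hW₀' hϖ₀ hb₀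
  obtain ⟨H, hH, hΦH⟩ := Φ.exists_variableChange
  have hθg (g : G) : θ.toRingHom.comp (Ideal.quotientMap _ (MulSemiringAction.toRingHom G B g)
      (WeierstrassCurve.level_le_comap A K B L m g)) =
      (Ideal.quotientMap _ (MulSemiringAction.toRingHom G B₀ g)
        (WeierstrassCurve.level_le_comap A₀ K₀ B₀ L₀ m g)).comp θ.toRingHom := by
    refine Ideal.Quotient.ringHom_ext (RingHom.ext fun x => ?_)
    obtain ⟨y, hy⟩ := Ideal.Quotient.mk_surjective (θ (Ideal.Quotient.mk _ x))
    change θ (Ideal.Quotient.mk _ (g • x)) =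
      Ideal.quotientMap _ _ (WeierstrassCurve.level_le_comap A₀ K₀ B₀ L₀ m g)
        (θ (Ideal.Quotient.mk _ x))
    rw [← hy, hθ g x y hy.symm]
    rfl
  -- The common quotients are those of `A₀` and `B₀`, reached from `A` and `B` through `ψ` and `θ`.
  -- The precision is `m + 1` because level `m` means modulo the uniformizer to the power `m + 1`.
  have hlink : WeierstrassCurve.IsLink (ψ.toRingHom.comp (Ideal.Quotient.mk _))
      (Ideal.Quotient.mk (WeierstrassCurve.level A₀ A₀ m))
      (θ.toRingHom.comp (Ideal.Quotient.mk _))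
      (Ideal.Quotient.mk (WeierstrassCurve.level A₀ B₀ m))
      (fun g : G => Ideal.quotientMap _ (MulSemiringAction.toRingHom G B₀ g)
        (WeierstrassCurve.level_le_comap A₀ K₀ B₀ L₀ m g))
      W'.eqn W₀'.eqn (W'.galoisChange hW') (W₀'.galoisChange hW₀') ϖ ϖ₀ (m + 1) H :=
    { surjective_left := ψ.surjective.comp Ideal.Quotient.mk_surjective
      surjective_left₀ := Ideal.Quotient.mk_surjective
      surjective_right := θ.surjective.comp Ideal.Quotient.mk_surjective
      surjective_right₀ := Ideal.Quotient.mk_surjective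
      ker_eq := by
        rw [← WeierstrassCurve.level_eq_span hϖ]
        exact (RingHom.ker_comp_of_injective _ θ.injective).trans Ideal.mk_ker
      ker_eq₀ := by rw [← WeierstrassCurve.level_eq_span hϖ₀, Ideal.mk_ker]
      eq_of_eq := hψθ
      uniformizer_eq := hψϖ.symm
      comp_eq := fun g => by
        rw [← RingHom.comp_assoc, ← hθg, RingHom.comp_assoc, Ideal.quotientMap_comp_mk,
          RingHom.comp_assoc]
      comp_eq₀ := fun g => Ideal.quotientMap_comp_mk _
      smul_eq := hH
      mul_eq := fun g => WeierstrassCurve.galoisChange_relation Φ hH hΦH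
        (W'.galoisChange_smul hW' g) (WeierstrassCurve.level_le_comap A K B L m g)
        (W₀'.galoisChange_smul hW₀' g) (WeierstrassCurve.level_le_comap A₀ K₀ B₀ L₀ m g)
        (hθg g) (hΦ g) }
  obtain ⟨X, C, hX, hC⟩ := hc.exists_variableChange (L := L) (L₀ := L₀) hc₀ hlink (by omega)
  obtain ⟨ψN, hψN⟩ := WeierstrassCurve.exists_level_ringEquiv ψ (by omega) (by omega : N ≤ m)
  refine ⟨ψN, hψN, ⟨WeierstrassCurve.pointedFiberIso ψN
    (C := C.map (Ideal.Quotient.mk (WeierstrassCurve.level A₀ A₀ N))) ?_⟩⟩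
  have hXN : (W.eqn.map (Ideal.Quotient.mk _)).map ψN.toRingHom =
      X.map (Ideal.Quotient.mk (WeierstrassCurve.level A₀ A₀ N)) :=
    WeierstrassCurve.ext (hψN _ _ (congrArg WeierstrassCurve.a₁ hX).symm)
      (hψN _ _ (congrArg WeierstrassCurve.a₂ hX).symm)
      (hψN _ _ (congrArg WeierstrassCurve.a₃ hX).symm)
      (hψN _ _ (congrArg WeierstrassCurve.a₄ hX).symm)
      (hψN _ _ (congrArg WeierstrassCurve.a₆ hX).symm)
  rw [hXN, WeierstrassCurve.map_variableChange]
  refine WeierstrassCurve.map_eq_map_of_ker_le ?_ hC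
  rw [Ideal.mk_ker, Ideal.mk_ker, WeierstrassCurve.level_eq_span hϖ₀]
  -- The exponent `m + 1 - (j + 1) - 3 * j` is at least `N + 1`, since `j` is at most the integral
  -- part of the valuation of the different.
  exact Ideal.span_singleton_le_span_singleton.mpr (pow_dvd_pow _ (by omega))
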